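/- A \emph{partially reflexive graph} is a finite undirected graph without multiple edges in which each vertex may or may not have a self-loop; a vertex is \emph{reflexive} if it has a self-loop and \emph{irreflexive} otherwise. Neighbourhoods $N(v)$, degrees and subgraph containment refer to the underlying loopless simple graph. A \emph{cutset} of $G$ is a nonempty set $C\subseteq V(G)$ such that $G-C$ is disconnected. A \emph{partially reflexive stable cut} is a cutset that is a stable (independent) set and contains only irreflexive vertices; equivalently, it is the preimage of the middle vertex under a surjective homomorphism from $G$ to the three-vertex path whose two end-vertices are looped and whose middle vertex is loopless. {\sc Partially Reflexive Stable Cut} asks whether a given partially reflexive graph has such a cut. Let $H_1^{2,2,2,1}$ be the $9$-vertex tree with two adjacent vertices of degree $3$, two paths with two edges attached to the first, and one path with two edges and one pendant edge attached to the second. A graph is $\{H_1^{2,2,2,1},C_3\}$-subgraph-free if it contains neither $H_1^{2,2,2,1}$ nor the triangle $C_3$ as a (not necessarily induced) subgraph. \textbf{Theorem.} (a) {\sc Partially Reflexive Stable Cut} is solvable in polynomial time on $\{H_1^{2,2,2,1},C_3\}$-subgraph-free graphs. (b) Let $G$ be an $\{H_1^{2,2,2,1},C_3\}$-subgraph-free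 partially reflexive graph such that: (1) no vertex has degree $1$ and every vertex of degree $2$ is reflexive; (2) no vertex of degree $2$ lies in a triangle; (3) there are no twins, i.e. no distinct $u,v$ with $N(u)\setminus\{v\}=N(v)\setminus\{u\}$; (4) if $u\neq v$ and $N(u)\subseteq N(v)$, then $u$ is reflexive and $v$ is irreflexive; (5) for every $Z\subseteq V(G)$ with $|Z|\le 10$ such that $G[Z]$ is connected and has maximum degree at least $3$, at least three vertices of $Z$ have a neighbour in $V(G)\setminus Z$. Then the set $S$ of irreflexive vertices of $G$ is a stable set, and $G$ has a partially reflexive stable cut if and only if $S$ is a cutset of $G$. -/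

import Mathlib

/-! ### Partially reflexive graphs and stable cuts -/

/-- A partially reflexive graph: an undirected graph without multiple edges in which each vertex
may or may not carry a self-loop. It is given by its underlying irreflexive graph together with
the set of its reflexive (looped) vertices. -/
structure PRGraph (V : Type*) where
  /-- the underlying irreflexive simple graph -/
  graph : SimpleGraph V
  /-- the set of vertices that carry a self-loop -/
  reflexive : Set V

namespace PRGraph

variable {V W : Type*}

/-- The edge relation, loops included. -/
def Edge (G : PRGraph V) (u v : V) : Prop :=
  G.graph.Adj u v ∨ (u = v ∧ u ∈ G.reflexive)

/-- The set of vertices without a self-loop. -/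
def irreflexive (G : PRGraph V) : Set V := G.reflexiveᶜ

/-- A cutset: a nonempty set of vertices whose removal leaves a disconnected graph, i.e. a graph
with two vertices that are not joined by a path. -/
def IsCutset (G : PRGraph V) (C : Set V) : Prop :=
  C.Nonempty ∧ ¬ (G.graph.induce Cᶜ).Preconnected

/-- A partially reflexive stable cut: a cutset which is a stable set and contains no looped
vertex. -/
def IsStableCut (G : PRGraph V) (C : Set V) : Prop :=
  G.IsCutset C ∧ G.graph.IsIndepSet C ∧ C ⊆ G.irreflexive

/-- The yes-instances of Partially Reflexive Stable Cut. -/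
def HasStableCut (G : PRGraph V) : Prop := ∃ C : Set V, G.IsStableCut C

/-- Graph homomorphisms: they map edges to edges and loops to loops. -/
def IsHom (G : PRGraph V) (H : PRGraph W) (f : V → W) : Prop :=
  ∀ u v, G.Edge u v → H.Edge (f u) (f v)

/-- The path on three vertices whose two outer vertices are looped and whose middle vertex
is loopless. -/
def P3101 : PRGraph (Fin 3) where
  graph := SimpleGraph.pathGraph 3
  reflexive := {0, 2}

theorem P3101_edge (a b : Fin 3) :
    P3101.Edge a b ↔ ¬ ((a = 0 ∧ b = 2) ∨ (a = 2 ∧ b = 0) ∨ (a = 1 ∧ b = 1)) := by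
  simp only [Edge, P3101, SimpleGraph.pathGraph_adj, Set.mem_insert_iff, Set.mem_singleton_iff]
  revert a b
  decide

theorem P3101_aux : ∀ t : Fin 3,
    ¬ (((0 : Fin 3) = 0 ∧ t = 2) ∨ ((0 : Fin 3) = 2 ∧ t = 0) ∨ ((0 : Fin 3) = 1 ∧ t = 1)) →
    t ≠ 1 → t = 0 := by
  decide

/-- Having a stable cut is the same as having a surjective homomorphism to `P3101`. -/
theorem hasStableCut_iff_surjective_hom (G : PRGraph V) :
    G.HasStableCut ↔ ∃ f : V → Fin 3, G.IsHom P3101 f ∧ Function.Surjective f := by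
  classical
  constructor
  · rintro ⟨C, ⟨⟨c, hc⟩, hdis⟩, hst, hirr⟩
    simp only [SimpleGraph.Preconnected, not_forall] at hdis
    obtain ⟨a, b, hab⟩ := hdis
    let f : V → Fin 3 := fun v =>
      if h : v ∈ C then 1
      else if (G.graph.induce Cᶜ).Reachable a ⟨v, h⟩ then 0 else 2
    refine ⟨f, ?_, ?_⟩
    · intro u v huv
      rw [P3101_edge]
      by_cases hu : u ∈ C <;> by_cases hv : v ∈ C
      · exfalso
        rcases huv with huv | ⟨-, hl⟩
        · exact hst hu hv huv.ne huv
        · exact hirr hu hl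
      · simp only [f, hu, hv, dif_pos, dif_neg, not_false_eq_true]
        split_ifs <;> simp
      · simp only [f, hu, hv, dif_pos, dif_neg, not_false_eq_true]
        split_ifs <;> simp
      · have key : (G.graph.induce Cᶜ).Reachable a ⟨u, hu⟩ ↔
            (G.graph.induce Cᶜ).Reachable a ⟨v, hv⟩ := by
          rcases huv with huv | ⟨rfl, -⟩
          · have h : (G.graph.induce Cᶜ).Adj ⟨u, hu⟩ ⟨v, hv⟩ := by simpa using huv
            exact ⟨fun h' => h'.trans h.reachable, fun h' => h'.trans h.symm.reachable⟩
          · rfl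
        simp only [f, hu, hv, dif_neg, not_false_eq_true, key]
        split_ifs <;> simp
    · intro y
      fin_cases y
      · refine ⟨a, ?_⟩
        have ha : a.1 ∉ C := a.2
        simp [f, ha]
      · exact ⟨c, by simp [f, hc]⟩
      · refine ⟨b, ?_⟩
        have hb : b.1 ∉ C := b.2
        simp [f, hb, hab]
  · rintro ⟨f, hf, hs⟩
    simp only [IsHom, P3101_edge] at hf
    refine ⟨{v | f v = 1}, ⟨hs 1, ?_⟩, ?_, ?_⟩
    · intro hpre
      obtain ⟨a, ha⟩ := hs 0
      obtain ⟨b, hb⟩ := hs 2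
      have hall : ∀ x y : ({v | f v = 1}ᶜ : Set V),
          (G.graph.induce {v | f v = 1}ᶜ).Walk x y → f x = 0 → f y = 0 := by
        intro x y w
        induction w with
        | nil => exact id
        | @cons x z y h w ih =>
          intro hx
          apply ih
          have h1 := hf x z (Or.inl (by simpa using h))
          have h2 : f z ≠ 1 := z.2
          rw [hx] at h1
          exact P3101_aux _ h1 h2
      obtain ⟨w⟩ := hpre ⟨a, by simp [ha]⟩ ⟨b, by simp [hb]⟩
      have := hall _ _ w ha
      simp [hb] at this
    · intro u hu v hv _ huv
      exact hf u v (Or.inl huv) (Or.inr (Or.inr ⟨hu, hv⟩))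
    · intro u hu hl
      exact hf u u (Or.inr ⟨rfl, hl⟩) (Or.inr (Or.inr ⟨hu, hu⟩))

/-- A preprocessed instance. Neighbourhoods and degrees are those of the underlying irreflexive
graph. -/
structure IsReduced (G : PRGraph V) : Prop where
  /-- no vertex has degree one -/
  degree_ne_one : ∀ v, (G.graph.neighborSet v).ncard ≠ 1
  /-- every vertex of degree two is reflexive -/
  degree_two : ∀ v, (G.graph.neighborSet v).ncard = 2 → v ∈ G.reflexive
  /-- no vertex of degree two lies in a triangle -/
  degree_two_triangle : ∀ v, (G.graph.neighborSet v).ncard = 2 →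
    ¬ ∃ x y, G.graph.Adj v x ∧ G.graph.Adj v y ∧ G.graph.Adj x y
  /-- there are no twins, adjacent or not -/
  no_twins : ∀ u v, u ≠ v → G.graph.neighborSet u \ {v} ≠ G.graph.neighborSet v \ {u}
  /-- nested neighbourhoods occur only for a reflexive vertex below an irreflexive one -/
  nested : ∀ u v, u ≠ v → G.graph.neighborSet u ⊆ G.graph.neighborSet v →
    u ∈ G.reflexive ∧ v ∈ G.irreflexive
  /-- a connected piece with at most ten vertices and maximum degree at least three has at least
  three vertices with a neighbour outside of it -/
  boundary : ∀ Z : Set V, Z.Finite → Z.ncard ≤ 10 → (G.graph.induce Z).Connected →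
    (∃ v ∈ Z, 3 ≤ (G.graph.neighborSet v ∩ Z).ncard) →
    3 ≤ {z ∈ Z | ∃ w, w ∉ Z ∧ G.graph.Adj z w}.ncard

end PRGraph

/-- Two adjacent vertices `0` and `1` of degree three; the paths `0-2-3` and `0-4-5` hang at `0`,
the path `1-6-7` and the pendant edge `1-8` hang at `1`. This is the six-vertex "H" graph with
three of its four pendant edges subdivided once. -/
def H2221 : SimpleGraph (Fin 9) :=
  SimpleGraph.fromEdgeSet
    {s(0, 1), s(0, 2), s(2, 3), s(0, 4), s(4, 5), s(1, 6), s(6, 7), s(1, 8)}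

/-- The underlying irreflexive graph contains neither `H2221` nor the triangle as a (not
necessarily induced) subgraph. -/
def PRGraph.IsH2221C3Free {V : Type*} (G : PRGraph V) : Prop :=
  H2221.Free G.graph ∧ (SimpleGraph.cycleGraph 3).Free G.graph

/-! ### Random access machines

Programs with structured control for a random access machine with registers and arrays that hold
natural numbers (a program mentions finitely many of them). The arithmetic is addition and
truncated subtraction, at unit cost; this is polynomially equivalent to Turing machines, as the
length of the numbers grows by at most one bit per step. -/

namespace RAM

/-- Memory contents. -/
structure State where
  /-- contents of the registers -/
  reg : ℕ → ℕ
  /-- `arr a i` is the content of cell `i` of array `a` -/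
  arr : ℕ → ℕ → ℕ

/-- Programs. Register and array names are constants of the program; the cells of an array are
addressed indirectly, through the content of a register. -/
inductive Cmd where
  /-- `x := k` -/
  | const (x k : ℕ)
  /-- `x := y + z` -/
  | add (x y z : ℕ)
  /-- `x := y - z`, truncated at zero -/
  | sub (x y z : ℕ)
  /-- `x := a[y]` -/
  | load (x a y : ℕ)
  /-- `a[x] := y` -/
  | store (a x y : ℕ)
  /-- first `c`, then `d` -/
  | seq (c d : Cmd)
  /-- if `x ≠ 0` then `c` else `d` -/
  | ite (x : ℕ) (c d : Cmd)
  /-- while `x ≠ 0` do `c` -/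
  | while (x : ℕ) (c : Cmd)

/-- Write a register. -/
def State.setReg (s : State) (x v : ℕ) : State :=
  { s with reg := Function.update s.reg x v }

/-- Write an array cell. -/
def State.setArr (s : State) (a i v : ℕ) : State :=
  { s with arr := Function.update s.arr a (Function.update (s.arr a) i v) }

/-- `Exec c s t s'`: started in `s`, the program `c` halts in `s'` after exactly `t` steps, where
each assignment and each test counts as one step. -/
inductive Exec : Cmd → State → ℕ → State → Prop
  | const (x k : ℕ) (s : State) : Exec (.const x k) s 1 (s.setReg x k)
  | add (x y z : ℕ) (s : State) : Exec (.add x y z) s 1 (s.setReg x (s.reg y + s.reg z))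
  | sub (x y z : ℕ) (s : State) : Exec (.sub x y z) s 1 (s.setReg x (s.reg y - s.reg z))
  | load (x a y : ℕ) (s : State) : Exec (.load x a y) s 1 (s.setReg x (s.arr a (s.reg y)))
  | store (a x y : ℕ) (s : State) :
      Exec (.store a x y) s 1 (s.setArr a (s.reg x) (s.reg y))
  | seq {c d : Cmd} {s s' s'' : State} {t t' : ℕ} :
      Exec c s t s' → Exec d s' t' s'' → Exec (.seq c d) s (t + t') s''
  | ite_true {x : ℕ} {c d : Cmd} {s s' : State} {t : ℕ} :
      s.reg x ≠ 0 → Exec c s t s' → Exec (.ite x c d) s (1 + t) s'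
  | ite_false {x : ℕ} {c d : Cmd} {s s' : State} {t : ℕ} :
      s.reg x = 0 → Exec d s t s' → Exec (.ite x c d) s (1 + t) s'
  | while_done {x : ℕ} {c : Cmd} {s : State} :
      s.reg x = 0 → Exec (.while x c) s 1 s
  | while_step {x : ℕ} {c : Cmd} {s s' s'' : State} {t t' : ℕ} :
      s.reg x ≠ 0 → Exec c s t s' → Exec (.while x c) s' t' s'' →
      Exec (.while x c) s (1 + t + t') s''

open Classical in
/-- The initial state for a partially reflexive graph on the vertices `0, …, n - 1`: register `0`
holds `n`, array `0` holds the adjacency matrix row by row (with the loops on the diagonal), and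
everything else is zero. -/
noncomputable def input {n : ℕ} (G : PRGraph (Fin n)) : State where
  reg x := if x = 0 then n else 0
  arr a k := if a = 0 ∧ ∃ i j : Fin n, k = (i : ℕ) * n + (j : ℕ) ∧ G.Edge i j then 1 else 0

/-- The decision problem `Yes` is solvable in polynomial time on the instances in `Inst`: some
program halts on each such instance with `n` vertices after at most `p n` steps, `p` a polynomial,
and leaves `1` in register `0` on yes-instances and `0` on no-instances. -/
def PolyTimeSolvableOn (Inst Yes : ∀ n : ℕ, PRGraph (Fin n) → Prop) : Prop :=
  ∃ (c : Cmd) (p : Polynomial ℕ), ∀ (n : ℕ) (G : PRGraph (Fin n)), Inst n G →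
    ∃ (t : ℕ) (s : State), Exec c (input G) t s ∧ t ≤ p.eval n ∧
      (Yes n G → s.reg 0 = 1) ∧ (¬ Yes n G → s.reg 0 = 0)

end RAM

/-! ### Two adjacent vertices with large neighbourhoods -/

namespace SimpleGraph

variable {V : Type*}

/-! A stable cut is the middle colour class of a surjective colouring by the path `P3101`: opposite
end colours are never adjacent, and the vertices of the middle colour are irreflexive and pairwise
nonadjacent.

Both parts rest on one structural fact, `NoH2221C3.exists_piece`. Let `uv` be an edge whose ends
have degree at least three, in a graph without `H2221`, triangles, leaves and twins. As there are no
twins, the neighbours of `u` have distinct sets of further neighbours, and Hall's theorem gives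
enough disjoint extensions to bound the degrees of `u` and `v` by four (`card_le_three`). Let `X`
consist of the other neighbours of `u` and `v`. A matching of size three from `X` to the vertices
beyond it would yield `H2221`, so by a König-type argument (`exists_three_matching_or_cover`) those
edges have a cover of size at most two. The cover cuts off a set `I` of at most eight vertices
containing `u` and `v`, all of whose outer neighbours lie in a set `Q` of at most two vertices.

For (b), two adjacent irreflexive vertices of a reduced graph have degree at least three, and then
`I ∪ Q` violates the boundary condition. So the irreflexive vertices are stable. In any colouring an
irreflexive vertex of an end colour has a reflexive neighbour of the same colour, hence both sides
of a cut contain reflexive vertices, and the set of all irreflexive vertices separates them.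

For (a), cuts of at most ten vertices are found by exhaustive search; a disconnected graph with a
cut has one of size one. In a connected graph without small cuts, a block of at most eight vertices
attached at `x` and `y` can be simplified: it is deleted if `x = y` or if a stable set of
irreflexive vertices inside it separates `x` from `y` (`hasCut_diff_iff`), and otherwise its
vertices may be made reflexive (`hasCut_reflexive_iff`). Twins are deleted (`Twin.hasCut_iff`). When
no rule applies, the structural fact shows that the irreflexive vertices are stable, and
reachability around them decides the instance.

Every test uses a fixed number of quantifiers over vertices and reachability, so it is polynomial on
the machine. Each rule deletes a vertex or adds a loop, which bounds the number of rounds by `2 n`.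
-/

/-- Nine vertices spanning a copy of `H2221`, listed as the numbers of the vertices of `H2221`. -/
structure IsH2221Copy (G : SimpleGraph V) (x : Fin 9 → V) : Prop where
  inj : Function.Injective x
  h01 : G.Adj (x 0) (x 1)
  h02 : G.Adj (x 0) (x 2)
  h23 : G.Adj (x 2) (x 3)
  h04 : G.Adj (x 0) (x 4)
  h45 : G.Adj (x 4) (x 5)
  h16 : G.Adj (x 1) (x 6)
  h67 : G.Adj (x 6) (x 7)
  h18 : G.Adj (x 1) (x 8)

/-- The graph has no triangle and no copy of `H2221`, in elementary terms. -/
structure NoH2221C3 (G : SimpleGraph V) : Prop where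
  triangle : ∀ a b c, G.Adj a b → G.Adj b c → G.Adj a c → False
  copy : ∀ x : Fin 9 → V, ¬ G.IsH2221Copy x

theorem noH2221C3_of_free {G : SimpleGraph V} (h : H2221.Free G)
    (h3 : (cycleGraph 3).Free G) : G.NoH2221C3 := by
  constructor
  · intro a b c hab hbc hac
    apply h3
    refine ⟨⟨⟨![a, b, c], ?_⟩, ?_⟩⟩
    · intro i j hij
      fin_cases i <;> fin_cases j <;>
        first | exact absurd hij (SimpleGraph.irrefl _) | simp [hab, hbc, hac, hab.symm, hbc.symm, hac.symm]
    · intro i j hij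
      have := hab.ne; have := hbc.ne; have := hac.ne
      fin_cases i <;> fin_cases j <;> simp_all
  · intro x hx
    apply h
    refine ⟨⟨⟨x, ?_⟩, hx.inj⟩⟩
    intro i j hij
    obtain ⟨-, h01, h02, h23, h04, h45, h16, h67, h18⟩ := hx
    simp only [H2221, fromEdgeSet_adj, Set.mem_insert_iff, Set.mem_singleton_iff, Sym2.eq_iff] at hij
    obtain ⟨hij, -⟩ := hij
    rcases hij with h | h | h | h | h | h | h | h <;> rcases h with ⟨rfl, rfl⟩ | ⟨rfl, rfl⟩ <;>
      first | assumption | (apply SimpleGraph.Adj.symm; assumption)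

/-- Two extended neighbours of `u` and one extended neighbour of `v`, all disjoint. -/
theorem NoH2221C3.two_one {G : SimpleGraph V} (hG : G.NoH2221C3) {u v a a' b b' x x' y : V}
    (huv : G.Adj u v) (ha : G.Adj u a) (ha' : G.Adj u a') (hb : G.Adj v b) (hb' : G.Adj v b')
    (hx : G.Adj a x) (hx' : G.Adj a' x') (hy : G.Adj b y)
    (hav : a ≠ v) (hav' : a' ≠ v) (hbu : b ≠ u) (hbu' : b' ≠ u) (haa : a ≠ a') (hbb : b ≠ b')
    (hxu : x ≠ u) (hxu' : x' ≠ u) (hyv : y ≠ v) (hxb : x ≠ b) (hxb1 : x ≠ b') (hxb' : x' ≠ b)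
    (hxb1' : x' ≠ b') (hya : y ≠ a) (hya' : y ≠ a') (hxx : x ≠ x') (hxy : x ≠ y) (hxy' : x' ≠ y) :
    False := by
  have tri : ∀ p q r, G.Adj p q → G.Adj q r → G.Adj p r → False := hG.triangle
  -- `b'` is the pendant vertex. The coincidences not excluded by hypothesis would identify adjacent
  -- vertices or close a triangle.
  apply hG.copy ![u, v, a, x, a', x', b, y, b']
  refine ⟨?_, huv, ha, hx, ha', hx', hb, hy, hb'⟩
  have e1 : x ≠ v := fun h => tri u a v ha (h ▸ hx) huv
  have e2 : x' ≠ v := fun h => tri u a' v ha' (h ▸ hx') huv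
  have e3 : y ≠ u := fun h => tri v b u hb (h ▸ hy) huv.symm
  have e4 : x ≠ a' := fun h => tri u a a' ha (h ▸ hx) ha'
  have e5 : x' ≠ a := fun h => tri u a' a ha' (h ▸ hx') ha
  have e6 : y ≠ b' := fun h => tri v b b' hb (h ▸ hy) hb'
  have e7 : ∀ p q, G.Adj u p → G.Adj v q → p ≠ q := fun p q hp hq h =>
    tri u v q huv hq (h ▸ hp)
  have f1 := huv.ne; have f2 := ha.ne; have f3 := ha'.ne; have f4 := hb.ne; have f5 := hb'.ne
  have f6 := hx.ne; have f7 := hx'.ne; have f8 := hy.ne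
  have g1 := e7 _ _ ha hb; have g2 := e7 _ _ ha hb'
  have g3 := e7 _ _ ha' hb; have g4 := e7 _ _ ha' hb'
  rw [← List.nodup_ofFn]
  simp only [List.ofFn_succ, List.ofFn_zero, List.nodup_cons, List.mem_cons, Matrix.cons_val_zero,
    Matrix.cons_val_succ, List.not_mem_nil, not_or, not_false_eq_true, and_true, List.nodup_nil]
  grind

/-- Three neighbours of `u` with distinct extensions that are not adjacent to `v`. -/
theorem NoH2221C3.three_outside {G : SimpleGraph V} (hG : G.NoH2221C3) {u v b b' y : V}
    {a x : Fin 3 → V} (huv : G.Adj u v) (ha : ∀ i, G.Adj u (a i)) (hav : ∀ i, a i ≠ v)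
    (hai : Function.Injective a) (hx : ∀ i, G.Adj (a i) (x i)) (hxu : ∀ i, x i ≠ u)
    (hxi : Function.Injective x) (hxv : ∀ i, ¬ G.Adj v (x i)) (hb : G.Adj v b) (hb' : G.Adj v b')
    (hbu : b ≠ u) (hbu' : b' ≠ u) (hbb : b ≠ b') (hy : G.Adj b y) (hyv : y ≠ v) : False := by
  -- Two branches at `u` that avoid `y` complete a copy. It remains to see that `y` meets at most
  -- one of the three branches.
  have key : ∀ i j, i ≠ j → a i ≠ y → a j ≠ y → x i ≠ y → x j ≠ y → False := by
    intro i j hij h1 h2 h3 h4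
    exact hG.two_one huv (ha i) (ha j) hb hb' (hx i) (hx j) hy (hav i) (hav j) hbu hbu'
      (hai.ne hij) hbb (hxu i) (hxu j) hyv (fun h => hxv i (h ▸ hb)) (fun h => hxv i (h ▸ hb'))
      (fun h => hxv j (h ▸ hb)) (fun h => hxv j (h ▸ hb')) h1.symm h2.symm (hxi.ne hij) h3 h4
  have mix : ∀ i j, a i = y → x j = y → False := by
    intro i j h1 h2
    exact hG.triangle u (a j) (x j) (ha j) (hx j) (by rw [h2, ← h1]; exact ha i)
  have aeq : ∀ i j, a i = y → a j = y → i = j := fun i j h1 h2 => hai (h1.trans h2.symm)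
  have xeq : ∀ i j, x i = y → x j = y → i = j := fun i j h1 h2 => hxi (h1.trans h2.symm)
  have bad : ∀ i j, (a i = y ∨ x i = y) → (a j = y ∨ x j = y) → i = j := by
    rintro i j (h1 | h1) (h2 | h2)
    exacts [aeq i j h1 h2, (mix i j h1 h2).elim, (mix j i h2 h1).elim, xeq i j h1 h2]
  have good : ∀ i j, i ≠ j → (a i = y ∨ x i = y) ∨ (a j = y ∨ x j = y) := by
    intro i j hij
    by_contra! h
    exact key i j hij h.1.1 h.2.1 h.1.2 h.2.2
  rcases good 0 1 (by decide) with h0 | h1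
  · rcases good 1 2 (by decide) with h1 | h2
    · exact absurd (bad 0 1 h0 h1) (by decide)
    · exact absurd (bad 0 2 h0 h2) (by decide)
  · rcases good 0 2 (by decide) with h0 | h2
    · exact absurd (bad 0 1 h0 h1) (by decide)
    · exact absurd (bad 1 2 h1 h2) (by decide)

/-- One of the three extensions is adjacent to `v`. -/
theorem NoH2221C3.two_outside {G : SimpleGraph V} (hG : G.NoH2221C3)
    {u v a₁ a₂ a₃ x₁ x₂ x₃ b' : V}
    (huv : G.Adj u v) (h₁ : G.Adj u a₁) (h₂ : G.Adj u a₂) (h₃ : G.Adj u a₃)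
    (hv₂ : a₂ ≠ v) (hv₃ : a₃ ≠ v) (h₁₂ : a₁ ≠ a₂) (h₁₃ : a₁ ≠ a₃)
    (h₂₃ : a₂ ≠ a₃) (hx₁ : G.Adj a₁ x₁) (hx₂ : G.Adj a₂ x₂) (hx₃ : G.Adj a₃ x₃)
    (hu₁ : x₁ ≠ u) (hu₂ : x₂ ≠ u) (hu₃ : x₃ ≠ u) (hx₂₃ : x₂ ≠ x₃)
    (hb₁ : G.Adj v x₁) (hb₂ : ¬ G.Adj v x₂) (hb₃ : ¬ G.Adj v x₃)
    (hb' : G.Adj v b') (hbu' : b' ≠ u) (hbx : b' ≠ x₁) (hv₁ : a₁ ≠ v) : False :=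
  -- Here `x₁` acts as the extended neighbour of `v`, with `a₁` as its extension.
  hG.two_one huv h₂ h₃ hb₁ hb' hx₂ hx₃ hx₁.symm hv₂ hv₃ hu₁ hbu' h₂₃ hbx.symm hu₂ hu₃ hv₁
    (fun h => hb₂ (h ▸ hb₁)) (fun h => hb₂ (h ▸ hb')) (fun h => hb₃ (h ▸ hb₁))
    (fun h => hb₃ (h ▸ hb')) h₁₂ h₁₃ hx₂₃
    (fun h => hG.triangle u a₂ a₁ h₂ (h ▸ hx₂) h₁) (fun h => hG.triangle u a₃ a₁ h₃ (h ▸ hx₃) h₁)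

/-- Two of the three extensions are adjacent to `v`. -/
theorem NoH2221C3.two_inside {G : SimpleGraph V} (hG : G.NoH2221C3)
    {u v a₁ a₂ a₃ a₄ x₁ x₂ x₃ : V}
    (huv : G.Adj u v) (h₃ : G.Adj u a₃) (h₄ : G.Adj u a₄) (hv₁ : a₁ ≠ v) (hv₂ : a₂ ≠ v)
    (hv₃ : a₃ ≠ v) (hv₄ : a₄ ≠ v) (h₁₂ : a₁ ≠ a₂) (h₁₃ : a₁ ≠ a₃) (h₁₄ : a₁ ≠ a₄)
    (h₂₃ : a₂ ≠ a₃) (h₂₄ : a₂ ≠ a₄) (h₃₄ : a₃ ≠ a₄)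
    (hx₁ : G.Adj a₁ x₁) (hx₂ : G.Adj a₂ x₂) (hx₃ : G.Adj a₃ x₃)
    (hu₁ : x₁ ≠ u) (hu₂ : x₂ ≠ u) (hu₃ : x₃ ≠ u)
    (hx₁₂ : x₁ ≠ x₂) (hx₁₃ : x₁ ≠ x₃) (hx₂₃ : x₂ ≠ x₃)
    (hb₁ : G.Adj v x₁) (hb₂ : G.Adj v x₂) (h₁ : G.Adj u a₁) (h₂ : G.Adj u a₂) : False :=
  -- The roles of `u` and `v` are exchanged: `x₁`, `x₂` are neighbours of `v` extended by `a₁`,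
  -- `a₂`, and `a₄` is the pendant neighbour of `u`.
  hG.two_one huv.symm hb₁ hb₂ h₃ h₄ hx₁.symm hx₂.symm hx₃ hu₁ hu₂ hv₃ hv₄ hx₁₂ h₃₄
    hv₁ hv₂ hu₃ h₁₃ h₁₄ h₂₃ h₂₄ hx₁₃.symm hx₂₃.symm h₁₂
    (fun h => hG.triangle u a₃ x₃ h₃ hx₃ (h ▸ h₁)) (fun h => hG.triangle u a₃ x₃ h₃ hx₃ (h ▸ h₂))

/-- Four neighbours of `u`, three of which have distinct extensions. -/
theorem NoH2221C3.three_extended {G : SimpleGraph V} (hG : G.NoH2221C3) {u v b b' : V}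
    {a : Fin 4 → V} {x : Fin 4 → V} (huv : G.Adj u v) (ha : ∀ i, G.Adj u (a i))
    (hav : ∀ i, a i ≠ v) (hai : Function.Injective a) (j : Fin 4)
    (hx : ∀ i ≠ j, G.Adj (a i) (x i)) (hxu : ∀ i ≠ j, x i ≠ u)
    (hxi : ∀ i ≠ j, ∀ k ≠ j, x i = x k → i = k) (hb : G.Adj v b) (hb' : G.Adj v b')
    (hbu : b ≠ u) (hbu' : b' ≠ u) (hbb : b ≠ b')
    (hdeg : ∀ p q, G.Adj p q → ∃ r, G.Adj p r ∧ r ≠ q) : False := by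
  -- The cases are whether at least two, exactly one or none of the three extensions are adjacent to
  -- `v`. The fourth neighbour `a j` serves as the pendant vertex in the first case.
  have in2 : ∀ p q r, p ≠ j → q ≠ j → r ≠ j → p ≠ q → p ≠ r → q ≠ r →
      G.Adj v (x p) → G.Adj v (x q) → False := by
    intro p q r hp hq hr hpq hpr hqr h1 h2
    exact hG.two_inside huv (ha r) (ha j) (hav p) (hav q) (hav r) (hav j) (hai.ne hpq)
      (hai.ne hpr) (hai.ne hp) (hai.ne hqr) (hai.ne hq) (hai.ne hr) (hx p hp) (hx q hq) (hx r hr)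
      (hxu p hp) (hxu q hq) (hxu r hr) (fun h => hpq (hxi p hp q hq h))
      (fun h => hpr (hxi p hp r hr h)) (fun h => hqr (hxi q hq r hr h)) h1 h2 (ha p) (ha q)
  have in1 : ∀ p q r, p ≠ j → q ≠ j → r ≠ j → p ≠ q → p ≠ r → q ≠ r →
      G.Adj v (x p) → ¬ G.Adj v (x q) → ¬ G.Adj v (x r) → False := by
    intro p q r hp hq hr hpq hpr hqr h1 h2 h3
    obtain ⟨c, hc, hcu, hcx⟩ : ∃ c, G.Adj v c ∧ c ≠ u ∧ c ≠ x p := by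
      by_cases h : b = x p
      · exact ⟨b', hb', hbu', fun h' => hbb (h.trans h'.symm)⟩
      · exact ⟨b, hb, hbu, h⟩
    exact hG.two_outside huv (ha p) (ha q) (ha r) (hav q) (hav r) (hai.ne hpq) (hai.ne hpr)
      (hai.ne hqr) (hx p hp) (hx q hq) (hx r hr) (hxu p hp) (hxu q hq) (hxu r hr)
      (fun h => hqr (hxi q hq r hr h)) h1 h2 h3 hc hcu hcx (hav p)
  have in0 : ∃ i ≠ j, G.Adj v (x i) := by
    by_contra! hcon
    obtain ⟨y, hy, hyv⟩ := hdeg b v hb.symm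
    exact hG.three_outside (a := fun i => a (j.succAbove i)) (x := fun i => x (j.succAbove i)) huv
      (fun i => ha _) (fun i => hav _) (hai.comp Fin.succAbove_right_injective)
      (fun i => hx _ (Fin.succAbove_ne j i)) (fun i => hxu _ (Fin.succAbove_ne j i))
      (fun i k h => Fin.succAbove_right_injective
        (hxi _ (Fin.succAbove_ne j i) _ (Fin.succAbove_ne j k) h))
      (fun i => hcon _ (Fin.succAbove_ne j i)) hb hb' hbu hbu' hbb hy hyv
  obtain ⟨i, hij, hi⟩ := in0
  obtain ⟨q, r, hq, hr, hiq, hir, hqr⟩ : ∃ q r, q ≠ j ∧ r ≠ j ∧ i ≠ q ∧ i ≠ r ∧ q ≠ r := by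
    clear * - hij
    revert i j
    decide
  by_cases h1 : G.Adj v (x q)
  · exact in2 i q r hij hq hr hiq hir hqr hi h1
  · by_cases h2 : G.Adj v (x r)
    · exact in2 i r q hij hr hq hir hiq hqr.symm hi h2
    · exact in1 i q r hij hq hr hiq hir hqr hi h1 h2

/-- Four distinct nonempty sets have three distinct representatives. -/
theorem exists_three_representatives [DecidableEq V] (e : Fin 4 → Finset V)
    (hne : ∀ i, (e i).Nonempty) (hinj : Function.Injective e) :
    ∃ (j : Fin 4) (x : Fin 4 → V), (∀ i ≠ j, x i ∈ e i) ∧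
      ∀ i ≠ j, ∀ k ≠ j, x i = x k → i = k := by
  -- Hall's theorem, after a common dummy `none` has been added to all four sets. Injectivity lets
  -- at most one index `j` receive the dummy.
  obtain ⟨f, hf, hft⟩ := (Finset.all_card_le_biUnion_card_iff_exists_injective
    (fun i => Finset.insertNone (e i))).1 (by
      intro s
      rcases s.eq_empty_or_nonempty with rfl | hs
      · simp
      have hU : s.biUnion (fun i => Finset.insertNone (e i)) = Finset.insertNone (s.biUnion e) := by
        ext o
        cases o with
        | none => simpa using (show ∃ a, a ∈ s from hs)
        | some o => simp
      rw [hU, Finset.card_insertNone]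
      -- Distinct nonempty subsets of a union of size `m` number at most `2 ^ m - 1`; together with
      -- `s.card ≤ 4` this gives `s.card ≤ m + 1`.
      have h1 : s.card ≤ ((s.biUnion e).powerset.erase ∅).card := by
        refine Finset.card_le_card_of_injOn e (fun i hi => ?_) hinj.injOn
        simp only [Finset.coe_erase, Set.mem_sdiff, Finset.mem_coe, Finset.mem_powerset,
          Set.mem_singleton_iff]
        exact ⟨Finset.subset_biUnion_of_mem e hi, (hne i).ne_empty⟩
      rw [Finset.card_erase_of_mem (by simp), Finset.card_powerset] at h1
      have h2 : s.card ≤ 4 := by simpa using s.card_le_univ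
      by_cases h3 : (s.biUnion e).card ≤ 2
      · interval_cases (s.biUnion e).card <;> omega
      · omega)
  have hj : ∃ j, ∀ i ≠ j, ∃ y, f i = some y := by
    by_cases h : ∃ j, f j = none
    · obtain ⟨j, hj⟩ := h
      refine ⟨j, fun i hi => Option.ne_none_iff_exists'.1 fun h => hi (hf (h.trans hj.symm))⟩
    · push Not at h
      exact ⟨0, fun i _ => Option.ne_none_iff_exists'.1 (h i)⟩
  obtain ⟨j, hj⟩ := hj
  have : Nonempty V := ⟨(hne 0).choose⟩
  choose! x hx using hj
  refine ⟨j, x, fun i hi => ?_, fun i hi k hk h => hf ?_⟩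
  · have := hft i
    rw [hx i hi] at this
    simpa using this
  · rw [hx i hi, hx k hk, h]

/-- A family of sets either has three distinct representatives or a cover of size two. -/
theorem exists_three_matching_or_cover [DecidableEq V] (X : Finset V) (Y : V → Finset V)
    (hX : 3 ≤ X.card) :
    (∃ m x : Fin 3 → V, (∀ i, m i ∈ X) ∧ Function.Injective m ∧ (∀ i, x i ∈ Y (m i)) ∧
      Function.Injective x) ∨
    ∃ T ⊆ X, (T.biUnion Y).card + (X \ T).card ≤ 2 := by
  -- The deficiency version of Hall's theorem: with `X.card - 3` dummies available, a system of
  -- representatives leaves at least three genuine ones.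
  by_cases hall : ∀ s : Finset X, s.card ≤ (s.biUnion (fun i =>
      (Y i).disjSum (Finset.univ : Finset (Fin (X.card - 3))))).card
  · left
    obtain ⟨f, hf, hft⟩ := (Finset.all_card_le_biUnion_card_iff_exists_injective _).1 hall
    have hr : (Finset.univ.filter (fun i => (f i).isRight)).card ≤ X.card - 3 := by
      have : Finset.card (Finset.univ.filter (fun i => (f i).isRight)) ≤
          ((Finset.univ : Finset (Fin (X.card - 3))).map ⟨Sum.inr, Sum.inr_injective⟩ :
            Finset (V ⊕ Fin (X.card - 3))).card := by
        refine Finset.card_le_card_of_injOn f (fun i hi => ?_) hf.injOn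
        simp only [Finset.coe_filter, Finset.mem_univ, true_and, Set.mem_ofPred_eq,
          Sum.isRight_iff] at hi
        obtain ⟨y, hy⟩ := hi
        simp [hy]
      simpa using this
    have hl : 2 < (Finset.univ.filter (fun i => ¬ (f i).isRight)).card := by
      have := Finset.card_filter_add_card_filter_not (s := (Finset.univ : Finset X))
        (fun i => (f i).isRight = true)
      simp only [Finset.card_univ, Fintype.card_coe] at this
      omega
    obtain ⟨p, q, r, hp, hq, hr, hpq, hpr, hqr⟩ := Finset.two_lt_card_iff.1 hl
    simp only [Finset.mem_filter, Finset.mem_univ, true_and, Bool.not_eq_true,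
      Sum.isRight_eq_false, Sum.isLeft_iff] at hp hq hr
    obtain ⟨x, hx⟩ := hp
    obtain ⟨y, hy⟩ := hq
    obtain ⟨z, hz⟩ := hr
    have hmem : ∀ (i : X) y, f i = Sum.inl y → y ∈ Y i := by
      intro i y h
      have := hft i
      rw [h] at this
      simpa using this
    have hne : ∀ (i k : X) y z, f i = Sum.inl y → f k = Sum.inl z → i ≠ k → y ≠ z := by
      intro i k y z h1 h2 h h'
      exact h (hf (by rw [h1, h2, h']))
    have e1 := hne _ _ _ _ hx hy hpq
    have e2 := hne _ _ _ _ hx hz hpr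
    have e3 := hne _ _ _ _ hy hz hqr
    have d1 : (p : V) ≠ q := fun h => hpq (Subtype.ext h)
    have d2 : (p : V) ≠ r := fun h => hpr (Subtype.ext h)
    have d3 : (q : V) ≠ r := fun h => hqr (Subtype.ext h)
    refine ⟨![p, q, r], ![x, y, z], ?_, ?_, ?_, ?_⟩
    · intro i; fin_cases i <;> simp
    · intro i k h; fin_cases i <;> fin_cases k <;> simp_all
    · intro i
      fin_cases i
      exacts [hmem _ _ hx, hmem _ _ hy, hmem _ _ hz]
    · intro i k h; fin_cases i <;> fin_cases k <;> simp_all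
  · right
    push Not at hall
    obtain ⟨s, hs⟩ := hall
    have hsne : s.Nonempty := by
      rw [Finset.nonempty_iff_ne_empty]
      rintro rfl
      simp at hs
    have hU : s.biUnion (fun i =>
        (Y i).disjSum (Finset.univ : Finset (Fin (X.card - 3)))) =
        (s.biUnion fun i => Y i).disjSum Finset.univ := by
      ext o
      cases o with
      | inl o => simp
      | inr o =>
        obtain ⟨i, hi⟩ := hsne
        simpa using ⟨i, i.2, hi⟩
    rw [hU, Finset.card_disjSum, Finset.card_univ, Fintype.card_fin] at hs
    -- A violating `s` satisfies `|Y(s)| + (|X| - 3) < |s|`, so its neighbours together with `X \ s`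
    -- number at most two.
    refine ⟨s.map ⟨Subtype.val, Subtype.val_injective⟩, ?_, ?_⟩
    · intro y hy
      simp only [Finset.mem_map, Function.Embedding.coeFn_mk] at hy
      obtain ⟨z, -, rfl⟩ := hy
      exact z.2
    · rw [Finset.card_sdiff_of_subset, Finset.card_map]
      · have : (s.map ⟨Subtype.val, Subtype.val_injective⟩).biUnion Y =
            s.biUnion fun i => Y i := by
          ext; simp
        rw [this]
        have := s.card_le_univ
        simp only [Fintype.card_coe] at this
        omega
      · intro y hy
        simp only [Finset.mem_map, Function.Embedding.coeFn_mk] at hy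
        obtain ⟨z, -, rfl⟩ := hy
        exact z.2

end SimpleGraph

/-! ### Small pieces around an edge with ends of degree at least three -/

namespace SimpleGraph

variable {V : Type*}

/-- If no two vertices have the same neighbours, then a vertex with a neighbour of degree at least
three has at most three other neighbours. -/
theorem NoH2221C3.card_le_three [DecidableEq V] {G : SimpleGraph V} (hG : G.NoH2221C3) {u v b b' : V}
    (huv : G.Adj u v) (N : V → Finset V) (hN : ∀ p q, q ∈ N p ↔ G.Adj p q)
    (hb : G.Adj v b) (hb' : G.Adj v b') (hbu : b ≠ u) (hbu' : b' ≠ u) (hbb : b ≠ b')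
    (hdeg : ∀ p q, G.Adj p q → ∃ r, G.Adj p r ∧ r ≠ q)
    (htwin : ∀ p q r t, p ≠ q → (∀ w, G.Adj p w ↔ G.Adj q w) → G.Adj p r → G.Adj r t →
      t ≠ p → t ≠ q → False) : ((N u).erase v).card ≤ 3 := by
  by_contra! hcard
  obtain ⟨s, hs, hs4⟩ := Finset.exists_subset_card_eq hcard
  let eq := Finset.equivFinOfCardEq hs4
  let a : Fin 4 → V := fun i => (eq.symm i : V)
  have hai : Function.Injective a := Subtype.val_injective.comp eq.symm.injective
  have ha : ∀ i, G.Adj u (a i) ∧ a i ≠ v := by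
    intro i
    have := hs (eq.symm i).2
    rw [Finset.mem_erase, hN] at this
    exact ⟨this.2, this.1⟩
  -- The sets are nonempty because there are no leaves. They are distinct because equality would
  -- make two neighbours of `u` twins, with `v` as the further neighbour of `u` that `htwin` asks
  -- for.
  obtain ⟨j, x, hx, hxi⟩ := exists_three_representatives (fun i => (N (a i)).erase u) (by
      intro i
      obtain ⟨r, hr, hru⟩ := hdeg (a i) u (ha i).1.symm
      exact ⟨r, by simp [hN, hr, hru]⟩) (by
      intro i k hik
      by_contra hne
      have hw : ∀ w, G.Adj (a i) w ↔ G.Adj (a k) w := by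
        intro w
        by_cases hwu : w = u
        · subst hwu
          exact ⟨fun _ => (ha k).1.symm, fun _ => (ha i).1.symm⟩
        · have := Finset.ext_iff.1 hik w
          simpa [hN, hwu] using this
      exact htwin (a i) (a k) u v (hai.ne hne) hw (ha i).1.symm huv (ha i).2.symm
        (ha k).2.symm)
  simp only [Finset.mem_erase, hN] at hx
  exact hG.three_extended huv (fun i => (ha i).1) (fun i => (ha i).2) hai j
    (fun i hi => (hx i hi).2) (fun i hi => (hx i hi).1) hxi hb hb' hbu hbu' hbb hdeg

/-- This distributes the edges of a matching of size three over the two ends of `uv`: two against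
one in either direction, or all at the same end. -/
theorem fin_three_pair (P : Fin 3 → Prop) :
    (∃ i j k, i ≠ j ∧ i ≠ k ∧ j ≠ k ∧ P i ∧ P j ∧ ¬ P k) ∨
    (∃ i j k, i ≠ j ∧ i ≠ k ∧ j ≠ k ∧ ¬ P i ∧ ¬ P j ∧ P k) ∨ (∀ i, P i) ∨ ∀ i, ¬ P i := by
  by_cases h0 : P 0 <;> by_cases h1 : P 1 <;> by_cases h2 : P 2
  · right; right; left; intro i; fin_cases i <;> assumption
  · left; exact ⟨0, 1, 2, by decide, by decide, by decide, h0, h1, h2⟩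
  · left; exact ⟨0, 2, 1, by decide, by decide, by decide, h0, h2, h1⟩
  · right; left; exact ⟨1, 2, 0, by decide, by decide, by decide, h1, h2, h0⟩
  · left; exact ⟨1, 2, 0, by decide, by decide, by decide, h1, h2, h0⟩
  · right; left; exact ⟨0, 2, 1, by decide, by decide, by decide, h0, h2, h1⟩
  · right; left; exact ⟨0, 1, 2, by decide, by decide, by decide, h0, h1, h2⟩
  · right; right; right; intro i; fin_cases i <;> assumption

/-- Two adjacent vertices of degree at least three cannot occur in a reduced graph without
`H2221` and triangles, unless they lie in the interior of a small piece that is attached at two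
vertices. -/
theorem NoH2221C3.exists_piece [DecidableEq V] {G : SimpleGraph V} (hG : G.NoH2221C3)
    {u v : V} (huv : G.Adj u v) (hfin : ∀ w, (G.neighborSet w).Finite)
    (hu : ∀ x, ∃ a, G.Adj u a ∧ a ≠ v ∧ a ≠ x) (hv : ∀ x, ∃ b, G.Adj v b ∧ b ≠ u ∧ b ≠ x)
    (hdeg : ∀ p q, G.Adj p q → ∃ r, G.Adj p r ∧ r ≠ q)
    (htwin : ∀ p q r t, p ≠ q → (∀ w, G.Adj p w ↔ G.Adj q w) → G.Adj p r → G.Adj r t →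
      t ≠ p → t ≠ q → False) :
    ∃ I Q : Finset V, u ∈ I ∧ v ∈ I ∧ I.card ≤ 8 ∧ Q.card ≤ 2 ∧ Disjoint I Q ∧
      (∀ i ∈ I, ∀ w, G.Adj i w → w ∈ I ∨ w ∈ Q) ∧ (∀ w ∈ I ∪ Q, ∃ w', G.Adj w w') ∧
      (G.induce (↑(I ∪ Q) : Set V)).Connected := by
  let N : V → Finset V := fun w => (hfin w).toFinset
  have hN : ∀ p q, q ∈ N p ↔ G.Adj p q := by intro p q; simp [N]
  obtain ⟨a, ha, hav, -⟩ := hu v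
  obtain ⟨a', ha', hav', haa⟩ := hu a
  obtain ⟨b, hb, hbu, -⟩ := hv u
  obtain ⟨b', hb', hbu', hbb⟩ := hv b
  have hA := hG.card_le_three huv N hN hb hb' hbu hbu' hbb.symm hdeg htwin
  have hB := hG.card_le_three huv.symm N hN ha ha' hav hav' haa.symm hdeg htwin
  let A := (N u).erase v
  let B := (N v).erase u
  have memA : ∀ w, w ∈ A ↔ w ≠ v ∧ G.Adj u w := by intro w; simp [A, hN]
  have memB : ∀ w, w ∈ B ↔ w ≠ u ∧ G.Adj v w := by intro w; simp [B, hN]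
  let X := A ∪ B
  have hX : 3 ≤ X.card := by
    have h1 : ({a, a', b} : Finset V) ⊆ X := by
      intro w hw
      simp only [Finset.mem_insert, Finset.mem_singleton] at hw
      simp only [X, Finset.mem_union, memA, memB]
      rcases hw with rfl | rfl | rfl
      exacts [Or.inl ⟨hav, ha⟩, Or.inl ⟨hav', ha'⟩, Or.inr ⟨hbu, hb⟩]
    have h2 : ∀ c, G.Adj u c → c ≠ b := fun c hc h => hG.triangle u v b huv hb (h ▸ hc)
    calc 3 = ({a, a', b} : Finset V).card := by
            rw [Finset.card_insert_of_notMem, Finset.card_pair (h2 _ ha')]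
            simp [haa.symm, h2 _ ha]
      _ ≤ _ := Finset.card_le_card h1
  have hX6 : X.card ≤ 6 := (Finset.card_union_le _ _).trans (by simp only [A, B]; omega)
  -- Neighbours beyond `u`, `v` and `X`. Such a vertex is adjacent to neither `u` nor `v`, so it
  -- cannot coincide with a pendant vertex.
  let Y : V → Finset V := fun w => N w \ insert u (insert v X)
  have memY : ∀ p q, q ∈ Y p ↔ G.Adj p q ∧ q ≠ u ∧ q ≠ v ∧ q ∉ X := by
    intro p q; simp [Y, hN]
  have notX : ∀ q, q ≠ u → q ≠ v → q ∉ X → ¬ G.Adj u q ∧ ¬ G.Adj v q := by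
    intro q h1 h2 h3
    simp only [X, Finset.mem_union, memA, memB, not_or, not_and] at h3
    exact ⟨h3.1 h2, h3.2 h1⟩
  rcases exists_three_matching_or_cover X Y hX with ⟨m, x, hm, hmi, hx, hxi⟩ | ⟨T, hT, hTc⟩
  · exfalso
    simp only [memY] at hx
    have hmem : ∀ i, (m i ≠ v ∧ G.Adj u (m i)) ∨ (m i ≠ u ∧ G.Adj v (m i)) := by
      intro i
      simpa only [X, Finset.mem_union, memA, memB] using hm i
    have hmx : ∀ i k, x i ≠ m k := fun i k h => (hx i).2.2.2 (h ▸ hm k)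
    have nx : ∀ i, ¬ G.Adj u (x i) ∧ ¬ G.Adj v (x i) := fun i =>
      notX _ (hx i).2.1 (hx i).2.2.1 (hx i).2.2.2
    rcases fin_three_pair (fun i => m i ≠ v ∧ G.Adj u (m i)) with
      ⟨i, j, k, hij, hik, hjk, hi, hj, hk⟩ | ⟨i, j, k, hij, hik, hjk, hi, hj, hk⟩ | h | h
    · have hk' := (hmem k).resolve_left hk
      obtain ⟨c, hc, hcu, hck⟩ := hv (m k)
      -- Two matching edges at `u` and one at `v` are the three long branches; the remaining
      -- neighbour `c` of `v` is the pendant vertex.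
      exact hG.two_one huv hi.2 hj.2 hk'.2 hc (hx i).1 (hx j).1 (hx k).1 hi.1 hj.1 hk'.1 hcu
        (hmi.ne hij) hck.symm (hx i).2.1 (hx j).2.1 (hx k).2.2.1 (hmx _ _)
        (fun h => (nx i).2 (h ▸ hc)) (hmx _ _) (fun h => (nx j).2 (h ▸ hc)) (hmx _ _) (hmx _ _)
        (hxi.ne hij) (hxi.ne hik) (hxi.ne hjk)
    · have hi' := (hmem i).resolve_left hi
      have hj' := (hmem j).resolve_left hj
      obtain ⟨c, hc, hcu, hck⟩ := hu (m k)
      exact hG.two_one huv.symm hi'.2 hj'.2 hk.2 hc (hx i).1 (hx j).1 (hx k).1 hi'.1 hj'.1 hk.1 hcu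
        (hmi.ne hij) hck.symm (hx i).2.2.1 (hx j).2.2.1 (hx k).2.1 (hmx _ _)
        (fun h => (nx i).1 (h ▸ hc)) (hmx _ _) (fun h => (nx j).1 (h ▸ hc)) (hmx _ _) (hmx _ _)
        (hxi.ne hij) (hxi.ne hik) (hxi.ne hjk)
    -- All three matching edges hang at `u`. The branch at `v` is obtained by extending an arbitrary
    -- neighbour `b`.
    · obtain ⟨y, hy, hyv⟩ := hdeg b v hb.symm
      exact hG.three_outside huv (fun i => (h i).2) (fun i => (h i).1) hmi (fun i => (hx i).1)
        (fun i => (hx i).2.1) hxi (fun i => (nx i).2) hb hb' hbu hbu' hbb.symm hy hyv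
    · have h' := fun i => (hmem i).resolve_left (h i)
      obtain ⟨y, hy, hyv⟩ := hdeg a u ha.symm
      exact hG.three_outside huv.symm (fun i => (h' i).2) (fun i => (h' i).1) hmi
        (fun i => (hx i).1) (fun i => (hx i).2.2.1) hxi (fun i => (nx i).1) ha ha' hav hav'
        haa.symm hy hyv
  · have huX : u ∉ X := by simp [X, memA, memB]
    have hvX : v ∉ X := by simp [X, memA, memB]
    -- The cover is `Q`. The bound eight is `2 + 6`, since `T ⊆ X` and `u`, `v` contribute at most
    -- three vertices each to `X`.
    refine ⟨insert u (insert v T), T.biUnion Y ∪ (X \ T), by simp, by simp, ?_, ?_, ?_, ?_, ?_, ?_⟩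
    · refine (Finset.card_insert_le _ _).trans ?_
      have := Finset.card_insert_le v T
      have := Finset.card_le_card hT
      omega
    · exact (Finset.card_union_le _ _).trans hTc
    · rw [Finset.disjoint_left]
      intro w hw hw'
      simp only [Finset.mem_union, Finset.mem_biUnion, memY, Finset.mem_sdiff] at hw'
      simp only [Finset.mem_insert] at hw
      rcases hw with rfl | rfl | hw
      · rcases hw' with ⟨p, hp, h⟩ | h
        exacts [h.2.1 rfl, huX h.1]
      · rcases hw' with ⟨p, hp, h⟩ | h
        exacts [h.2.2.1 rfl, hvX h.1]
      · rcases hw' with ⟨p, hp, h⟩ | h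
        exacts [h.2.2.2 (hT hw), h.2 hw]
    · intro i hi w hw
      simp only [Finset.mem_insert] at hi
      simp only [Finset.mem_insert, Finset.mem_union, Finset.mem_biUnion, memY, Finset.mem_sdiff]
      by_cases hwu : w = u
      · simp [hwu]
      by_cases hwv : w = v
      · simp [hwv]
      by_cases hwX : w ∈ X
      · by_cases hwT : w ∈ T <;> simp [hwT, hwX]
      · rcases hi with rfl | rfl | hi
        · exact absurd hw (notX w hwu hwv hwX).1
        · exact absurd hw (notX w hwu hwv hwX).2
        · exact Or.inr (Or.inl ⟨i, hi, hw, hwu, hwv, hwX⟩)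
    · have hXn : ∀ w ∈ X, ∃ w', G.Adj w w' := by
        intro w hw
        simp only [X, Finset.mem_union, memA, memB] at hw
        rcases hw with h | h
        exacts [⟨u, h.2.symm⟩, ⟨v, h.2.symm⟩]
      intro w hw
      simp only [Finset.mem_union, Finset.mem_insert, Finset.mem_biUnion, memY,
        Finset.mem_sdiff] at hw
      rcases hw with (rfl | rfl | h) | ⟨p, hp, h⟩ | h
      exacts [⟨v, huv⟩, ⟨u, huv.symm⟩, hXn w (hT h), ⟨p, h.1.symm⟩, hXn w h.1]
    · set Z : Finset V := insert u (insert v T) ∪ (T.biUnion Y ∪ (X \ T)) with hZ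
      have huZ : u ∈ (Z : Set V) := by simp [hZ]
      have hvZ : v ∈ (Z : Set V) := by simp [hZ]
      have rv : (G.induce (Z : Set V)).Reachable ⟨u, huZ⟩ ⟨v, hvZ⟩ :=
        Adj.reachable (by simpa using huv)
      have rX : ∀ w (hw : w ∈ (Z : Set V)), w ∈ X →
          (G.induce (Z : Set V)).Reachable ⟨u, huZ⟩ ⟨w, hw⟩ := by
        intro w hw hwX
        simp only [X, Finset.mem_union, memA, memB] at hwX
        rcases hwX with h | h
        · exact Adj.reachable (by simpa using h.2)
        · exact rv.trans (Adj.reachable (by simpa using h.2))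
      rw [connected_iff_exists_forall_reachable]
      refine ⟨⟨u, huZ⟩, ?_⟩
      rintro ⟨w, hw⟩
      have hw' := hw
      simp only [hZ, Finset.coe_union, Finset.coe_insert, Set.mem_union, Set.mem_insert_iff,
        Finset.mem_coe, Finset.mem_biUnion, memY, Finset.mem_sdiff] at hw'
      rcases hw' with (rfl | rfl | h) | ⟨p, hp, h⟩ | h
      · exact Reachable.refl _
      · exact rv
      · exact rX w hw (hT h)
      · have hpZ : p ∈ (Z : Set V) := by simp [hZ, hp]
        exact (rX p hpZ (hT hp)).trans (Adj.reachable (by simpa using h.1))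
      · exact rX w hw h.1

end SimpleGraph

/-! ### Colourings -/

namespace SimpleGraph

variable {V : Type*} {G : SimpleGraph V} {K S C I : Set V} {f : V → Fin 3}

/-- The part of a graph on a set of vertices, the other vertices being isolated. -/
def restrict (G : SimpleGraph V) (K : Set V) : SimpleGraph V where
  Adj u v := G.Adj u v ∧ u ∈ K ∧ v ∈ K
  symm := ⟨fun _ _ h => ⟨h.1.symm, h.2.2, h.2.1⟩⟩
  loopless := ⟨fun _ h => G.irrefl h.1⟩

/-- A homomorphism from the graph on `K`, with irreflexive vertices `S`, to the path on three
vertices with looped ends and a loopless middle vertex. -/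
structure IsColouring (G : SimpleGraph V) (K S : Set V) (f : V → Fin 3) : Prop where
  far : ∀ u v, (G.restrict K).Adj u v → ¬ (f u = 0 ∧ f v = 2)
  mid : ∀ u v, (G.restrict K).Adj u v → ¬ (f u = 1 ∧ f v = 1)
  loop : ∀ u ∈ K, f u = 1 → u ∈ S

/-- There is a colouring with all three colours. -/
def HasCut (G : SimpleGraph V) (K S : Set V) : Prop :=
  ∃ f, G.IsColouring K S f ∧ ∀ c, ∃ v ∈ K, f v = c

/-- Steps in the graph on `K` that avoid `C`. -/
def Step (G : SimpleGraph V) (K C : Set V) (p q : V) : Prop :=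
  (G.restrict K).Adj p q ∧ p ∉ C ∧ q ∉ C

/-- The graph on `K` is connected or empty. -/
def Conn (G : SimpleGraph V) (K : Set V) : Prop :=
  ∀ a ∈ K, ∀ b ∈ K, Relation.ReflTransGen (G.Step K ∅) a b

/-- The set of the first `k` values of a sequence. -/
def tup (k : ℕ) (c : ℕ → V) : Set V := {v | ∃ i < k, v = c i}

/-- There is a stable cut of size at most ten. -/
def SmallCut (G : SimpleGraph V) (K S : Set V) : Prop :=
  ∃ (c : ℕ → V) (a b : V), tup 10 c ⊆ K ∧ tup 10 c ⊆ S ∧ a ∈ K ∧ b ∈ K ∧ a ∉ tup 10 c ∧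
    b ∉ tup 10 c ∧ (∀ i < 10, ∀ j < 10, ¬ G.Adj (c i) (c j)) ∧
    ¬ Relation.ReflTransGen (G.Step K (tup 10 c)) a b

theorem finite_tup (k : ℕ) (c : ℕ → V) : (tup k c).Finite := by
  have : tup k c = c '' Set.Iio k := by
    ext v; simp [tup, eq_comm]
  rw [this]
  exact (Set.finite_Iio k).image c

theorem ncard_tup_le (k : ℕ) (c : ℕ → V) : (tup k c).ncard ≤ k := by
  have : tup k c = c '' Set.Iio k := by
    ext v; simp [tup, eq_comm]
  rw [this]
  refine (Set.ncard_image_le (Set.finite_Iio k)).trans ?_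
  rw [← Finset.coe_Iio, Set.ncard_coe_finset, Nat.card_Iio]

/-- A set with fewer than `k` elements is padded by repeating `z`. The swap puts `z` first, because
the rule that adds a loop acts on entry `0`. -/
theorem exists_tup {k : ℕ} (hC : C.Finite) (hk : C.ncard ≤ k) {z : V}
    (hz : z ∈ C) : ∃ c : ℕ → V, tup k c = C ∧ c 0 = z := by
  classical
  obtain ⟨c, hc⟩ : ∃ c : Fin (C.ncard) ≃ C, True := by
    have : Fintype C := hC.fintype
    refine ⟨(Fintype.equivFinOfCardEq ?_).symm, trivial⟩
    rw [Set.ncard_eq_toFinset_card', Set.toFinset_card]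
  have hpos : 0 < C.ncard := (Set.ncard_pos hC).2 ⟨z, hz⟩
  let s := Equiv.swap (⟨0, hpos⟩ : Fin C.ncard) (c.symm ⟨z, hz⟩)
  refine ⟨fun i => if h : i < C.ncard then c (s ⟨i, h⟩) else z, ?_, ?_⟩
  · ext v
    constructor
    · rintro ⟨i, -, rfl⟩
      by_cases h : i < C.ncard
      · simp [h]
      · simpa [h] using hz
    · intro hv
      refine ⟨s.symm (c.symm ⟨v, hv⟩), by omega, ?_⟩
      simp
  · simp [hpos, s]

/-- Reflection of the path exchanges the end colours, so that statements about colour `0` transfer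
to colour `2`. -/
theorem IsColouring.rev (h : G.IsColouring K S f) : G.IsColouring K S (fun v => (f v).rev) := by
  have e : ∀ c : Fin 3, (c.rev = 0 ↔ c = 2) ∧ (c.rev = 1 ↔ c = 1) ∧ (c.rev = 2 ↔ c = 0) := by
    decide
  constructor
  · intro u v huv
    rw [(e _).1, (e _).2.2]
    exact fun h' => h.far v u (SimpleGraph.Adj.symm huv) h'.symm
  · intro u v huv
    rw [(e _).2.1, (e _).2.1]
    exact h.mid u v huv
  · intro u hu
    rw [(e _).2.1]
    exact h.loop u hu

/-- Opposite end colours are never adjacent, so an end colour persists along any walk that avoids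
the middle colour. All separation arguments use this. -/
theorem IsColouring.eq_of_adj (h : G.IsColouring K S f) {p q : V} (hpq : (G.restrict K).Adj p q)
    (hp : f p ≠ 1) (hq : f q ≠ 1) : f p = f q := by
  have h1 := h.far p q hpq
  have h2 := h.far q p (SimpleGraph.Adj.symm hpq)
  generalize f p = a at *
  generalize f q = b at *
  revert a b
  decide

theorem IsColouring.mono {K' S' : Set V} (h : G.IsColouring K S f) (hK : K' ⊆ K)
    (hS : ∀ u ∈ K', f u = 1 → u ∈ S') : G.IsColouring K' S' f :=
  ⟨fun u v huv => h.far u v ⟨huv.1, hK huv.2.1, hK huv.2.2⟩,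
    fun u v huv => h.mid u v ⟨huv.1, hK huv.2.1, hK huv.2.2⟩, hS⟩

/-- The vertices of the middle colour separate the others. -/
theorem IsColouring.not_reachable (h : G.IsColouring K S f) {a b : V} (ha : f a = 0) (hb : f b = 2)
    (hC : ∀ v ∈ K, f v = 1 → v ∈ C) : ¬ Relation.ReflTransGen (G.Step K C) a b := by
  intro hab
  have : f b = 0 := by
    clear hb
    induction hab with
    | refl => exact ha
    | tail _ hpq ih =>
      rw [← ih]
      refine (h.eq_of_adj hpq.1 (by rw [ih]; decide) ?_).symm
      exact fun h1 => hpq.2.2 (hC _ hpq.1.2.2 h1)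
  rw [hb] at this
  exact absurd this (by decide)

/-- A stable separating set of irreflexive vertices yields a colouring. -/
theorem hasCut_of_not_reachable {a b : V} (hne : C.Nonempty) (hK : C ⊆ K) (hS : ∀ v ∈ C, v ∈ S)
    (hst : ∀ p ∈ C, ∀ q ∈ C, ¬ G.Adj p q) (ha : a ∈ K) (hb : b ∈ K) (haC : a ∉ C) (hbC : b ∉ C)
    (hab : ¬ Relation.ReflTransGen (G.Step K C) a b) : G.HasCut K S := by
  classical
  have key : ∀ p q, (G.restrict K).Adj p q → p ∉ C → q ∉ C →
      (Relation.ReflTransGen (G.Step K C) a p ↔ Relation.ReflTransGen (G.Step K C) a q) := by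
    intro p q hpq hp hq
    exact ⟨fun h => h.tail ⟨hpq, hp, hq⟩, fun h => h.tail ⟨SimpleGraph.Adj.symm hpq, hq, hp⟩⟩
  refine ⟨fun v => if v ∈ C then 1 else
    if Relation.ReflTransGen (G.Step K C) a v then 0 else 2, ⟨?_, ?_, ?_⟩, ?_⟩
  · intro p q hpq
    by_cases hp : p ∈ C
    · simp [hp]
    by_cases hq : q ∈ C
    · simp [hq]
    have := key p q hpq hp hq
    by_cases h1 : Relation.ReflTransGen (G.Step K C) a p
    · simp [hq, this.1 h1]
    · simp [hp, h1]
  · intro p q hpq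
    have e : ∀ v, (if v ∈ C then (1 : Fin 3) else
        if Relation.ReflTransGen (G.Step K C) a v then 0 else 2) = 1 → v ∈ C := by
      intro v
      split_ifs <;> simp_all
    exact fun h => hst p (e p h.1) q (e q h.2) hpq.1
  · intro v _
    split_ifs with h
    · exact fun _ => hS v h
    · simp
    · simp
  · intro c
    fin_cases c
    · exact ⟨a, ha, by simp [haC, Relation.ReflTransGen.refl]⟩
    · obtain ⟨v, hv⟩ := hne
      exact ⟨v, hK hv, by simp [hv]⟩
    · exact ⟨b, hb, by simp [hbC, hab]⟩

theorem SmallCut.hasCut (h : G.SmallCut K S) : G.HasCut K S := by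
  obtain ⟨c, a, b, hK, hS, ha, hb, haC, hbC, hst, hab⟩ := h
  refine hasCut_of_not_reachable (C := tup 10 c) ⟨c 0, 0, by norm_num, rfl⟩ hK hS ?_ ha hb haC hbC hab
  rintro p ⟨i, hi, rfl⟩ q ⟨j, hj, rfl⟩
  exact hst i hi j hj

/-- A colouring with few vertices of the middle colour. -/
theorem IsColouring.smallCut (h : G.IsColouring K S f) {a b c : V} (ha : a ∈ K) (hb : b ∈ K)
    (hc : c ∈ K) (hfa : f a = 0) (hfb : f b = 2) (hfc : f c = 1) (T : Set V) (hT : T.Finite)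
    (hT10 : T.ncard ≤ 10) (hsub : ∀ v ∈ K, f v = 1 → v ∈ T) : G.SmallCut K S := by
  have hsub' : {v | v ∈ K ∧ f v = 1} ⊆ T := fun v hv => hsub v hv.1 hv.2
  have hfin : {v | v ∈ K ∧ f v = 1}.Finite := hT.subset hsub'
  obtain ⟨t, ht, -⟩ := exists_tup (k := 10) hfin
    ((Set.ncard_le_ncard hsub' hT).trans hT10) (z := c) ⟨hc, hfc⟩
  have mem : ∀ i < 10, t i ∈ K ∧ f (t i) = 1 := by
    intro i hi
    have : t i ∈ tup 10 t := ⟨i, hi, rfl⟩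
    rw [ht] at this
    exact this
  refine ⟨t, a, b, ?_, ?_, ha, hb, ?_, ?_, ?_, ?_⟩
  · rw [ht]; exact fun v hv => hv.1
  · rw [ht]; exact fun v hv => h.loop v hv.1 hv.2
  · rw [ht]; rintro ⟨-, h1⟩; rw [hfa] at h1; exact absurd h1 (by decide)
  · rw [ht]; rintro ⟨-, h1⟩; rw [hfb] at h1; exact absurd h1 (by decide)
  · intro i hi j hj hij
    exact h.mid _ _ ⟨hij, (mem i hi).1, (mem j hj).1⟩ ⟨(mem i hi).2, (mem j hj).2⟩
  · rw [ht]
    exact h.not_reachable hfa hfb (fun v hv h1 => ⟨hv, h1⟩)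

/-- Without the middle colour, the two end colours would lie in different components. -/
theorem Conn.exists_mid (hc : G.Conn K) (h : G.IsColouring K S f) {a b : V} (ha : a ∈ K)
    (hb : b ∈ K) (hfa : f a = 0) (hfb : f b = 2) : ∃ c ∈ K, f c = 1 := by
  by_contra! hcon
  exact h.not_reachable (C := ∅) hfa hfb (fun v hv h1 => (hcon v hv h1).elim) (hc a ha b hb)

theorem Conn.exists_adj (hc : G.Conn K) {a b : V} (ha : a ∈ K) (hb : b ∈ K) (hab : a ≠ b) :
    ∃ s ∈ K, G.Adj a s := by
  rcases Relation.ReflTransGen.cases_head (hc a ha b hb) with h | ⟨s, hs, -⟩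
  · exact absurd h hab
  · exact ⟨s, hs.1.2.2, hs.1.1⟩

/-- A union of components yields a cut of size one. -/
theorem smallCut_of_closed {D : Set V} {c x y : V} (hcK : c ∈ K) (hcS : c ∈ S)
    (hD : ∀ p q, (G.restrict K).Adj p q → (p ∈ D ↔ q ∈ D)) (hx : x ∈ K) (hxD : x ∈ D)
    (hxc : x ≠ c) (hy : y ∈ K) (hyD : y ∉ D) (hyc : y ≠ c) : G.SmallCut K S := by
  classical
  -- No edge leaves `D`, so giving the end colours to `D` and to its complement is consistent
  -- whatever vertex `c` takes the middle colour.
  refine IsColouring.smallCut (f := fun v => if v = c then 1 else if v ∈ D then 0 else 2)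
    ⟨?_, ?_, ?_⟩ hx hy hcK (by simp [hxc, hxD]) (by simp [hyc, hyD]) (by simp) {c} (by simp)
    (by simp) ?_
  · intro p q hpq
    have := hD p q hpq
    by_cases h1 : p = c <;> by_cases h2 : q = c <;> by_cases h3 : q ∈ D <;> simp_all
  · intro p q hpq
    have e : ∀ v, (if v = c then (1 : Fin 3) else if v ∈ D then 0 else 2) = 1 → v = c := by
      intro v; split_ifs <;> simp_all
    rintro ⟨h1, h2⟩
    rw [e p h1, e q h2] at hpq
    exact (G.restrict K).irrefl hpq
  · intro v _
    split_ifs <;> simp_all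
  · intro v _
    split_ifs <;> simp_all

/-- In a disconnected graph every cut gives one of size one. -/
theorem HasCut.smallCut_of_not_conn (h : G.HasCut K S) (hc : ¬ G.Conn K) : G.SmallCut K S := by
  obtain ⟨f, hf, hs⟩ := h
  obtain ⟨a, ha, hfa⟩ := hs 0
  obtain ⟨c, hcK, hfc⟩ := hs 1
  obtain ⟨b, hb, hfb⟩ := hs 2
  have hac : a ≠ c := fun h => by rw [h, hfc] at hfa; exact absurd hfa (by decide)
  by_contra hsm
  -- If there is no small cut, disconnectedness forces the middle colour to occur only at `c`, which
  -- is itself a small cut.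
  have key : ∀ D : Set V, (∀ p q, (G.restrict K).Adj p q → (p ∈ D ↔ q ∈ D)) →
      (∃ x ∈ K, x ∈ D) → (∃ y ∈ K, y ∉ D) → (∀ c', c' ∈ K → f c' = 1 → c' = c) := by
    intro D hD ⟨x, hx, hxD⟩ ⟨y, hy, hyD⟩ c' hc' hfc'
    by_contra hne
    -- Either `c` is a cut between `D` and its complement, or one of the two sides is just `c`, so
    -- that `c` is isolated.
    have hiso : ∀ q, (G.restrict K).Adj c q → False := by
      by_cases h1 : ∃ x ∈ K, x ∈ D ∧ x ≠ c
      · by_cases h2 : ∃ y ∈ K, y ∉ D ∧ y ≠ c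
        · obtain ⟨x, hx, hxD, hxc⟩ := h1
          obtain ⟨y, hy, hyD, hyc⟩ := h2
          exact (hsm (smallCut_of_closed hcK (hf.loop c hcK hfc) hD hx hxD hxc hy hyD hyc)).elim
        · push Not at h2
          obtain rfl := h2 y hy hyD
          intro q hq
          have hqD := hyD ∘ (hD y q hq).2
          have := h2 q hq.2.2 hqD
          rw [this] at hq
          exact (G.restrict K).irrefl hq
      · push Not at h1
        obtain rfl := h1 x hx hxD
        intro q hq
        have := h1 q hq.2.2 ((hD x q hq).1 hxD)
        rw [this] at hq
        exact (G.restrict K).irrefl hq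
    have hac' : a ≠ c' := fun h => by rw [h, hfc'] at hfa; exact absurd hfa (by decide)
    -- With `c` isolated, a second vertex `c'` of the middle colour is a cut between `c` and `a`.
    refine hsm (smallCut_of_closed (D := {c}) hc' (hf.loop c' hc' hfc') ?_ hcK rfl
      (Ne.symm hne) ha hac hac')
    intro p q hpq
    constructor
    · rintro rfl
      exact (hiso q hpq).elim
    · rintro rfl
      exact (hiso p (SimpleGraph.Adj.symm hpq)).elim
  simp only [Conn, not_forall] at hc
  obtain ⟨p, hp, q, hq, hpq⟩ := hc
  have := key {v | Relation.ReflTransGen (G.Step K ∅) p v}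
    (fun x y hxy => ⟨fun h => h.tail ⟨hxy, id, id⟩,
      fun h => h.tail ⟨SimpleGraph.Adj.symm hxy, id, id⟩⟩)
    ⟨p, hp, Relation.ReflTransGen.refl⟩ ⟨q, hq, hpq⟩
  exact hsm (hf.smallCut ha hb hcK hfa hfb hfc {c} (by simp) (by simp) this)

end SimpleGraph

/-! ### Blocks and twins: reductions that preserve the existence of a cut -/

namespace SimpleGraph

variable {V : Type*} {G : SimpleGraph V} {K S C I : Set V} {f : V → Fin 3}

/-- `I` is attached to the rest of the graph on `K` at `x` and `y` only. -/
structure Block (G : SimpleGraph V) (K I : Set V) (x y : V) : Prop where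
  sub : I ⊆ K
  hx : x ∈ K
  hy : y ∈ K
  hxI : x ∉ I
  hyI : y ∉ I
  nbr : ∀ i ∈ I, ∀ w ∈ K, G.Adj i w → w ∈ I ∨ w = x ∨ w = y

/-- Steps from `I ∪ {x, y}` into `I ∪ {y}` that avoid `C`. -/
def SepStep (G : SimpleGraph V) (K I C : Set V) (y : V) (p q : V) : Prop :=
  (G.restrict K).Adj p q ∧ (q ∈ I ∨ q = y) ∧ q ∉ C

/-- `x` and `y` are separated in `I ∪ {x, y}` by a stable set of irreflexive vertices of `I`. -/
def Sep (G : SimpleGraph V) (K S I : Set V) (x y : V) : Prop :=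
  ∃ c : ℕ → V, tup 8 c ⊆ I ∧ tup 8 c ⊆ S ∧ (∀ i < 8, ∀ j < 8, ¬ G.Adj (c i) (c j)) ∧
    ¬ Relation.ReflTransGen (G.SepStep K I (tup 8 c) y) x y

/-- If colour `0` occurred only inside `I`, everything outside `I ∪ {x, y}` could be recoloured `2`.
Connectivity keeps the middle colour nonempty, and it is now confined to `I ∪ {x, y}`. This is where
the bound ten on small cuts comes from: eight vertices and two attachments. -/
theorem HasCut.outside_zero (hc : G.Conn K) (hsm : ¬ G.SmallCut K S)
    (hf : G.IsColouring K S f) (hs : ∀ c, ∃ v ∈ K, f v = c) {x y : V} (hb : G.Block K I x y)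
    (hI : I.Finite) (hI8 : I.ncard ≤ 8) : ∃ v ∈ K, v ∉ I ∧ f v = 0 := by
  classical
  by_contra! hcon
  apply hsm
  let g : V → Fin 3 := fun v => if v ∈ I ∨ v = x ∨ v = y then f v else 2
  have hg0 : ∀ v ∈ K, v ∉ I → g v ≠ 0 := by
    intro v hv hvI
    simp only [g]
    split_ifs
    · exact hcon v hv hvI
    · decide
  have hg1 : ∀ v, g v = 1 → v ∈ insert x (insert y I) ∧ f v = 1 := by
    intro v
    simp only [g]
    split_ifs with h
    · intro h1
      refine ⟨?_, h1⟩
      simp only [Set.mem_insert_iff]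
      tauto
    · simp
  have hcol : G.IsColouring K S g := by
    refine ⟨?_, fun p q hpq h => hf.mid p q hpq ⟨(hg1 p h.1).2, (hg1 q h.2).2⟩,
      fun v hv h => hf.loop v hv (hg1 v h).2⟩
    rintro p q hpq ⟨h1, h2⟩
    have hpI : p ∈ I := by
      by_contra hpI
      exact hg0 p hpq.2.1 hpI h1
    have hq := hb.nbr p hpI q hpq.2.2 hpq.1
    simp only [g, hpI, true_or, if_true] at h1
    simp only [g, hq, if_true] at h2
    exact hf.far p q hpq ⟨h1, h2⟩
  obtain ⟨a, ha, hfa⟩ := hs 0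
  obtain ⟨b, hbK, hfb⟩ := hs 2
  have haI : a ∈ I := by
    by_contra haI
    exact hcon a ha haI hfa
  have hga : g a = 0 := by simp [g, haI, hfa]
  have hgb : g b = 2 := by simp [g, hfb]
  obtain ⟨c, hcK, hgc⟩ := hc.exists_mid hcol ha hbK hga hgb
  refine hcol.smallCut ha hbK hcK hga hgb hgc _ ((hI.insert y).insert x) ?_
    (fun v _ h => (hg1 v h).1)
  have := Set.ncard_insert_le x (insert y I)
  have := Set.ncard_insert_le y I
  omega

/-- If there is no small stable cut, then all colours occur outside of a small block. -/
theorem HasCut.outside (hc : G.Conn K) (hsm : ¬ G.SmallCut K S)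
    (hf : G.IsColouring K S f) (hs : ∀ c, ∃ v ∈ K, f v = c) {x y : V} (hb : G.Block K I x y)
    (hI : I.Finite) (hI8 : I.ncard ≤ 8) (c : Fin 3) : ∃ v ∈ K, v ∉ I ∧ f v = c := by
  have e : ∀ c d : Fin 3, c.rev = d ↔ c = d.rev := by decide
  fin_cases c
  · exact HasCut.outside_zero hc hsm hf hs hb hI hI8
  -- A middle colour class contained in `I` is already a small cut.
  · by_contra! hcon
    obtain ⟨a, ha, hfa⟩ := hs 0
    obtain ⟨b, hbK, hfb⟩ := hs 2
    obtain ⟨c, hcK, hfc⟩ := hs 1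
    refine hsm (hf.smallCut ha hbK hcK hfa hfb hfc I hI (hI8.trans (by norm_num)) ?_)
    intro v hv h1
    by_contra hvI
    exact hcon v hv hvI h1
  · obtain ⟨v, hv, hvI, h⟩ := HasCut.outside_zero hc hsm hf.rev
      (fun c => by simpa only [e] using hs c.rev) hb hI hI8
    exact ⟨v, hv, hvI, (e _ _).1 h⟩

/-- A colouring outside of a block extends to it, avoiding the middle colour, if the
attachments do not have opposite colours. -/
theorem IsColouring.extend_const {x y : V} (hb : G.Block K I x y)
    (hf : G.IsColouring (K \ I) S f) (h02 : ¬ (f x = 0 ∧ f y = 2)) (h20 : ¬ (f x = 2 ∧ f y = 0)) :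
    ∃ g : V → Fin 3, G.IsColouring K S g ∧ (∀ v, v ∉ I → g v = f v) ∧ ∀ v ∈ I, g v ≠ 1 := by
  classical
  -- An end colour that agrees with every attachment not of the middle colour; the whole block
  -- receives it.
  obtain ⟨c, hc1, hcx, hcy⟩ : ∃ c : Fin 3, c ≠ 1 ∧ (f x = 1 ∨ f x = c) ∧ (f y = 1 ∨ f y = c) := by
    generalize f x = a at *
    generalize f y = b at *
    revert a b
    decide
  let g : V → Fin 3 := fun v => if v ∈ I then c else f v
  have gI : ∀ v, v ∈ I → g v = c := fun v hv => by simp [g, hv]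
  have gO : ∀ v, v ∉ I → g v = f v := fun v hv => by simp [g, hv]
  have cross : ∀ p q, (G.restrict K).Adj p q → p ∈ I → g p = c ∧ (g q = 1 ∨ g q = c) := by
    intro p q hpq hp
    refine ⟨gI p hp, ?_⟩
    rcases hb.nbr p hp q hpq.2.2 hpq.1 with h | rfl | rfl
    · exact Or.inr (gI q h)
    · rw [gO _ hb.hxI]; exact hcx
    · rw [gO _ hb.hyI]; exact hcy
  have small : ∀ a b : Fin 3, c ≠ 1 → (a = c ∧ (b = 1 ∨ b = c)) →
      ¬ (a = 0 ∧ b = 2) ∧ ¬ (b = 0 ∧ a = 2) ∧ ¬ (a = 1 ∧ b = 1) := by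
    clear * -
    revert c
    decide
  refine ⟨g, ⟨?_, ?_, ?_⟩, gO, fun v hv => by rw [gI v hv]; exact hc1⟩
  · intro p q hpq
    by_cases hp : p ∈ I
    · exact (small _ _ hc1 (cross p q hpq hp)).1
    by_cases hq : q ∈ I
    · exact (small _ _ hc1 (cross q p hpq.symm hq)).2.1
    rw [gO p hp, gO q hq]
    exact hf.far p q ⟨hpq.1, ⟨hpq.2.1, hp⟩, ⟨hpq.2.2, hq⟩⟩
  · intro p q hpq
    by_cases hp : p ∈ I
    · exact (small _ _ hc1 (cross p q hpq hp)).2.2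
    by_cases hq : q ∈ I
    · exact fun h => (small _ _ hc1 (cross q p hpq.symm hq)).2.2 h.symm
    rw [gO p hp, gO q hq]
    exact hf.mid p q ⟨hpq.1, ⟨hpq.2.1, hp⟩, ⟨hpq.2.2, hq⟩⟩
  · intro v hv h1
    by_cases hvI : v ∈ I
    · rw [gI v hvI] at h1
      exact absurd h1 hc1
    · rw [gO v hvI] at h1
      exact hf.loop v ⟨hv, hvI⟩ h1

/-- A colouring outside of a block extends to it if the attachments are separated. -/
theorem IsColouring.extend_sep {x y : V} (hb : G.Block K I x y) (hsep : G.Sep K S I x y)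
    (hf : G.IsColouring (K \ I) S f) (hx : f x ≠ 1) (hy : f y ≠ 1) :
    ∃ g : V → Fin 3, G.IsColouring K S g ∧ (∀ v, v ∉ I → g v = f v) := by
  classical
  obtain ⟨t, hCI, hCS, hst, hab⟩ := hsep
  set C := tup 8 t with hC
  have hst' : ∀ p ∈ C, ∀ q ∈ C, ¬ G.Adj p q := by
    rintro p ⟨i, hi, rfl⟩ q ⟨j, hj, rfl⟩
    exact hst i hi j hj
  let R : V → Prop := fun v => Relation.ReflTransGen (G.SepStep K I C y) x v
  -- The separating set gets the middle colour, the part of the block reached from `x` gets the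
  -- colour of `x`, and the rest gets the colour of `y`.
  let g : V → Fin 3 := fun v => if v ∈ I then (if v ∈ C then 1 else if R v then f x else f y)
    else f v
  have gO : ∀ v, v ∉ I → g v = f v := fun v hv => by simp [g, hv]
  have gC : ∀ v, v ∈ I → g v = 1 → v ∈ C := by
    intro v hv h1
    by_contra hvC
    simp only [g, hv, hvC, if_true, if_false] at h1
    split_ifs at h1
    exacts [hx h1, hy h1]
  have cross : ∀ p q, (G.restrict K).Adj p q → p ∈ I → g p = g q ∨ (g p = 1 ∧ g q ≠ 1) ∨
      (g p ≠ 1 ∧ g q = 1) := by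
    intro p q hpq hp
    have hpx : p ≠ x := fun h => hb.hxI (h ▸ hp)
    by_cases hpC : p ∈ C
    · right; left
      refine ⟨by simp [g, hp, hpC], fun hq1 => ?_⟩
      rcases hb.nbr p hp q hpq.2.2 hpq.1 with h | rfl | rfl
      · exact hst' p hpC q (gC q h hq1) hpq.1
      · rw [gO _ hb.hxI] at hq1; exact hx hq1
      · rw [gO _ hb.hyI] at hq1; exact hy hq1
    · have hp1 : g p ≠ 1 := fun h => hpC (gC p hp h)
      rcases hb.nbr p hp q hpq.2.2 hpq.1 with h | rfl | rfl
      · by_cases hqC : q ∈ C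
        · right; right
          exact ⟨hp1, by simp [g, h, hqC]⟩
        · left
          have : R p ↔ R q := ⟨fun h' => h'.tail ⟨hpq, Or.inl h, hqC⟩,
            fun h' => h'.tail ⟨hpq.symm, Or.inl hp, hpC⟩⟩
          simp [g, hp, h, hpC, hqC, this]
      · left
        have : R p := Relation.ReflTransGen.single ⟨hpq.symm, Or.inl hp, hpC⟩
        simp [g, hp, hpC, this, hb.hxI]
      · left
        -- `SepStep` allows steps into `y`, so a neighbour of `y` inside the block cannot be reached
        -- from `x`.
        have : ¬ R p := fun h => hab (h.tail ⟨hpq, Or.inr rfl, fun h => hb.hyI (hCI h)⟩)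
        simp [g, hp, hpC, this, hb.hyI]
  have small : ∀ a b : Fin 3, (a = b ∨ (a = 1 ∧ b ≠ 1) ∨ (a ≠ 1 ∧ b = 1)) →
      ¬ (a = 0 ∧ b = 2) ∧ ¬ (b = 0 ∧ a = 2) := by
    decide
  have mid : ∀ p q, (G.restrict K).Adj p q → p ∈ I → ¬ (g p = 1 ∧ g q = 1) := by
    rintro p q hpq hp ⟨h1, h2⟩
    have hpC := gC p hp h1
    rcases hb.nbr p hp q hpq.2.2 hpq.1 with h | rfl | rfl
    · exact hst' p hpC q (gC q h h2) hpq.1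
    · rw [gO _ hb.hxI] at h2; exact hx h2
    · rw [gO _ hb.hyI] at h2; exact hy h2
  refine ⟨g, ⟨?_, ?_, ?_⟩, gO⟩
  · intro p q hpq
    by_cases hp : p ∈ I
    · exact (small _ _ (cross p q hpq hp)).1
    by_cases hq : q ∈ I
    · exact (small _ _ (cross q p hpq.symm hq)).2
    rw [gO p hp, gO q hq]
    exact hf.far p q ⟨hpq.1, ⟨hpq.2.1, hp⟩, ⟨hpq.2.2, hq⟩⟩
  · intro p q hpq
    by_cases hp : p ∈ I
    · exact mid p q hpq hp
    by_cases hq : q ∈ I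
    · exact fun h => mid q p hpq.symm hq h.symm
    rw [gO p hp, gO q hq]
    exact hf.mid p q ⟨hpq.1, ⟨hpq.2.1, hp⟩, ⟨hpq.2.2, hq⟩⟩
  · intro v hv h1
    by_cases hvI : v ∈ I
    · exact hCS (gC v hvI h1)
    · rw [gO v hvI] at h1
      exact hf.loop v ⟨hv, hvI⟩ h1

/-- A block may be deleted if it imposes no constraint on its attachments. -/
theorem hasCut_diff_iff {x y : V} (hc : G.Conn K) (hsm : ¬ G.SmallCut K S)
    (hb : G.Block K I x y) (hI : I.Finite) (hI8 : I.ncard ≤ 8) (hxy : x = y ∨ G.Sep K S I x y) :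
    G.HasCut (K \ I) S ↔ G.HasCut K S := by
  constructor
  · rintro ⟨f, hf, hs⟩
    have : ∃ g : V → Fin 3, G.IsColouring K S g ∧ (∀ v, v ∉ I → g v = f v) := by
      by_cases h02 : f x = 0 ∧ f y = 2
      · rcases hxy with rfl | hsep
        · exact absurd (h02.1.symm.trans h02.2) (by decide)
        · exact hf.extend_sep hb hsep (by rw [h02.1]; decide) (by rw [h02.2]; decide)
      by_cases h20 : f x = 2 ∧ f y = 0
      · rcases hxy with rfl | hsep
        · exact absurd (h20.1.symm.trans h20.2) (by decide)
        · exact hf.extend_sep hb hsep (by rw [h20.1]; decide) (by rw [h20.2]; decide)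
      obtain ⟨g, hg, hgf, -⟩ := hf.extend_const hb h02 h20
      exact ⟨g, hg, hgf⟩
    obtain ⟨g, hg, hgf⟩ := this
    refine ⟨g, hg, fun c => ?_⟩
    obtain ⟨v, hv, hvc⟩ := hs c
    exact ⟨v, hv.1, by rw [hgf v hv.2, hvc]⟩
  · rintro ⟨f, hf, hs⟩
    refine ⟨f, hf.mono Set.sdiff_subset (fun u hu => hf.loop u hu.1), fun c => ?_⟩
    obtain ⟨v, hv, hvI, hvc⟩ := HasCut.outside hc hsm hf hs hb hI hI8 c
    exact ⟨v, ⟨hv, hvI⟩, hvc⟩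

/-- The vertices of `I` with the middle colour separate `x` from `y`, because an end colour is
constant along steps that avoid them. The vertex `z` makes this set nonempty, as needed to list it
as a sequence. -/
theorem sep_of_opposite {x y z : V} (hb : G.Block K I x y) (hI : I.Finite) (hI8 : I.ncard ≤ 8)
    (hf : G.IsColouring K S f) (hz : z ∈ I) (hfz : f z = 1) (hx : f x ≠ 1) (hy : f y ≠ 1)
    (hxy : f x ≠ f y) : G.Sep K S I x y := by
  have hfin : {v | v ∈ I ∧ f v = 1}.Finite := hI.subset fun v hv => hv.1
  obtain ⟨t, ht, -⟩ := exists_tup (k := 8) hfin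
    ((Set.ncard_le_ncard (fun v hv => hv.1) hI).trans hI8) (z := z) ⟨hz, hfz⟩
  have mem : ∀ i < 8, t i ∈ I ∧ f (t i) = 1 := by
    intro i hi
    have : t i ∈ tup 8 t := ⟨i, hi, rfl⟩
    rw [ht] at this
    exact this
  refine ⟨t, ?_, ?_, ?_, ?_⟩
  · rw [ht]; exact fun v hv => hv.1
  · rw [ht]; exact fun v hv => hf.loop v (hb.sub hv.1) hv.2
  · intro i hi j hj hij
    exact hf.mid _ _ ⟨hij, hb.sub (mem i hi).1, hb.sub (mem j hj).1⟩ ⟨(mem i hi).2, (mem j hj).2⟩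
  · rw [ht]
    intro h
    apply hxy
    suffices ∀ v, Relation.ReflTransGen (G.SepStep K I {v | v ∈ I ∧ f v = 1} y) x v →
        f x = f v from this y h
    intro v hv
    induction hv with
    | refl => rfl
    | tail _ hpq ih =>
      rw [ih]
      refine hf.eq_of_adj hpq.1 (by rw [← ih]; exact hx) ?_
      rcases hpq.2.1 with h | rfl
      · exact fun h1 => hpq.2.2 ⟨h, h1⟩
      · exact hy

/-- A vertex in a block may be made reflexive if the attachments are not separated. -/
theorem hasCut_reflexive_iff {x y z : V} (hc : G.Conn K) (hsm : ¬ G.SmallCut K S)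
    (hb : G.Block K I x y) (hI : I.Finite) (hI8 : I.ncard ≤ 8) (hz : z ∈ I)
    (hsep : ¬ G.Sep K S I x y) : G.HasCut K (S \ {z}) ↔ G.HasCut K S := by
  constructor
  · rintro ⟨f, hf, hs⟩
    exact ⟨f, hf.mono le_rfl (fun u hu h => (hf.loop u hu h).1), hs⟩
  · rintro ⟨f, hf, hs⟩
    by_cases hfz : f z = 1
    · have hno : ¬ (f x ≠ 1 ∧ f y ≠ 1 ∧ f x ≠ f y) := fun h =>
        hsep (sep_of_opposite hb hI hI8 hf hz hfz h.1 h.2.1 h.2.2)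
      obtain ⟨g, hg, hgf, hgI⟩ := (hf.mono (K' := K \ I) Set.sdiff_subset
        (fun u hu => hf.loop u hu.1)).extend_const hb
        (fun h => hno (by rw [h.1, h.2]; decide)) (fun h => hno (by rw [h.1, h.2]; decide))
      refine ⟨g, hg.mono le_rfl (fun u hu h => ⟨hg.loop u hu h, ?_⟩), fun c => ?_⟩
      · rintro rfl
        exact hgI _ hz h
      · obtain ⟨v, hv, hvI, hvc⟩ := HasCut.outside hc hsm hf hs hb hI hI8 c
        exact ⟨v, hv, by rw [hgf v hvI, hvc]⟩
    · refine ⟨f, hf.mono le_rfl (fun u hu h => ⟨hf.loop u hu h, ?_⟩), hs⟩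
      rintro rfl
      exact hfz h

/-- `v` and `w` have the same neighbours, `w` may take over the role of `v`, and `t` is a further
vertex. -/
structure Twin (G : SimpleGraph V) (K S : Set V) (v w t : V) : Prop where
  ne : v ≠ w
  hv : v ∈ K
  hw : w ∈ K
  nbr : ∀ p ∈ K, G.Adj v p ↔ G.Adj w p
  loop : v ∈ S ∨ w ∉ S
  ht : t ∈ K
  tv : t ≠ v
  tw : t ≠ w
  adj : ¬ G.Adj v t

/-- If `v` alone has colour `0`, its neighbours all have the middle colour. They are also the
neighbours of `w`, so `w` can take over colour `0`. In case `w` carried colour `2`, that colour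
survives at `t`, or at a neighbour of `t` if `t` has the middle colour. -/
theorem Twin.hasCut_of_zero {v w t : V} (hT : G.Twin K S v w t) (hc : G.Conn K)
    (hf : G.IsColouring K S f) (hfv : f v = 0) (h0 : ∀ u ∈ K, f u = 0 → u = v) :
    G.HasCut (K \ {v}) S := by
  classical
  have hnb : ∀ r ∈ K, G.Adj v r → f r = 1 := by
    intro r hr hvr
    by_contra h1
    have := hf.eq_of_adj ⟨hvr, hT.hv, hr⟩ (by rw [hfv]; decide) h1
    have := h0 r hr (this.symm.trans hfv)
    rw [this] at hvr
    exact G.irrefl hvr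
  obtain ⟨r, hr, hvr⟩ := hc.exists_adj hT.hv hT.hw hT.ne
  have hfr := hnb r hr hvr
  have hrv : r ≠ v := fun h => by rw [h] at hvr; exact G.irrefl hvr
  have hrw : r ≠ w := fun h => by
    have := (hT.nbr r hr).1 hvr
    rw [h] at this; exact G.irrefl this
  let g : V → Fin 3 := Function.update f w 0
  have gw : g w = 0 := Function.update_self ..
  have gO : ∀ u, u ≠ w → g u = f u := fun u hu => Function.update_of_ne hu ..
  have hwn : ∀ q ∈ K, G.Adj w q → g q = 1 := by
    intro q hq hwq
    rw [gO q (fun h => by rw [h] at hwq; exact G.irrefl hwq)]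
    exact hnb q hq ((hT.nbr q hq).2 hwq)
  refine ⟨g, ⟨?_, ?_, ?_⟩, ?_⟩
  · rintro p q ⟨hpq, hp, hq⟩ ⟨h1, h2⟩
    by_cases hpw : p = w
    · subst hpw
      rw [hwn q hq.1 hpq] at h2; exact absurd h2 (by decide)
    by_cases hqw : q = w
    · subst hqw
      rw [gw] at h2; exact absurd h2 (by decide)
    rw [gO p hpw] at h1
    rw [gO q hqw] at h2
    exact hf.far p q ⟨hpq, hp.1, hq.1⟩ ⟨h1, h2⟩
  · rintro p q ⟨hpq, hp, hq⟩ ⟨h1, h2⟩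
    have e : ∀ u, g u = 1 → u ≠ w := fun u h1 h => by
      rw [h, gw] at h1; exact absurd h1 (by decide)
    rw [gO p (e p h1)] at h1
    rw [gO q (e q h2)] at h2
    exact hf.mid p q ⟨hpq, hp.1, hq.1⟩ ⟨h1, h2⟩
  · intro u hu h1
    have : u ≠ w := fun h => by rw [h, gw] at h1; exact absurd h1 (by decide)
    rw [gO u this] at h1
    exact hf.loop u hu.1 h1
  · have h2 : ∃ s ∈ K, s ≠ v ∧ s ≠ w ∧ f s = 2 := by
      by_cases ht1 : f t = 1
      · obtain ⟨s, hs, hts⟩ := hc.exists_adj hT.ht hT.hw hT.tw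
        have hsv : s ≠ v := fun h => hT.adj (by rw [← h]; exact hts.symm)
        refine ⟨s, hs, hsv, fun h => hT.adj ((hT.nbr t hT.ht).2 (by rw [← h]; exact hts.symm)), ?_⟩
        have e1 : f s ≠ 1 := fun h => hf.mid t s ⟨hts, hT.ht, hs⟩ ⟨ht1, h⟩
        have e0 : f s ≠ 0 := fun h => hsv (h0 s hs h)
        generalize f s = a at *
        revert a; decide
      · refine ⟨t, hT.ht, hT.tv, hT.tw, ?_⟩
        have e0 : f t ≠ 0 := fun h => hT.tv (h0 t hT.ht h)
        generalize f t = a at *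
        revert a; decide
    obtain ⟨s, hs, hsv, hsw, hfs⟩ := h2
    intro c
    fin_cases c
    · exact ⟨w, ⟨hT.hw, hT.ne.symm⟩, gw⟩
    · exact ⟨r, ⟨hr, hrv⟩, by rw [gO r hrw]; exact hfr⟩
    · exact ⟨s, ⟨hs, hsv⟩, by rw [gO s hsw]; exact hfs⟩

/-- One of two twins may be deleted. -/
theorem Twin.hasCut_iff {v w t : V} (hT : G.Twin K S v w t) (hc : G.Conn K)
    (hsm : ¬ G.SmallCut K S) : G.HasCut (K \ {v}) S ↔ G.HasCut K S := by
  classical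
  have hvw : ¬ G.Adj v w := fun h => G.irrefl ((hT.nbr w hT.hw).1 h)
  have e : ∀ c d : Fin 3, c.rev = d ↔ c = d.rev := by decide
  constructor
  · rintro ⟨f, hf, hs⟩
    -- The restored twin copies the colour of `w`. The field `loop` of `Twin` makes this legal if
    -- that colour is the middle one.
    let g : V → Fin 3 := Function.update f v (f w)
    have gv : g v = f w := Function.update_self ..
    have gO : ∀ u, u ≠ v → g u = f u := fun u hu => Function.update_of_ne hu ..
    have adj' : ∀ q, (G.restrict K).Adj v q → q ≠ v ∧ (G.restrict (K \ {v})).Adj w q := by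
      intro q hq
      have hqv : q ≠ v := (hq.ne').symm.symm
      exact ⟨hqv, (hT.nbr q hq.2.2).1 hq.1, ⟨hT.hw, hT.ne.symm⟩, ⟨hq.2.2, hqv⟩⟩
    refine ⟨g, ⟨?_, ?_, ?_⟩, ?_⟩
    · intro p q hpq
      by_cases hp : p = v
      · subst hp
        obtain ⟨h1, h2⟩ := adj' q hpq
        rw [gv, gO q h1]
        exact hf.far _ _ h2
      by_cases hq : q = v
      · subst hq
        obtain ⟨h1, h2⟩ := adj' p hpq.symm
        rw [gv, gO p h1]
        exact hf.far _ _ h2.symm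
      rw [gO p hp, gO q hq]
      exact hf.far p q ⟨hpq.1, ⟨hpq.2.1, hp⟩, ⟨hpq.2.2, hq⟩⟩
    · intro p q hpq
      by_cases hp : p = v
      · subst hp
        obtain ⟨h1, h2⟩ := adj' q hpq
        rw [gv, gO q h1]
        exact hf.mid _ _ h2
      by_cases hq : q = v
      · subst hq
        obtain ⟨h1, h2⟩ := adj' p hpq.symm
        rw [gv, gO p h1]
        exact hf.mid _ _ h2.symm
      rw [gO p hp, gO q hq]
      exact hf.mid p q ⟨hpq.1, ⟨hpq.2.1, hp⟩, ⟨hpq.2.2, hq⟩⟩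
    · intro u hu h1
      by_cases huv : u = v
      · subst huv
        rw [gv] at h1
        exact hT.loop.resolve_right (not_not.2 (hf.loop w ⟨hT.hw, hT.ne.symm⟩ h1))
      · rw [gO u huv] at h1
        exact hf.loop u ⟨hu, huv⟩ h1
    · intro c
      obtain ⟨u, hu, huc⟩ := hs c
      exact ⟨u, hu.1, by rw [gO u hu.2]; exact huc⟩
  · rintro ⟨f, hf, hs⟩
    -- Restriction fails only if `v` is the sole vertex of some colour. If that is the middle
    -- colour, `v` is a small cut; otherwise `w` takes over, after a reflection in the case of
    -- colour `2`.
    by_cases h0 : ∃ u ∈ K, f u = 0 ∧ u ≠ v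
    · by_cases h2 : ∃ u ∈ K, f u = 2 ∧ u ≠ v
      · by_cases h1 : ∃ u ∈ K, f u = 1 ∧ u ≠ v
        · refine ⟨f, hf.mono Set.sdiff_subset (fun u hu => hf.loop u hu.1), fun c => ?_⟩
          fin_cases c
          · obtain ⟨u, hu, hc, huv⟩ := h0
            exact ⟨u, ⟨hu, huv⟩, hc⟩
          · obtain ⟨u, hu, hc, huv⟩ := h1
            exact ⟨u, ⟨hu, huv⟩, hc⟩
          · obtain ⟨u, hu, hc, huv⟩ := h2
            exact ⟨u, ⟨hu, huv⟩, hc⟩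
        · push Not at h1
          obtain ⟨a, ha, hfa⟩ := hs 0
          obtain ⟨b, hb, hfb⟩ := hs 2
          obtain ⟨c, hcK, hfc⟩ := hs 1
          exact (hsm (hf.smallCut ha hb hcK hfa hfb hfc {v} (by simp) (by simp) h1)).elim
      · push Not at h2
        obtain ⟨b, hb, hfb⟩ := hs 2
        obtain rfl := h2 b hb hfb
        exact hT.hasCut_of_zero hc hf.rev ((e _ _).2 hfb) (fun u hu h => h2 u hu ((e _ _).1 h))
    · push Not at h0
      obtain ⟨a, ha, hfa⟩ := hs 0
      obtain rfl := h0 a ha hfa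
      exact hT.hasCut_of_zero hc hf hfa h0

end SimpleGraph

/-! ### Stability of the set of irreflexive vertices -/

namespace SimpleGraph

variable {V : Type*} {G : SimpleGraph V} {K S : Set V}

/-- If the irreflexive vertices are stable, then a cut separates two reflexive vertices by the
set of all irreflexive ones. -/
theorem HasCut.exists_separated (h : G.HasCut K S)
    (hst : ∀ u ∈ K, u ∈ S → ∀ v ∈ K, v ∈ S → ¬ G.Adj u v)
    (hnb : ∀ u ∈ K, u ∈ S → ∃ w ∈ K, G.Adj u w) :
    ∃ a ∈ K, ∃ b ∈ K, a ∉ S ∧ b ∉ S ∧ ¬ Relation.ReflTransGen (G.Step K S) a b := by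
  obtain ⟨f, hf, hs⟩ := h
  -- An irreflexive vertex of an end colour has a neighbour, which is reflexive by stability,
  -- therefore not of the middle colour, and so of the same end colour.
  have key : ∀ c : Fin 3, c ≠ 1 → ∃ a ∈ K, a ∉ S ∧ f a = c := by
    intro c hc
    obtain ⟨a, ha, hfa⟩ := hs c
    by_cases haS : a ∈ S
    · obtain ⟨w, hw, haw⟩ := hnb a ha haS
      have hwS : w ∉ S := fun h => hst a ha haS w hw h haw
      refine ⟨w, hw, hwS, ?_⟩
      rw [← hfa]
      exact (hf.eq_of_adj ⟨haw, ha, hw⟩ (by rw [hfa]; exact hc)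
        (fun h => hwS (hf.loop w hw h))).symm
    · exact ⟨a, ha, haS, hfa⟩
  obtain ⟨a, ha, haS, hfa⟩ := key 0 (by decide)
  obtain ⟨b, hb, hbS, hfb⟩ := key 2 (by decide)
  exact ⟨a, ha, b, hb, haS, hbS, hf.not_reachable hfa hfb hf.loop⟩

theorem NoH2221C3.restrict_mono {K' : Set V} (hG : (G.restrict K).NoH2221C3) (hK : K' ⊆ K) :
    (G.restrict K').NoH2221C3 := by
  have h : ∀ {p q}, (G.restrict K').Adj p q → (G.restrict K).Adj p q :=
    fun hpq => ⟨hpq.1, hK hpq.2.1, hK hpq.2.2⟩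
  constructor
  · exact fun a b c hab hbc hac => hG.triangle a b c (h hab) (h hbc) (h hac)
  · rintro x ⟨h0, h1, h2, h3, h4, h5, h6, h7, h8⟩
    exact hG.copy x ⟨h0, h h1, h h2, h h3, h h4, h h5, h h6, h h7, h h8⟩

/-- If no block contains an irreflexive vertex, no block is attached at a single vertex and there
are no twins, then the irreflexive vertices are stable. -/
theorem NoH2221C3.stable_of_no_block (hG : (G.restrict K).NoH2221C3) (hK : K.Finite)
    (hblock : ∀ (I : Set V) (x y z : V), I.Finite → I.ncard ≤ 8 → G.Block K I x y → z ∈ I →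
      z ∈ S → False)
    (hblock1 : ∀ (I : Set V) (x z : V), I.Finite → I.ncard ≤ 8 → G.Block K I x x → z ∈ I → False)
    (htwin : ∀ v w t, ¬ G.Twin K S v w t) :
    ∀ u ∈ K, u ∈ S → ∀ v ∈ K, v ∈ S → ¬ G.Adj u v := by
  classical
  intro u hu huS v hv hvS huv
  set H := G.restrict K with hH
  have huvH : H.Adj u v := ⟨huv, hu, hv⟩
  have three : ∀ p q, H.Adj p q → p ∈ S → ∀ x, ∃ a, H.Adj p a ∧ a ≠ q ∧ a ≠ x := by
    intro p q hpq hpS x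
    by_contra! hcon
    -- An irreflexive vertex without neighbours other than `q` and `x` is itself a block. If `x`
    -- cannot serve as an attachment, `q` is used twice.
    refine hblock {p} q (if x ∈ K ∧ x ≠ p then x else q) p (by simp) (by simp) ?_ rfl hpS
    have hqp : q ∉ ({p} : Set V) := hpq.ne'
    refine ⟨by simpa using hpq.2.1, hpq.2.2, ?_, hqp, ?_, ?_⟩
    · split_ifs with h
      exacts [h.1, hpq.2.2]
    · split_ifs with h
      exacts [h.2, hqp]
    · rintro i rfl w hw hiw
      by_cases hwq : w = q
      · exact Or.inr (Or.inl hwq)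
      · have hwx := hcon w ⟨hiw, hpq.2.1, hw⟩ hwq
        right; right
        rw [if_pos ⟨hwx ▸ hw, hwx ▸ hiw.ne'⟩, hwx]
  obtain ⟨I, Q, huI, hvI, hI, hQ, hd, hnb, hall, -⟩ := hG.exists_piece huvH
    (fun w => hK.subset (fun p hp => hp.2.2)) (three u v huvH huS) (three v u huvH.symm hvS) (by
      intro p q hpq
      by_contra! hcon
      -- A leaf is a block attached at a single vertex.
      refine hblock1 {p} q p (by simp) (by simp) ⟨by simpa using hpq.2.1, hpq.2.2, hpq.2.2,
        hpq.ne', hpq.ne', ?_⟩ rfl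
      rintro i rfl w hw hiw
      exact Or.inr (Or.inl (hcon w ⟨hiw, hpq.2.1, hw⟩))) (by
      intro p q r t hpq hw hpr hrt htp htq
      have hqr : H.Adj q r := (hw r).1 hpr
      have hpt : ¬ G.Adj p t := fun h => hG.triangle p r t hpr hrt ⟨h, hpr.2.1, hrt.2.2⟩
      have hw' : ∀ w ∈ K, G.Adj p w ↔ G.Adj q w := fun w hwK =>
        ⟨fun h => ((hw w).1 ⟨h, hpr.2.1, hwK⟩).1, fun h => ((hw w).2 ⟨h, hqr.2.1, hwK⟩).1⟩
      have hqt : ¬ G.Adj q t := fun h => hpt ((hw' t hrt.2.2).2 h)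
      -- One of the two orders satisfies the loop condition of `Twin`. The further vertex is `t`,
      -- which is not adjacent to the twins since there are no triangles.
      by_cases h : p ∈ S ∨ q ∉ S
      · exact htwin p q t ⟨hpq, hpr.2.1, hqr.2.1, hw', h, hrt.2.2, htp, htq, hpt⟩
      · exact htwin q p t ⟨hpq.symm, hqr.2.1, hpr.2.1, fun w hwK => (hw' w hwK).symm, by tauto,
          hrt.2.2, htq, htp, hqt⟩)
  have hKm : ∀ w ∈ I ∪ Q, w ∈ K := fun w hw => by
    obtain ⟨w', h⟩ := hall w hw
    exact h.2.1
  rcases Nat.lt_or_ge Q.card 1 with h0 | h1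
  · obtain rfl : Q = ∅ := Finset.card_eq_zero.1 (by omega)
    -- With no outer neighbours, `I` minus `u` is a block attached at `u` alone.
    refine hblock1 (I.erase u) u v (Finset.finite_toSet _) ?_ ⟨?_, hu, hu, ?_, ?_, ?_⟩ ?_
    · rw [Set.ncard_coe_finset]
      exact (Finset.card_erase_le).trans hI
    · intro w hw
      exact hKm w (Finset.mem_union_left _ (Finset.mem_of_mem_erase hw))
    · simp
    · simp
    · intro i hi w hw hiw
      have hi' : i ∈ I := Finset.mem_of_mem_erase hi
      have := hnb i hi' w ⟨hiw, hKm i (Finset.mem_union_left _ hi'), hw⟩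
      by_cases hwu : w = u
      · exact Or.inr (Or.inl hwu)
      · left; simpa [hwu] using this
    · simpa [hvI] using huv.ne'
  · obtain ⟨x, y, rfl⟩ : ∃ x y, Q = {x, y} := by
      rcases Nat.lt_or_ge Q.card 2 with h2 | h2
      · obtain ⟨x, rfl⟩ := Finset.card_eq_one.1 (show Q.card = 1 by omega)
        exact ⟨x, x, by simp⟩
      · obtain ⟨x, y, -, rfl⟩ := Finset.card_eq_two.1 (show Q.card = 2 by omega)
        exact ⟨x, y, rfl⟩
    rw [Finset.disjoint_right] at hd
    refine hblock I x y u (Finset.finite_toSet _) (by rwa [Set.ncard_coe_finset])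
      ⟨?_, hKm x (by simp), hKm y (by simp), hd (by simp), hd (by simp), ?_⟩ huI huS
    · exact fun w hw => hKm w (Finset.mem_union_left _ hw)
    · intro i hi w hw hiw
      simpa using hnb i hi w ⟨hiw, hKm i (Finset.mem_union_left _ hi), hw⟩

end SimpleGraph

/-! ### Reduced instances -/

namespace PRGraph

variable {V : Type*} {G : PRGraph V}

theorem hasStableCut_iff_hasCut : G.HasStableCut ↔ G.graph.HasCut Set.univ G.irreflexive := by
  rw [hasStableCut_iff_surjective_hom]
  simp only [IsHom, P3101_edge]
  constructor
  · rintro ⟨f, hf, hs⟩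
    refine ⟨f, ⟨?_, ?_, ?_⟩, fun c => ?_⟩
    · exact fun u v huv h => hf u v (Or.inl huv.1) (Or.inl h)
    · exact fun u v huv h => hf u v (Or.inl huv.1) (Or.inr (Or.inr h))
    · exact fun u _ h1 hr => hf u u (Or.inr ⟨rfl, hr⟩) (Or.inr (Or.inr ⟨h1, h1⟩))
    · obtain ⟨v, hv⟩ := hs c
      exact ⟨v, trivial, hv⟩
  · rintro ⟨f, hf, hs⟩
    refine ⟨f, ?_, fun c => ?_⟩
    · rintro u v (huv | ⟨rfl, hr⟩) h
      · have huv' : (G.graph.restrict Set.univ).Adj u v := ⟨huv, trivial, trivial⟩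
        rcases h with h | h | h
        exacts [hf.far u v huv' h, hf.far v u huv'.symm h.symm, hf.mid u v huv' h]
      · rcases h with h | h | h
        · exact absurd (h.1.symm.trans h.2) (by decide)
        · exact absurd (h.1.symm.trans h.2) (by decide)
        · exact hf.loop u trivial h.1 hr
    · obtain ⟨v, -, hv⟩ := hs c
      exact ⟨v, hv⟩

/-- Adjacent irreflexive vertices have degree neither one nor two, so `exists_piece` applies. The
resulting `I ∪ Q` has at most ten vertices, and only those of `Q` can have neighbours outside, which
contradicts `boundary`. -/
theorem IsReduced.isIndepSet [Finite V] (hR : G.IsReduced) (hG : G.graph.NoH2221C3) :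
    G.graph.IsIndepSet G.irreflexive := by
  classical
  intro u hu v hv _ huv
  have two : ∀ p q, G.graph.Adj p q → ∃ r, G.graph.Adj p r ∧ r ≠ q := by
    intro p q hpq
    by_contra! hcon
    apply hR.degree_ne_one p
    rw [Set.ncard_eq_one]
    exact ⟨q, Set.ext fun w => ⟨fun h => hcon w h, fun h => by rw [h]; exact hpq⟩⟩
  have three : ∀ p q, G.graph.Adj p q → p ∈ G.irreflexive → ∀ x, ∃ a, G.graph.Adj p a ∧ a ≠ q ∧
      a ≠ x := by
    intro p q hpq hp x
    obtain ⟨r, hpr, hrq⟩ := two p q hpq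
    by_contra! hcon
    obtain rfl := hcon r hpr hrq
    refine hp (hR.degree_two p ?_)
    rw [Set.ncard_eq_two]
    refine ⟨q, r, hrq.symm, Set.ext fun w => ⟨fun h => ?_, ?_⟩⟩
    · by_cases hwq : w = q
      · exact Or.inl hwq
      · exact Or.inr (hcon w h hwq)
    · rintro (rfl | rfl)
      exacts [hpq, hpr]
  obtain ⟨I, Q, huI, hvI, hI, hQ, hd, hnb, -, hc⟩ := hG.exists_piece huv (fun w => Set.toFinite _)
    (three u v huv hu) (three v u huv.symm hv) two (by
      intro p q r t hpq hw hpr _ _ _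
      apply hR.no_twins p q hpq
      have hpq' : ¬ G.graph.Adj p q := fun h => G.graph.irrefl ((hw q).1 h)
      ext w
      simp only [Set.mem_sdiff, SimpleGraph.mem_neighborSet, Set.mem_singleton_iff, hw w]
      constructor
      · rintro ⟨h, -⟩
        exact ⟨h, fun h' => by subst h'; exact G.graph.irrefl ((hw w).2 h)⟩
      · rintro ⟨h, -⟩
        exact ⟨h, fun h' => G.graph.irrefl (h' ▸ h)⟩)
  have hZ := hR.boundary (↑(I ∪ Q)) (Finset.finite_toSet _)
    (by
      rw [Set.ncard_coe_finset]
      exact (Finset.card_union_le _ _).trans (by omega)) hc (by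
      refine ⟨u, by simp [huI], ?_⟩
      obtain ⟨a, ha, hav, -⟩ := three u v huv hu v
      obtain ⟨b, hb, hbv, hba⟩ := three u v huv hu a
      have hsub : (({v, a, b} : Finset V) : Set V) ⊆ G.graph.neighborSet u ∩ ↑(I ∪ Q) := by
        intro w hw
        have hw' : G.graph.Adj u w := by
          simp only [Finset.coe_insert, Finset.coe_singleton, Set.mem_insert_iff,
            Set.mem_singleton_iff] at hw
          rcases hw with rfl | rfl | rfl <;> assumption
        exact ⟨hw', by simpa using hnb u huI w hw'⟩
      have := Set.ncard_le_ncard hsub (Set.toFinite _)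
      rw [Set.ncard_coe_finset, Finset.card_insert_of_notMem, Finset.card_pair hba.symm] at this
      · exact this
      · simp [hav.symm, hbv.symm])
  have hsub : {z | z ∈ (↑(I ∪ Q) : Set V) ∧ ∃ w, w ∉ (↑(I ∪ Q) : Set V) ∧ G.graph.Adj z w} ⊆
      (Q : Set V) := by
    rintro z ⟨hz, w, hw, hzw⟩
    simp only [Finset.coe_union, Set.mem_union, Finset.mem_coe, not_or] at hz hw
    rcases hz with hz | hz
    · rcases hnb z hz w hzw with h | h
      exacts [absurd h hw.1, absurd h hw.2]
    · exact hz
  have := Set.ncard_le_ncard hsub (Set.toFinite _)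
  rw [Set.ncard_coe_finset] at this
  omega

/-- By stability the set of irreflexive vertices is itself a stable cut as soon as it is a cutset.
Conversely, every cut yields two reflexive vertices which that set separates. -/
theorem IsReduced.hasStableCut_iff [Finite V] (hR : G.IsReduced) (hG : G.graph.NoH2221C3) :
    G.HasStableCut ↔ G.IsCutset G.irreflexive := by
  have hind := hR.isIndepSet hG
  refine ⟨fun h => ?_, fun h => ⟨_, h, hind, le_rfl⟩⟩
  rw [hasStableCut_iff_hasCut] at h
  have hne : G.irreflexive.Nonempty := by
    obtain ⟨f, hf, hs⟩ := h
    obtain ⟨c, -, hc⟩ := hs 1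
    exact ⟨c, hf.loop c trivial hc⟩
  have h' := h
  obtain ⟨f, -, hs⟩ := h'
  obtain ⟨a, -, b, -, ha, hb, hab⟩ := h.exists_separated
    (fun u _ hu v _ hv huv => hind hu hv huv.ne huv) (by
      intro u _ hu
      by_contra! hcon
      obtain ⟨v, hv⟩ : ∃ v, v ≠ u := by
        by_contra! h1
        obtain ⟨p, -, hp⟩ := hs 0
        obtain ⟨q, -, hq⟩ := hs 1
        rw [h1 p] at hp
        rw [h1 q, hp] at hq
        exact absurd hq (by decide)
      -- An isolated vertex has an empty neighbourhood, contained in every other one, so `nested`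
      -- makes it reflexive.
      exact hu (hR.nested u v hv.symm (fun w hw => (hcon w trivial hw).elim)).1)
  refine ⟨hne, fun hpre => hab ?_⟩
  have := (SimpleGraph.reachable_iff_reflTransGen _ _).1 (hpre ⟨a, ha⟩ ⟨b, hb⟩)
  refine Relation.ReflTransGen.lift (p := G.graph.Step Set.univ G.irreflexive) Subtype.val ?_ _ _ this
  exact fun x y hxy => ⟨⟨by simpa using hxy, trivial, trivial⟩, x.2, y.2⟩

end PRGraph

/-! ### Programs for bounded quantifiers and reachability -/

namespace RAM

open Relation

/-- Started in `s`, the program `c` halts after at most `T` steps in a state that satisfies `Q`. -/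
def Runs (c : Cmd) (s : State) (T : ℕ) (Q : State → Prop) : Prop :=
  ∃ t s', Exec c s t s' ∧ t ≤ T ∧ Q s'

section Runs

variable {c d : Cmd} {s : State} {T T' : ℕ} {Q R : State → Prop} {x y z k a : ℕ}

theorem Runs.mono (h : Runs c s T R) (hT : T ≤ T') (hQ : ∀ s', R s' → Q s') : Runs c s T' Q := by
  obtain ⟨t, s', he, ht, hr⟩ := h
  exact ⟨t, s', he, ht.trans hT, hQ s' hr⟩

theorem Runs.const (h : Q (s.setReg x k)) : Runs (.const x k) s 1 Q :=
  ⟨1, _, .const x k s, le_rfl, h⟩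

theorem Runs.add (h : Q (s.setReg x (s.reg y + s.reg z))) : Runs (.add x y z) s 1 Q :=
  ⟨1, _, .add x y z s, le_rfl, h⟩

theorem Runs.sub (h : Q (s.setReg x (s.reg y - s.reg z))) : Runs (.sub x y z) s 1 Q :=
  ⟨1, _, .sub x y z s, le_rfl, h⟩

theorem Runs.load (h : Q (s.setReg x (s.arr a (s.reg y)))) : Runs (.load x a y) s 1 Q :=
  ⟨1, _, .load x a y s, le_rfl, h⟩

theorem Runs.store (h : Q (s.setArr a (s.reg x) (s.reg y))) : Runs (.store a x y) s 1 Q :=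
  ⟨1, _, .store a x y s, le_rfl, h⟩

theorem Runs.seq (h : Runs c s T R) (h' : ∀ s', R s' → Runs d s' T' Q) :
    Runs (.seq c d) s (T + T') Q := by
  obtain ⟨t, s', he, ht, hr⟩ := h
  obtain ⟨t', s'', he', ht', hq⟩ := h' s' hr
  exact ⟨t + t', s'', .seq he he', add_le_add ht ht', hq⟩

theorem Runs.const_seq (h : Runs d (s.setReg x k) T Q) : Runs (.seq (.const x k) d) s (1 + T) Q :=
  (Runs.const (Q := (· = s.setReg x k)) rfl).seq fun _ e => e ▸ h

theorem Runs.add_seq (h : Runs d (s.setReg x (s.reg y + s.reg z)) T Q) :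
    Runs (.seq (.add x y z) d) s (1 + T) Q :=
  (Runs.add (Q := (· = s.setReg x (s.reg y + s.reg z))) rfl).seq fun _ e => e ▸ h

theorem Runs.sub_seq (h : Runs d (s.setReg x (s.reg y - s.reg z)) T Q) :
    Runs (.seq (.sub x y z) d) s (1 + T) Q :=
  (Runs.sub (Q := (· = s.setReg x (s.reg y - s.reg z))) rfl).seq fun _ e => e ▸ h

theorem Runs.load_seq (h : Runs d (s.setReg x (s.arr a (s.reg y))) T Q) :
    Runs (.seq (.load x a y) d) s (1 + T) Q :=
  (Runs.load (Q := (· = s.setReg x (s.arr a (s.reg y)))) rfl).seq fun _ e => e ▸ h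

theorem Runs.store_seq (h : Runs d (s.setArr a (s.reg x) (s.reg y)) T Q) :
    Runs (.seq (.store a x y) d) s (1 + T) Q :=
  (Runs.store (Q := (· = s.setArr a (s.reg x) (s.reg y))) rfl).seq fun _ e => e ▸ h

theorem Runs.ite (h : s.reg x ≠ 0 → Runs c s T Q) (h' : s.reg x = 0 → Runs d s T Q) :
    Runs (.ite x c d) s (1 + T) Q := by
  by_cases hx : s.reg x = 0
  · obtain ⟨t, s', he, ht, hq⟩ := h' hx
    exact ⟨1 + t, s', .ite_false hx he, by omega, hq⟩
  · obtain ⟨t, s', he, ht, hq⟩ := h hx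
    exact ⟨1 + t, s', .ite_true hx he, by omega, hq⟩

/-- The measure drops in every round, so there are at most `m s` rounds, each costing the body and
one test. The last test accounts for the extra `1`. -/
theorem Runs.while (Inv : State → Prop) (m : State → ℕ)
    (hstep : ∀ s, Inv s → s.reg x ≠ 0 → Runs c s T (fun s' => Inv s' ∧ m s' < m s))
    (hs : Inv s) :
    Runs (.while x c) s (1 + m s * (T + 1)) (fun s' => Inv s' ∧ s'.reg x = 0) := by
  suffices ∀ N s, m s ≤ N → Inv s →
      Runs (.while x c) s (1 + m s * (T + 1)) (fun s' => Inv s' ∧ s'.reg x = 0) from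
    this _ s le_rfl hs
  intro N
  induction N with
  | zero =>
    intro s hm hs
    by_cases hx : s.reg x = 0
    · exact ⟨1, s, .while_done hx, by omega, hs, hx⟩
    · obtain ⟨t, s', -, -, -, hlt⟩ := hstep s hs hx
      omega
  | succ N ih =>
    intro s hm hs
    by_cases hx : s.reg x = 0
    · exact ⟨1, s, .while_done hx, by omega, hs, hx⟩
    · obtain ⟨t, s', he, ht, hs', hlt⟩ := hstep s hs hx
      obtain ⟨t', s'', he', ht', hq⟩ := ih s' (by omega) hs'
      refine ⟨1 + t + t', s'', .while_step hx he he', ?_, hq⟩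
      have : (m s' + 1) * (T + 1) ≤ m s * (T + 1) := Nat.mul_le_mul_right _ hlt
      rw [add_mul] at this
      omega

end Runs

/-- The registers below `d`, except for the volatile registers `1`, `2`, `3`, and the arrays
below `e` are the same. -/
structure Agree (d e : ℕ) (s s' : State) : Prop where
  reg : ∀ x < d, (x = 0 ∨ 4 ≤ x) → s'.reg x = s.reg x
  arr : ∀ a < e, s'.arr a = s.arr a

section Agree

variable {d d' e e' : ℕ} {s s' s'' : State}

theorem Agree.refl (d e : ℕ) (s : State) : Agree d e s s := ⟨fun _ _ _ => rfl, fun _ _ => rfl⟩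

theorem Agree.trans (h : Agree d e s s') (h' : Agree d e s' s'') : Agree d e s s'' :=
  ⟨fun x hx hx' => (h'.reg x hx hx').trans (h.reg x hx hx'),
    fun a ha => (h'.arr a ha).trans (h.arr a ha)⟩

theorem Agree.mono (h : Agree d' e' s s') (hd : d ≤ d') (he : e ≤ e') : Agree d e s s' :=
  ⟨fun x hx hx' => h.reg x (hx.trans_le hd) hx', fun a ha => h.arr a (ha.trans_le he)⟩

theorem Agree.setReg (h : Agree d e s s') {x v : ℕ} (hx : d ≤ x ∨ x = 1 ∨ x = 2 ∨ x = 3) :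
    Agree d e s (s'.setReg x v) := by
  refine ⟨fun y hy hy' => ?_, h.arr⟩
  have : y ≠ x := by omega
  simp only [State.setReg, Function.update_of_ne this]
  exact h.reg y hy hy'

theorem Agree.setArr (h : Agree d e s s') {a i v : ℕ} (ha : e ≤ a) :
    Agree d e s (s'.setArr a i v) := by
  refine ⟨h.reg, fun b hb => ?_⟩
  have : b ≠ a := by omega
  simp only [State.setArr, Function.update_of_ne this]
  exact h.arr b hb

end Agree

/-- `P` depends on the registers below `d` and the arrays below `e` only, and some program decides
it in polynomial time without changing those. -/
def Dec (d e : ℕ) (P : State → Prop) : Prop :=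
  (∀ s s', Agree d e s s' → (P s' ↔ P s)) ∧ ∃ (c : Cmd) (p : Polynomial ℕ), ∀ s,
    Runs c s (p.eval (s.reg 0)) (fun s' => Agree d e s s' ∧ (s'.reg 1 ≠ 0 ↔ P s))

section Dec

variable {d e : ℕ} {P Q : State → Prop}

theorem Dec.congr (h : Dec d e P) (hPQ : ∀ s, P s ↔ Q s) : Dec d e Q := by
  obtain rfl : P = Q := funext fun s => propext (hPQ s)
  exact h

theorem Dec.not (h : Dec d e P) : Dec d e (fun s => ¬ P s) := by
  obtain ⟨hl, c, p, hc⟩ := h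
  refine ⟨fun s s' hs => not_congr (hl s s' hs), .seq c (.ite 1 (.const 1 0) (.const 1 1)),
    p + 2, fun s => ?_⟩
  simp only [Polynomial.eval_add, Polynomial.eval_ofNat]
  refine (hc s).seq fun s' ⟨ha, hs'⟩ => Runs.ite (T := 1) (fun h1 => Runs.const ?_)
    (fun h1 => Runs.const ?_)
  · exact ⟨ha.setReg (by omega), by simp [State.setReg, hs'.1 h1]⟩
  · refine ⟨ha.setReg (by omega), ?_⟩
    have : ¬ P s := fun h => hs'.2 h h1
    simp [State.setReg, this]

theorem Dec.and (hd : 1 ≤ d) (h : Dec d e P) (h' : Dec d e Q) : Dec d e (fun s => P s ∧ Q s) := by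
  obtain ⟨hl, c, p, hc⟩ := h
  obtain ⟨hl', c', p', hc'⟩ := h'
  refine ⟨fun s s' hs => and_congr (hl s s' hs) (hl' s s' hs), .seq c (.ite 1 c' (.const 1 0)),
    p + (1 + (p' + 1)), fun s => ?_⟩
  simp only [Polynomial.eval_add, Polynomial.eval_one]
  refine (hc s).seq fun s' ⟨ha, hs'⟩ => Runs.ite (fun h1 => ?_) (fun h1 => ?_)
  -- Register `0` lies below `d` and is preserved, so the second time bound refers to the same `n`.
  · have := hc' s'
    rw [ha.reg 0 (by omega) (by omega)] at this
    refine this.mono (by omega) fun s'' ⟨ha', hs''⟩ => ⟨ha.trans ha', ?_⟩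
    rw [hs'', hl' s s' ha]
    exact ⟨fun h => ⟨hs'.1 h1, h⟩, fun h => h.2⟩
  · refine (Runs.const (Q := fun s'' => Agree d e s s'' ∧ (s''.reg 1 ≠ 0 ↔ P s ∧ Q s)) ?_).mono
      (by omega) (fun _ h => h)
    refine ⟨ha.setReg (by omega), ?_⟩
    have : ¬ P s := fun h => hs'.2 h h1
    simp [State.setReg, this]

theorem Dec.or (hd : 1 ≤ d) (h : Dec d e P) (h' : Dec d e Q) : Dec d e (fun s => P s ∨ Q s) :=
  (h.not.and hd h'.not).not.congr fun s => by tauto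

theorem Dec.true : Dec d e (fun _ => True) := by
  refine ⟨fun _ _ _ => Iff.rfl, .const 1 1, 1, fun s => ?_⟩
  simp only [Polynomial.eval_one]
  exact Runs.const ⟨(Agree.refl d e s).setReg (by omega), by simp [State.setReg]⟩

/-- The bound `k` is a constant of the program, so the quantifier is unrolled into a conjunction. -/
theorem Dec.forall_lt (hd : 1 ≤ d) (k : ℕ) {P : ℕ → State → Prop} (h : ∀ i < k, Dec d e (P i)) :
    Dec d e (fun s => ∀ i < k, P i s) := by
  induction k with
  | zero => exact Dec.true.congr fun s => by simp
  | succ k ih =>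
    refine ((ih fun i hi => h i (hi.trans k.lt_succ_self)).and hd (h k k.lt_succ_self)).congr
      fun s => ?_
    constructor
    · rintro ⟨h1, h2⟩ i hi
      rcases Nat.lt_succ_iff_lt_or_eq.1 hi with hi | rfl
      exacts [h1 i hi, h2]
    · exact fun h1 => ⟨fun i hi => h1 i (hi.trans k.lt_succ_self), h1 k k.lt_succ_self⟩

theorem Dec.exists_lt (hd : 1 ≤ d) (k : ℕ) {P : ℕ → State → Prop} (h : ∀ i < k, Dec d e (P i)) :
    Dec d e (fun s => ∃ i < k, P i s) :=
  (Dec.forall_lt hd k (fun i hi => (h i hi).not)).not.congr fun s => by push Not; rfl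

theorem Dec.eq {x y : ℕ} (hx : x < d) (hx' : 4 ≤ x) (hy : y < d) (hy' : 4 ≤ y) :
    Dec d e (fun s => s.reg x = s.reg y) := by
  have : Dec d e (fun s => s.reg x ≠ s.reg y) := by
    -- With truncated subtraction, two numbers differ exactly if `(x - y) + (y - x)` is nonzero.
    refine ⟨fun s s' h => ?_, .seq (.sub 1 x y) (.seq (.sub 2 y x) (.add 1 1 2)), 3, fun s => ?_⟩
    · simp only [h.reg x hx (Or.inr hx'), h.reg y hy (Or.inr hy')]
    · simp only [Polynomial.eval_ofNat]
      refine Runs.sub_seq (T := 2) (Runs.sub_seq (T := 1) (Runs.add ⟨?_, ?_⟩))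
      · exact ((((Agree.refl d e s).setReg (by omega)).setReg (by omega)).setReg (by omega))
      · have e1 : x ≠ 1 := by omega
        have e2 : y ≠ 1 := by omega
        simp only [State.setReg, Function.update_self, Function.update_of_ne e1,
          Function.update_of_ne e2, Function.update_of_ne (show (1 : ℕ) ≠ 2 by decide)]
        omega
  exact this.not.congr fun s => not_not

theorem Dec.cell {a x : ℕ} (ha : a < e) (hx : x < d) (hx' : 4 ≤ x) :
    Dec d e (fun s => s.arr a (s.reg x) ≠ 0) := by
  refine ⟨fun s s' h => ?_, .load 1 a x, 1, fun s => ?_⟩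
  · simp only [h.reg x hx (Or.inr hx'), h.arr a ha]
  · simp only [Polynomial.eval_one]
    exact Runs.load ⟨(Agree.refl d e s).setReg (by omega), by simp [State.setReg]⟩

/-- The entry in row `x` and column `y` of the matrix in array `0`, the rows of which start at the
positions given by array `1`. -/
theorem Dec.entry {x y : ℕ} (he : 4 ≤ e) (hx : x < d) (hx' : 4 ≤ x) (hy : y < d) (hy' : 4 ≤ y) :
    Dec d e (fun s => s.arr 0 (s.arr 1 (s.reg x) + s.reg y) ≠ 0) := by
  refine ⟨fun s s' h => ?_, .seq (.load 1 1 x) (.seq (.add 1 1 y) (.load 1 0 1)), 3, fun s => ?_⟩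
  · simp only [h.reg x hx (Or.inr hx'), h.reg y hy (Or.inr hy'), h.arr 0 (by omega), h.arr 1 (by omega)]
  · simp only [Polynomial.eval_ofNat]
    refine Runs.load_seq (T := 2) (Runs.add_seq (T := 1) (Runs.load ⟨?_, ?_⟩))
    · exact ((((Agree.refl d e s).setReg (by omega)).setReg (by omega)).setReg (by omega))
    · have e2 : y ≠ 1 := by omega
      simp [State.setReg, Function.update_of_ne e2]

end Dec

/-- Overwrite the registers `d, …, d + k - 1`. -/
def State.setRegs (s : State) (d k : ℕ) (f : ℕ → ℕ) : State :=
  { s with reg := fun x => if d ≤ x ∧ x < d + k then f (x - d) else s.reg x }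

/-- A program that searches for values of the registers `d, …, d + k - 1` satisfying `P`, below the
content of register `0`. -/
def IsSearch (c : Cmd) (p : Polynomial ℕ) (d k e : ℕ) (P : State → Prop) : Prop :=
  ∀ s, Runs c s (p.eval (s.reg 0)) (fun s' => Agree d e s s' ∧
    (s'.reg 1 ≠ 0 → P s' ∧ ∀ i < k, s'.reg (d + i) < s.reg 0) ∧
    (s'.reg 1 = 0 → ∀ f : ℕ → ℕ, (∀ i < k, f i < s.reg 0) → ¬ P (s.setRegs d k f)))

/-- These are `k` nested loops, built by recursion: the outer one runs register `d` through the
values below `n`, the inner search treats the later registers. For fixed `k` the time stays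
polynomial. The witness is left in the registers, where the closure and reduction loops need it. -/
theorem exists_isSearch {e : ℕ} {P : State → Prop} : ∀ {k d : ℕ}, 4 ≤ d → Dec (d + k) e P →
    ∃ c p, IsSearch c p d k e P
  | 0, d, hd, ⟨hl, c, p, hc⟩ => by
    refine ⟨c, p, fun s => (hc s).mono le_rfl fun s' ⟨ha, hs'⟩ => ⟨ha, fun h1 => ?_, fun h1 => ?_⟩⟩
    · exact ⟨(hl s s' ha).2 (hs'.1 h1), fun i hi => absurd hi (by omega)⟩
    · intro f _ hP
      refine hs'.2 ((hl s (s.setRegs d 0 f) ⟨fun x hx _ => ?_, fun _ _ => rfl⟩).1 hP) h1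
      exact if_neg (by omega)
  | k + 1, d, hd, h => by
    rw [show d + (k + 1) = (d + 1) + k by ring] at h
    obtain ⟨c, p, hc⟩ := exists_isSearch (by omega) h
    obtain ⟨hl, -⟩ := h
    -- Register `2` holds the number of values still to be tried and controls the loop; a success
    -- sets it to `0`. Register `1` starts at `0` so that an empty range counts as failure.
    refine ⟨.seq (.const d 0) (.seq (.sub 2 0 d) (.seq (.const 1 0) (.while 2 (.seq c
      (.ite 1 (.const 2 0) (.seq (.const 3 1) (.seq (.add d d 3) (.sub 2 0 d)))))))),
      3 + (1 + Polynomial.X * (p + 4 + 1)), fun s => ?_⟩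
    simp only [Polynomial.eval_add, Polynomial.eval_ofNat, Polynomial.eval_mul, Polynomial.eval_X,
      Polynomial.eval_one]
    rw [show 3 + (1 + s.reg 0 * (p.eval (s.reg 0) + 4 + 1)) =
      1 + (1 + (1 + (1 + s.reg 0 * (p.eval (s.reg 0) + 4 + 1)))) by ring]
    refine Runs.const_seq (Runs.sub_seq (Runs.const_seq ?_))
    have e1 : d ≠ 1 := by omega
    have e2 : d ≠ 2 := by omega
    have e3 : d ≠ 3 := by omega
    have f0 : 0 ≠ d := by omega
    have f1 : 1 ≠ d := by omega
    generalize hs₃ : ((s.setReg d 0).setReg 2 _).setReg 1 0 = s₃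
    have ha₃ : Agree d e s s₃ := by
      subst hs₃
      exact ((Agree.refl d e s).setReg (by omega)).setReg (by omega) |>.setReg (by omega)
    have hd0 : s₃.reg d = 0 := by
      subst hs₃
      simp [State.setReg, e1, e2]
    have hr1 : s₃.reg 1 = 0 := by
      subst hs₃
      simp [State.setReg]
    have hr2 : s₃.reg 2 = s.reg 0 := by
      subst hs₃
      simp [State.setReg, f0]
    -- As long as register `1` is `0`, every tuple whose first entry is below the counter has been
    -- excluded.
    let Inv : State → Prop := fun s' => Agree d e s s' ∧
      (s'.reg 1 ≠ 0 → s'.reg 2 = 0 ∧ P s' ∧ ∀ i < k + 1, s'.reg (d + i) < s.reg 0) ∧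
      (s'.reg 1 = 0 → s'.reg 2 = s.reg 0 - s'.reg d ∧
        ∀ f : ℕ → ℕ, (∀ i < k + 1, f i < s.reg 0) → f 0 < s'.reg d →
          ¬ P (s.setRegs d (k + 1) f))
    have := Runs.while (x := 2) (c := .seq c (.ite 1 (.const 2 0) (.seq (.const 3 1)
      (.seq (.add d d 3) (.sub 2 0 d))))) (s := s₃) (T := p.eval (s.reg 0) + 4) Inv
      (fun s' => s'.reg 2) ?_ ?_
    · rw [hr2] at this
      refine this.mono le_rfl fun s' ⟨⟨ha, h1, h0⟩, hs'⟩ => ⟨ha, fun h => (h1 h).2, fun h f hf => ?_⟩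
      obtain ⟨h2, h3⟩ := h0 h
      have := hf 0 (by omega)
      exact h3 f hf (by omega)
    · rintro s' ⟨ha, h1, h0⟩ hne
      have hz : s'.reg 1 = 0 := by
        by_contra h
        exact hne (h1 h).1
      obtain ⟨hr, hno⟩ := h0 hz
      have e0 : s'.reg 0 = s.reg 0 := ha.reg 0 (by omega) (by omega)
      have hcs := hc s'
      rw [e0] at hcs
      refine hcs.seq fun s'' ⟨ha', hyes, hno'⟩ => Runs.ite (T := 3) (fun hs1 => ?_) (fun hs0 => ?_)
      · refine (Runs.const (Q := fun t => t = s''.setReg 2 0) rfl).mono (by omega) ?_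
        rintro _ rfl
        have ha'' : Agree d e s s'' := ha.trans (ha'.mono (by omega) le_rfl)
        refine ⟨⟨ha''.setReg (by omega), fun _ => ⟨by simp [State.setReg], ?_, ?_⟩, ?_⟩, ?_⟩
        · exact (hl s'' _ ((Agree.refl _ e s'').setReg (by omega))).2 (hyes hs1).1
        · intro i hi
          have : d + i ≠ 2 := by omega
          simp only [State.setReg, Function.update_of_ne this]
          rcases Nat.eq_zero_or_pos i with rfl | hi0
          · rw [add_zero, ha'.reg d (by omega) (by omega)]
            omega
          · have := (hyes hs1).2 (i - 1) (by omega)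
            rwa [show d + 1 + (i - 1) = d + i by omega] at this
        · intro h
          simp [State.setReg] at h
          exact absurd h hs1
        · simp only [State.setReg, Function.update_self]
          omega
      · refine Runs.const_seq (T := 2) (Runs.add_seq (T := 1) (Runs.sub ?_))
        have hdd : s''.reg d = s'.reg d := ha'.reg d (by omega) (by omega)
        have h00 : s''.reg 0 = s.reg 0 := (ha'.reg 0 (by omega) (by omega)).trans e0
        have ha'' : Agree d e s s'' := ha.trans (ha'.mono (by omega) le_rfl)
        refine ⟨⟨?_, ?_, ?_⟩, ?_⟩
        · exact ((ha''.setReg (by omega)).setReg (by omega)).setReg (by omega)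
        · intro h
          simp [State.setReg, f1, hs0] at h
        · intro _
          simp only [State.setReg, Function.update_self, Function.update_of_ne e2,
            Function.update_of_ne e3, Function.update_of_ne f0,
            Function.update_of_ne (show 0 ≠ 3 by decide), h00, hdd]
          refine ⟨trivial, fun f hf hf0 hP => ?_⟩
          rcases Nat.lt_succ_iff_lt_or_eq.1 hf0 with h | h
          · exact hno f hf h hP
          -- The first entry is the current counter value, and the failed inner search excludes
          -- every tail.
          · refine hno' hs0 (fun i => f (i + 1)) (fun i hi => ?_) ((hl _ _ ⟨fun x hx hx' => ?_,
              fun a haa => ?_⟩).1 hP)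
            · exact hf (i + 1) (by omega)
            · simp only [State.setRegs]
              by_cases hxd : x < d
              · rw [if_neg (by omega), if_neg (by omega), ha.reg x hxd hx']
              · rw [if_pos (by omega)]
                by_cases hxd' : x = d
                · subst hxd'
                  rw [if_neg (by omega), Nat.sub_self, h]
                · rw [if_pos (by omega), show x - (d + 1) + 1 = x - d by omega]
            · exact (ha.arr a haa).symm
        · simp only [State.setReg, Function.update_self, Function.update_of_ne e3, Function.update_of_ne f0,
            Function.update_of_ne (show 0 ≠ 3 by decide), h00, hdd]
          omega
    · refine ⟨ha₃, fun h => absurd hr1 h, fun _ => ⟨by rw [hr2, hd0, Nat.sub_zero], ?_⟩⟩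
      intro f _ hf0
      rw [hd0] at hf0
      omega

theorem Dec.exists_regs {d e k : ℕ} {P : State → Prop} (hd : 4 ≤ d) (h : Dec (d + k) e P) :
    Dec d e (fun s => ∃ f : ℕ → ℕ, (∀ i < k, f i < s.reg 0) ∧ P (s.setRegs d k f)) := by
  obtain ⟨c, p, hc⟩ := exists_isSearch hd h
  obtain ⟨hl, -⟩ := h
  have key : ∀ s s' f, Agree d e s s' → (P (s'.setRegs d k f) ↔ P (s.setRegs d k f)) := by
    intro s s' f h
    refine hl _ _ ⟨fun x hx hx' => ?_, h.arr⟩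
    simp only [State.setRegs]
    split_ifs with hif
    · rfl
    · exact h.reg x (by omega) hx'
  refine ⟨fun s s' h => ?_, c, p, fun s => (hc s).mono le_rfl fun s' ⟨ha, hyes, hno⟩ =>
    ⟨ha, fun h1 => ?_, fun ⟨f, hf, hP⟩ h1 => hno h1 f hf hP⟩⟩
  · simp only [h.reg 0 (by omega) (by omega)]
    exact exists_congr fun f => and_congr_right fun _ => key s s' f h
  · obtain ⟨hP, hlt⟩ := hyes h1
    refine ⟨fun i => s'.reg (d + i), hlt, (hl _ _ ⟨fun x hx hx' => ?_, fun a haa => ?_⟩).1 hP⟩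
    · simp only [State.setRegs]
      split_ifs with hif
      · rw [show d + (x - d) = x by omega]
      · exact ha.reg x (by omega) hx'
    · exact ha.arr a haa

end RAM

/-! ### Reachability -/

namespace RAM

open Relation

/-- Set the first cells of array `e` to zero, with register `d` as a counter. -/
def clear (d e : ℕ) : Cmd :=
  .seq (.const d 0) (.seq (.sub 2 0 d) (.while 2 (.seq (.const 3 0) (.seq (.store e d 3)
    (.seq (.const 3 1) (.seq (.add d d 3) (.sub 2 0 d)))))))

theorem runs_clear {d e : ℕ} (hd : 4 ≤ d) (s : State) :
    Runs (clear d e) s (3 + s.reg 0 * 6)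
      (fun s' => Agree d e s s' ∧ ∀ i < s.reg 0, s'.arr e i = 0) := by
  have e2 : d ≠ 2 := by omega
  have e3 : d ≠ 3 := by omega
  have f0 : 0 ≠ d := by omega
  have f2 : 2 ≠ d := by omega
  have f3 : 3 ≠ d := by omega
  rw [show 3 + s.reg 0 * 6 = 1 + (1 + (1 + s.reg 0 * (5 + 1))) by ring]
  refine Runs.const_seq (Runs.sub_seq ?_)
  have := Runs.while (x := 2) (c := .seq (.const 3 0) (.seq (.store e d 3)
    (.seq (.const 3 1) (.seq (.add d d 3) (.sub 2 0 d)))))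
    (s := (s.setReg d 0).setReg 2 ((s.setReg d 0).reg 0 - (s.setReg d 0).reg d)) (T := 5)
    (fun s' => Agree d e s s' ∧ s'.reg 2 = s.reg 0 - s'.reg d ∧ ∀ i < s'.reg d, s'.arr e i = 0)
    (fun s' => s'.reg 2) ?_ ?_
  · have h2 : ((s.setReg d 0).setReg 2 ((s.setReg d 0).reg 0 - (s.setReg d 0).reg d)).reg 2 =
        s.reg 0 := by simp [State.setReg, f0]
    rw [h2] at this
    refine this.mono le_rfl fun s' ⟨⟨ha, h2, h⟩, h0⟩ => ⟨ha, fun i hi => h i (by omega)⟩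
  · rintro s' ⟨ha, h2, h⟩ hne
    refine Runs.const_seq (T := 4) (Runs.store_seq (T := 3) (Runs.const_seq (T := 2)
      (Runs.add_seq (T := 1) (Runs.sub ⟨⟨?_, ?_, ?_⟩, ?_⟩))))
    · exact ((((ha.setReg (by omega)).setArr le_rfl).setReg (by omega)).setReg
        (by omega)).setReg (by omega)
    · simp [State.setReg, State.setArr, e2, e3, f0, ha.reg 0 (by omega)]
    · simp only [State.setReg, State.setArr, Function.update_self, Function.update_of_ne e3,
        Function.update_of_ne e2]
      intro i hi
      by_cases hid : i = s'.reg d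
      · simp [hid]
      · rw [Function.update_of_ne hid]
        exact h i (by omega)
    · simp only [State.setReg, State.setArr, Function.update_self, Function.update_of_ne e3,
        Function.update_of_ne f0, Function.update_of_ne (show 0 ≠ 3 by decide),
        ha.reg 0 (by omega) (by omega)]
      omega
  · refine ⟨((Agree.refl d e s).setReg (by omega)).setReg (by omega), ?_, ?_⟩
    · simp [State.setReg, f0, e2]
    · intro i hi
      simp [State.setReg, e2] at hi

/-- The relation that `P` defines on the values of two registers. -/
def Rel (d : ℕ) (P : State → Prop) (s : State) (i j : ℕ) : Prop :=
  i < s.reg 0 ∧ j < s.reg 0 ∧ P (s.setRegs d 2 fun k => if k = 0 then i else j)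

theorem Rel.congr {d e : ℕ} {P : State → Prop} (hd : 4 ≤ d)
    (hl : ∀ s s', Agree (d + 2) e s s' → (P s' ↔ P s)) {s s' : State} (h : Agree d e s s') :
    Rel d P s' = Rel d P s := by
  funext i j
  simp only [Rel, h.reg 0 (by omega) (by omega), eq_iff_iff]
  refine and_congr_right fun _ => and_congr_right fun _ => hl _ _ ⟨fun x hx hx' => ?_, h.arr⟩
  simp only [State.setRegs]
  split_ifs
  · rfl
  · rfl
  · exact h.reg x (by omega) hx'

/-- The termination measure of the marking loops: `j` ceases to be unmarked and no other cell
becomes unmarked. -/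
theorem card_filter_lt {n : ℕ} {p q : ℕ → Prop} [DecidablePred p] [DecidablePred q] {j : ℕ}
    (hj : j < n) (hpq : ∀ i < n, q i → p i) (hp : p j) (hq : ¬ q j) :
    ((Finset.range n).filter q).card < ((Finset.range n).filter p).card := by
  apply Finset.card_lt_card
  rw [Finset.ssubset_iff_of_subset]
  · exact ⟨j, by simp [hj, hp], by simp [hq]⟩
  · intro i
    simp only [Finset.mem_filter, Finset.mem_range]
    exact fun ⟨h1, h2⟩ => ⟨h1, hpq i h1 h2⟩

/-- Array `e` collects the vertices reached from `u`. Each round searches for a marked and an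
unmarked vertex in the relation and marks the latter, so there are at most `n` rounds. As array `e`
is then in use, `P` must also be decidable with `e + 1` protected arrays. -/
theorem Dec.reach {d e u v : ℕ} {P : State → Prop} (hd : 4 ≤ d) (hu : u < d) (hu' : 4 ≤ u)
    (hv : v < d) (hv' : 4 ≤ v) (h : ∀ e' ≥ e, Dec (d + 2) e' P) :
    Dec d e (fun s => ReflTransGen (Rel d P s) (s.reg u) (s.reg v)) := by
  have hl := (h e le_rfl).1
  have hQ : Dec (d + 2) (e + 1)
      (fun s => (s.arr e (s.reg d) ≠ 0 ∧ ¬ s.arr e (s.reg (d + 1)) ≠ 0) ∧ P s) :=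
    ((Dec.cell (by omega) (by omega) (by omega)).and (by omega)
      (Dec.cell (by omega) (by omega) (by omega)).not).and (by omega) (h (e + 1) (by omega))
  obtain ⟨c, p, hc⟩ := exists_isSearch hd hQ
  -- The cell of `v` is cleared separately, since the content of register `v` need not be below `n`.
  -- The cell of `u` is marked afterwards, which is right also when both cells coincide.
  refine ⟨fun s s' hs => ?_, .seq (clear d e) (.seq (.const 3 0) (.seq (.store e v 3)
    (.seq (.const 3 1) (.seq (.store e u 3) (.seq c (.seq (.while 1 (.seq (.const 3 1)
      (.seq (.store e (d + 1) 3) c))) (.load 1 e v))))))),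
    (3 + Polynomial.X * 6) + (4 + (p + ((1 + Polynomial.X * (2 + p + 1)) + 1))), fun s => ?_⟩
  · beta_reduce
    rw [Rel.congr hd hl hs, hs.reg u hu (Or.inr hu'), hs.reg v hv (Or.inr hv')]
  simp only [Polynomial.eval_add, Polynomial.eval_ofNat, Polynomial.eval_mul, Polynomial.eval_X,
    Polynomial.eval_one]
  -- `core` says that the marks are sound and `u` is marked. `full` adds the outcome of a search: an
  -- edge leaving the marked set, or its closure under the relation.
  let core : State → Prop := fun t => Agree d e s t ∧
    (∀ i, (i < s.reg 0 ∨ i = s.reg v) → t.arr e i ≠ 0 →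
      ReflTransGen (Rel d P s) (s.reg u) i) ∧ t.arr e (s.reg u) ≠ 0
  let full : State → Prop := fun t => core t ∧
    (t.reg 1 ≠ 0 → t.arr e (t.reg d) ≠ 0 ∧ t.arr e (t.reg (d + 1)) = 0 ∧
      Rel d P s (t.reg d) (t.reg (d + 1))) ∧
    (t.reg 1 = 0 → ∀ i j, t.arr e i ≠ 0 → Rel d P s i j → t.arr e j ≠ 0)
  have hsearch : ∀ t, core t → Runs c t (p.eval (s.reg 0))
      (fun t' => full t' ∧ t'.arr e = t.arr e) := by
    rintro t ⟨ha, hsound, hmark⟩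
    have h0 : t.reg 0 = s.reg 0 := ha.reg 0 (by omega) (by omega)
    have := hc t
    rw [h0] at this
    refine this.mono le_rfl fun t' ⟨ha', hyes, hno⟩ => ?_
    have he : t'.arr e = t.arr e := ha'.arr e (by omega)
    have hst : Agree d e s t' := ha.trans (ha'.mono le_rfl (by omega))
    refine ⟨⟨⟨hst, ?_, ?_⟩, fun h1 => ?_, fun h1 i j hi hij => ?_⟩, he⟩
    · rw [he]; exact hsound
    · rw [he]; exact hmark
    · obtain ⟨⟨⟨hm, hm'⟩, hP⟩, hlt⟩ := hyes h1
      refine ⟨hm, not_not.1 hm', hlt 0 (by omega), hlt 1 (by omega), ?_⟩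
      refine (hl t' (s.setRegs d 2 _) ⟨fun x hx hx' => ?_, fun a haa => (hst.arr a haa).symm⟩).2 hP
      simp only [State.setRegs]
      by_cases h1 : d ≤ x ∧ x < d + 2
      · rw [if_pos h1]
        rcases (show x = d ∨ x = d + 1 by omega) with rfl | rfl
        · simp
        · simp
      · rw [if_neg h1]
        exact (hst.reg x (by omega) hx').symm
    · rw [he] at hi ⊢
      intro hj
      refine hno h1 (fun k => if k = 0 then i else j) (fun k hk => ?_) ⟨⟨?_, ?_⟩, ?_⟩
      · split_ifs
        exacts [hij.1, hij.2.1]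
      · simpa [State.setRegs] using hi
      · simpa [State.setRegs] using hj
      · have := Rel.congr hd hl ha
        exact (this ▸ hij).2.2
  have hassoc : ∀ a b q : ℕ, a + (4 + (q + b)) = a + (1 + (1 + (1 + (1 + (q + b))))) := by
    intros; ring
  rw [hassoc]
  refine (runs_clear hd s).seq fun s₁ ⟨ha₁, hz⟩ => Runs.const_seq (Runs.store_seq (Runs.const_seq
    (Runs.store_seq ?_)))
  have u3 : u ≠ 3 := by omega
  have v3 : v ≠ 3 := by omega
  have hcore : core ((((s₁.setReg 3 0).setArr e ((s₁.setReg 3 0).reg v)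
      ((s₁.setReg 3 0).reg 3)).setReg 3 1).setArr e
      ((((s₁.setReg 3 0).setArr e ((s₁.setReg 3 0).reg v)
      ((s₁.setReg 3 0).reg 3)).setReg 3 1).reg u)
      ((((s₁.setReg 3 0).setArr e ((s₁.setReg 3 0).reg v)
      ((s₁.setReg 3 0).reg 3)).setReg 3 1).reg 3)) := by
    refine ⟨(((ha₁.setReg (by omega)).setArr le_rfl).setReg (by omega)).setArr le_rfl, ?_, ?_⟩
    · intro i hi hm
      simp only [State.setReg, State.setArr, Function.update_self, Function.update_of_ne u3,
        Function.update_of_ne v3, ha₁.reg u hu (Or.inr hu'), ha₁.reg v hv (Or.inr hv')] at hm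
      by_cases hiu : i = s.reg u
      · rw [hiu]
      · rw [Function.update_of_ne hiu] at hm
        by_cases hiv : i = s.reg v
        · rw [hiv] at hm
          simp at hm
        · rw [Function.update_of_ne hiv] at hm
          exact absurd (hz i (hi.resolve_right hiv)) hm
    · simp [State.setReg, State.setArr, u3, ha₁.reg u hu (Or.inr hu')]
  generalize (((s₁.setReg 3 0).setArr e ((s₁.setReg 3 0).reg v)
      ((s₁.setReg 3 0).reg 3)).setReg 3 1).setArr e
      ((((s₁.setReg 3 0).setArr e ((s₁.setReg 3 0).reg v)
      ((s₁.setReg 3 0).reg 3)).setReg 3 1).reg u)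
      ((((s₁.setReg 3 0).setArr e ((s₁.setReg 3 0).reg v)
      ((s₁.setReg 3 0).reg 3)).setReg 3 1).reg 3) = s₂ at hcore ⊢
  let m : State → ℕ := fun t => ((Finset.range (s.reg 0)).filter (fun i => t.arr e i = 0)).card
  refine (hsearch s₂ hcore).seq fun s₃ ⟨hfull, _⟩ => ?_
  have hm : m s₃ ≤ s.reg 0 := (Finset.card_filter_le _ _).trans (by simp)
  refine ((Runs.while (x := 1) (T := 2 + p.eval (s.reg 0)) full m ?_ hfull).mono
    (T' := 1 + s.reg 0 * (2 + p.eval (s.reg 0) + 1)) ?_ (fun _ h => h)).seq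
    fun s₄ ⟨⟨⟨ha, hsound, hmark⟩, _, hcl⟩, h1⟩ => Runs.load ⟨ha.setReg (by omega), ?_⟩
  · rintro t ⟨⟨ha, hsound, hmark⟩, hyes, -⟩ h1
    obtain ⟨hmi, hmj, hij⟩ := hyes h1
    rw [show 2 + p.eval (s.reg 0) = 1 + (1 + p.eval (s.reg 0)) by ring]
    refine Runs.const_seq (Runs.store_seq ?_)
    have d3 : d + 1 ≠ 3 := by omega
    refine (hsearch _ ⟨(ha.setReg (by omega)).setArr le_rfl, ?_, ?_⟩).mono le_rfl
      fun t' ⟨hf, ht'⟩ => ⟨hf, ?_⟩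
    · intro i hi hm
      simp only [State.setReg, State.setArr, Function.update_self,
        Function.update_of_ne d3] at hm
      by_cases hij' : i = t.reg (d + 1)
      · rw [hij']
        exact (hsound _ (Or.inl hij.1) hmi).tail hij
      · rw [Function.update_of_ne hij'] at hm
        exact hsound i hi hm
    · simp only [State.setReg, State.setArr, Function.update_self,
        Function.update_of_ne d3]
      by_cases hij' : s.reg u = t.reg (d + 1)
      · rw [hij']; simp
      · rw [Function.update_of_ne hij']; exact hmark
    · simp only [m, ht']
      simp only [State.setReg, State.setArr, Function.update_self, Function.update_of_ne d3]
      refine card_filter_lt (j := t.reg (d + 1)) hij.2.1 (fun i _ hi => ?_) hmj (by simp)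
      by_cases hij' : i = t.reg (d + 1)
      · rw [hij']; exact hmj
      · rwa [Function.update_of_ne hij'] at hi
  · exact Nat.add_le_add_left (Nat.mul_le_mul_right _ hm) 1
  · simp only [State.setReg, Function.update_self, ha.reg v hv (Or.inr hv')]
    refine ⟨hsound _ (Or.inr rfl), fun hr => ?_⟩
    generalize s.reg v = w at hr
    induction hr with
    | refl => exact hmark
    | tail _ hij ih => exact hcl h1 _ _ ih hij

end RAM

/-! ### The reduction rules -/

namespace SimpleGraph

variable {V : Type*} {G : SimpleGraph V} {K S : Set V}

theorem tup_congr {k : ℕ} {c c' : ℕ → V} (h : ∀ i < k, c i = c' i) : tup k c = tup k c' := by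
  ext v
  exact exists_congr fun i => and_congr_right fun hi => by rw [h i hi]

/-- The vertices in `tup 8 i` may be deleted. -/
def DelRule (G : SimpleGraph V) (K S : Set V) (i : ℕ → V) (x y : V) : Prop :=
  (G.Block K (tup 8 i) x y ∧ (x = y ∨ G.Sep K S (tup 8 i) x y)) ∨
    (G.Twin K S (i 0) x y ∧ ∀ j < 8, i j = i 0)

/-- The vertex `i 0` may be made reflexive. -/
def RefRule (G : SimpleGraph V) (K S : Set V) (i : ℕ → V) (x y : V) : Prop :=
  (G.Block K (tup 8 i) x y ∧ ¬ G.Sep K S (tup 8 i) x y) ∧ i 0 ∈ S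

/-- One of the two rules applies in a connected graph without small cuts. -/
def Rule (G : SimpleGraph V) (K S : Set V) (i : ℕ → V) (x y : V) : Prop :=
  (¬ G.SmallCut K S ∧ G.Conn K) ∧ (G.DelRule K S i x y ∨ G.RefRule K S i x y)

/-- All ten vertices of an applicable rule are alive, so a search over numbers below `n` misses
none. -/
theorem Rule.mem {i : ℕ → V} {x y : V} (h : G.Rule K S i x y) :
    (∀ j < 8, i j ∈ K) ∧ x ∈ K ∧ y ∈ K := by
  have block : G.Block K (tup 8 i) x y → (∀ j < 8, i j ∈ K) ∧ x ∈ K ∧ y ∈ K := fun hb =>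
    ⟨fun j hj => hb.sub ⟨j, hj, rfl⟩, hb.hx, hb.hy⟩
  rcases h.2 with (h | h) | h
  · exact block h.1
  · exact ⟨fun j hj => by rw [h.2 j hj]; exact h.1.hv, h.1.hw, h.1.ht⟩
  · exact block h.1.1

theorem Rule.hasCut_del {i : ℕ → V} {x y : V} (h : G.Rule K S i x y) (hd : G.DelRule K S i x y) :
    G.HasCut (K \ tup 8 i) S ↔ G.HasCut K S := by
  obtain ⟨hsm, hc⟩ := h.1
  rcases hd with hd | hd
  · exact hasCut_diff_iff hc hsm hd.1 (finite_tup 8 i) (ncard_tup_le 8 i) hd.2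
  · have : tup 8 i = {i 0} := by
      ext v
      constructor
      · rintro ⟨j, hj, rfl⟩
        exact hd.2 j hj
      · rintro rfl
        exact ⟨0, by norm_num, rfl⟩
    rw [this]
    exact hd.1.hasCut_iff hc hsm

theorem Rule.hasCut_ref {i : ℕ → V} {x y : V} (h : G.Rule K S i x y)
    (hd : ¬ G.DelRule K S i x y) :
    (G.HasCut K (S \ {i 0}) ↔ G.HasCut K S) ∧ i 0 ∈ S := by
  obtain ⟨hsm, hc⟩ := h.1
  obtain ⟨⟨hb, hsep⟩, hS⟩ := h.2.resolve_left hd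
  exact ⟨hasCut_reflexive_iff hc hsm hb (finite_tup 8 i) (ncard_tup_le 8 i)
    ⟨0, by norm_num, rfl⟩ hsep, hS⟩

/-- If no rule applies, then a cut is found by inspecting small cuts and the set of all irreflexive
vertices. -/
theorem NoH2221C3.hasCut_iff_of_no_rule (hG : (G.restrict K).NoH2221C3) (hK : K.Finite)
    (hno : ∀ i x y, ¬ G.Rule K S i x y) :
    G.HasCut K S ↔ G.SmallCut K S ∨ (G.Conn K ∧ ∃ a ∈ K, ∃ b ∈ K, a ∉ S ∧ b ∉ S ∧
      ¬ Relation.ReflTransGen (G.Step K S) a b) := by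
  have hst : ¬ G.SmallCut K S → G.Conn K → ∀ u ∈ K, u ∈ S → ∀ v ∈ K, v ∈ S → ¬ G.Adj u v := by
    intro hsm hc
    refine hG.stable_of_no_block hK ?_ ?_ ?_
    · intro I x y z hI hI8 hb hz hzS
      obtain ⟨c, rfl, rfl⟩ := exists_tup hI hI8 hz
      -- A block with an irreflexive vertex always triggers a rule: deletion if the attachments are
      -- separated, a new loop otherwise.
      by_cases hsep : G.Sep K S (tup 8 c) x y
      · exact hno c x y ⟨⟨hsm, hc⟩, Or.inl (Or.inl ⟨hb, Or.inr hsep⟩)⟩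
      · exact hno c x y ⟨⟨hsm, hc⟩, Or.inr ⟨⟨hb, hsep⟩, hzS⟩⟩
    · intro I x z hI hI8 hb hz
      obtain ⟨c, rfl, rfl⟩ := exists_tup hI hI8 hz
      exact hno c x x ⟨⟨hsm, hc⟩, Or.inl (Or.inl ⟨hb, Or.inl rfl⟩)⟩
    · intro v w t hT
      exact hno (fun _ => v) w t ⟨⟨hsm, hc⟩, Or.inl (Or.inr ⟨hT, fun _ _ => rfl⟩)⟩
  by_cases hsm : G.SmallCut K S
  · simp [hsm, hsm.hasCut]
  rw [or_iff_right hsm]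
  constructor
  · intro h
    have hc : G.Conn K := by
      by_contra hc
      exact hsm (h.smallCut_of_not_conn hc)
    refine ⟨hc, h.exists_separated (hst hsm hc) fun u hu _ => ?_⟩
    obtain ⟨f, -, hs⟩ := h
    obtain ⟨p, hp, hfp⟩ := hs 0
    obtain ⟨q, hq, hfq⟩ := hs 1
    by_cases hup : u = p
    · refine hc.exists_adj hu hq ?_
      rintro rfl
      rw [hup, hfp] at hfq
      exact absurd hfq (by decide)
    · exact hc.exists_adj hu hp hup
  · rintro ⟨hc, a, ha, b, hb, haS, hbS, hab⟩
    -- `S` may contain deleted vertices, so the cut is `K ∩ S`. If that were empty, connectivity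
    -- would join `a` to `b`.
    refine hasCut_of_not_reachable (C := K ∩ S) ?_ Set.inter_subset_left (fun v hv => hv.2)
      (fun p hp q hq => hst hsm hc p hp.1 hp.2 q hq.1 hq.2)
      ha hb (fun h => haS h.2) (fun h => hbS h.2) (fun h => hab ?_)
    · by_contra hne
      rw [Set.not_nonempty_iff_eq_empty] at hne
      have hS : ∀ v ∈ K, v ∉ S := fun v hv hvS => by
        have : v ∈ K ∩ S := ⟨hv, hvS⟩
        rwa [hne] at this
      exact hab (Relation.ReflTransGen.mono (fun p q hpq =>
        ⟨hpq.1, hS p hpq.1.2.1, hS q hpq.1.2.2⟩) _ _ (hc a ha b hb))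
    · exact Relation.ReflTransGen.mono (fun p q hpq => ⟨hpq.1, fun hp => hpq.2.1
        ⟨hpq.1.2.1, hp⟩, fun hq => hpq.2.2 ⟨hpq.1.2.2, hq⟩⟩) _ _ h

end SimpleGraph

/-! ### Deciding the rules -/

namespace RAM

open Relation SimpleGraph

/-- The graph stored in the arrays `0` and `1`. -/
def State.graph (s : State) : SimpleGraph ℕ where
  Adj i j := i ≠ j ∧ s.arr 0 (s.arr 1 i + j) ≠ 0 ∧ s.arr 0 (s.arr 1 j + i) ≠ 0
  symm := ⟨fun _ _ h => ⟨h.1.symm, h.2.2, h.2.1⟩⟩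
  loopless := ⟨fun _ h => h.1 rfl⟩

/-- The vertices that are not deleted; array `2` marks the deleted ones. -/
def State.alive (s : State) : Set ℕ := {i | i < s.reg 0 ∧ ¬ s.arr 2 i ≠ 0}

/-- The irreflexive vertices; array `3` marks those that were made reflexive. -/
def State.irr (s : State) : Set ℕ := {i | ¬ s.arr 0 (s.arr 1 i + i) ≠ 0 ∧ ¬ s.arr 3 i ≠ 0}

section

variable {d e k x y : ℕ} {s : State}

theorem State.setRegs_reg_add {f : ℕ → ℕ} {i : ℕ} (hi : i < k) :
    (s.setRegs d k f).reg (d + i) = f i := by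
  simp only [State.setRegs]
  rw [if_pos (by omega), Nat.add_sub_cancel_left]

theorem State.setRegs_reg_lt {f : ℕ → ℕ} (hx : x < d) : (s.setRegs d k f).reg x = s.reg x :=
  if_neg (by omega)

theorem State.graph_setRegs (f : ℕ → ℕ) : (s.setRegs d k f).graph = s.graph := rfl

theorem State.irr_setRegs (f : ℕ → ℕ) : (s.setRegs d k f).irr = s.irr := rfl

theorem State.alive_setRegs (hd : 1 ≤ d) (f : ℕ → ℕ) : (s.setRegs d k f).alive = s.alive := by
  simp only [State.alive, State.setRegs_reg_lt (show 0 < d from hd)]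
  rfl

/-- Quantification over `k` vertices. -/
theorem Dec.exists_tuple {Q : State → (ℕ → ℕ) → Prop} (hd : 4 ≤ d)
    (hlt : ∀ s f, Q s f → ∀ i < k, f i < s.reg 0)
    (hcongr : ∀ s f f', (∀ i < k, f i = f' i) → Q s f → Q s f')
    (hset : ∀ s f g, Q (s.setRegs d k g) f ↔ Q s f)
    (h : Dec (d + k) e (fun s => Q s (fun i => s.reg (d + i)))) :
    Dec d e (fun s => ∃ f, Q s f) := by
  refine (Dec.exists_regs hd h).congr fun s => ⟨fun ⟨f, _, hQ⟩ => ⟨f, ?_⟩, fun ⟨f, hQ⟩ =>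
    ⟨f, hlt s f hQ, ?_⟩⟩
  · exact hcongr s _ f (fun i hi => State.setRegs_reg_add hi) ((hset s _ f).1 hQ)
  · exact hcongr _ _ _ (fun i hi => (State.setRegs_reg_add hi).symm) ((hset s f f).2 hQ)

/-- Quantification over one vertex. -/
theorem Dec.exists_vertex {Q : State → ℕ → Prop} (hd : 4 ≤ d)
    (hlt : ∀ s v, Q s v → v < s.reg 0) (hset : ∀ s v g, Q (s.setRegs d 1 g) v ↔ Q s v)
    (h : Dec (d + 1) e (fun s => Q s (s.reg d))) : Dec d e (fun s => ∃ v, Q s v) := by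
  refine (Dec.exists_tuple (k := 1) (Q := fun s f => Q s (f 0)) hd ?_ ?_ ?_ h).congr
    fun s => ⟨fun ⟨f, hf⟩ => ⟨f 0, hf⟩, fun ⟨v, hv⟩ => ⟨fun _ => v, hv⟩⟩
  · intro s f hQ i hi
    obtain rfl : i = 0 := by omega
    exact hlt s _ hQ
  · intro s f f' hf
    rw [hf 0 (by omega)]
    exact id
  · exact fun s f g => hset s _ g

/-- Reachability by a relation on vertices. -/
theorem Dec.reachable {R : State → ℕ → ℕ → Prop} (hd : 4 ≤ d) (hx : x < d) (hx' : 4 ≤ x)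
    (hy : y < d) (hy' : 4 ≤ y) (hlt : ∀ s i j, R s i j → i < s.reg 0 ∧ j < s.reg 0)
    (hset : ∀ s g, R (s.setRegs d 2 g) = R s)
    (h : ∀ e' ≥ e, Dec (d + 2) e' (fun s => R s (s.reg d) (s.reg (d + 1)))) :
    Dec d e (fun s => ReflTransGen (R s) (s.reg x) (s.reg y)) := by
  refine (Dec.reach hd hx hx' hy hy' h).congr fun s => ?_
  have : Rel d (fun s => R s (s.reg d) (s.reg (d + 1))) s = R s := by
    funext i j
    simp only [Rel, hset, eq_iff_iff]
    rw [State.setRegs_reg_add (show 1 < 2 by decide)]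
    have := State.setRegs_reg_add (s := s) (d := d) (f := fun k => if k = 0 then i else j)
      (show 0 < 2 by decide)
    rw [add_zero] at this
    rw [this]
    exact ⟨fun h => h.2.2, fun h => ⟨(hlt s i j h).1, (hlt s i j h).2, h⟩⟩
  rw [this]

theorem Dec.lt_size (hx : x < d) (hx' : 4 ≤ x) : Dec d e (fun s => s.reg x < s.reg 0) := by
  refine ⟨fun s s' h => ?_, .sub 1 0 x, 1, fun s => ?_⟩
  · simp only [h.reg x hx (Or.inr hx'), h.reg 0 (by omega) (by omega)]
  · simp only [Polynomial.eval_one]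
    refine Runs.sub ⟨(Agree.refl d e s).setReg (by omega), ?_⟩
    simp only [State.setReg, Function.update_self]
    omega

variable (he : 4 ≤ e) (hx : x < d) (hx' : 4 ≤ x) (hy : y < d) (hy' : 4 ≤ y)
include he hx hx'

theorem Dec.alive : Dec d e (fun s => s.reg x ∈ s.alive) :=
  (Dec.lt_size hx hx').and (by omega) (Dec.cell (by omega) hx hx').not

theorem Dec.irr : Dec d e (fun s => s.reg x ∈ s.irr) :=
  (Dec.entry he hx hx' hx hx').not.and (by omega) (Dec.cell (by omega) hx hx').not

include hy hy'

theorem Dec.adj : Dec d e (fun s => s.graph.Adj (s.reg x) (s.reg y)) :=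
  (Dec.eq hx hx' hy hy').not.and (by omega)
    ((Dec.entry he hx hx' hy hy').and (by omega) (Dec.entry he hy hy' hx hx'))

theorem Dec.restrict_adj : Dec d e (fun s => (s.graph.restrict s.alive).Adj (s.reg x) (s.reg y)) :=
  (Dec.adj he hx hx' hy hy').and (by omega)
    ((Dec.alive he hx hx').and (by omega) (Dec.alive he hy hy'))

end

/-! ### Programs for small cuts, connectivity, blocks, separation and twins -/

section

variable {d e k b x y : ℕ} {s : State}

theorem Dec.mem_tup (hd : 4 ≤ d) (hb : b + k ≤ d) (hb' : 4 ≤ b) (hx : x < d) (hx' : 4 ≤ x) :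
    Dec d e (fun s => s.reg x ∈ tup k (fun i => s.reg (b + i))) :=
  Dec.exists_lt (by omega) k fun i hi => Dec.eq hx hx' (by omega) (by omega)

theorem Dec.stable_tup (he : 4 ≤ e) (hd : 4 ≤ d) (hb : b + k ≤ d) (hb' : 4 ≤ b) :
    Dec d e (fun s => ∀ i < k, ∀ j < k, ¬ s.graph.Adj (s.reg (b + i)) (s.reg (b + j))) :=
  Dec.forall_lt (by omega) k fun i hi => Dec.forall_lt (by omega) k fun j hj =>
    (Dec.adj he (by omega) (by omega) (by omega) (by omega)).not

theorem tup_subset_iff {V : Type*} {k : ℕ} {c : ℕ → V} {K : Set V} :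
    tup k c ⊆ K ↔ ∀ i < k, c i ∈ K :=
  ⟨fun h i hi => h ⟨i, hi, rfl⟩, by rintro h _ ⟨i, hi, rfl⟩; exact h i hi⟩

/-- The avoided set may depend on the memory, but not on the two registers in which the closure loop
searches for its next edge. -/
theorem Dec.step {C : State → Set ℕ} (hd : 4 ≤ d) (he : 4 ≤ e) (hx : x < d) (hx' : 4 ≤ x)
    (hy : y < d) (hy' : 4 ≤ y) (hset : ∀ s g, C (s.setRegs d 2 g) = C s)
    (hC : ∀ e' ≥ e, ∀ z, z < d + 2 → 4 ≤ z → Dec (d + 2) e' (fun s => s.reg z ∈ C s)) :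
    Dec d e (fun s => ReflTransGen (s.graph.Step s.alive (C s)) (s.reg x) (s.reg y)) := by
  refine Dec.reachable hd hx hx' hy hy' (fun s i j h => ⟨h.1.2.1.1, h.1.2.2.1⟩) ?_ ?_
  · intro s g
    rw [hset, State.graph_setRegs, State.alive_setRegs (by omega)]
  · exact fun e' he' => (Dec.restrict_adj (by omega) (by omega) (by omega) (by omega)
      (by omega)).and (by omega) ((hC e' he' d (by omega) (by omega)).not.and (by omega)
      (hC e' he' (d + 1) (by omega) (by omega)).not)

theorem Dec.smallCut (hd : 4 ≤ d) (he : 4 ≤ e) :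
    Dec d e (fun s => s.graph.SmallCut s.alive s.irr) := by
  -- Ten registers list the cut, and two more hold the separated vertices.
  have key := Dec.exists_tuple (d := d) (e := e) (k := 12) (Q := fun s c => tup 10 c ⊆ s.alive ∧
    tup 10 c ⊆ s.irr ∧ c 10 ∈ s.alive ∧ c 11 ∈ s.alive ∧ c 10 ∉ tup 10 c ∧ c 11 ∉ tup 10 c ∧
    (∀ i < 10, ∀ j < 10, ¬ s.graph.Adj (c i) (c j)) ∧
    ¬ ReflTransGen (s.graph.Step s.alive (tup 10 c)) (c 10) (c 11)) hd ?_ ?_ ?_ ?_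
  · refine key.congr fun s => ⟨fun ⟨c, h⟩ => ⟨c, c 10, c 11, h⟩, fun ⟨c, a, b, h⟩ =>
      ⟨fun i => if i < 10 then c i else if i = 10 then a else b, ?_⟩⟩
    have hc : tup 10 (fun i => if i < 10 then c i else if i = 10 then a else b) = tup 10 c :=
      tup_congr fun i hi => if_pos hi
    rw [hc]
    obtain ⟨h1, h2, h3, h4, h5, h6, h7, h8⟩ := h
    refine ⟨h1, h2, h3, h4, h5, h6, fun i hi j hj => ?_, h8⟩
    simp only [hi, hj, if_true]
    exact h7 i hi j hj
  · rintro s f ⟨h1, -, h3, h4, -⟩ i hi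
    by_cases h : i < 10
    · exact (h1 ⟨i, h, rfl⟩).1
    · rcases (show i = 10 ∨ i = 11 by omega) with rfl | rfl
      exacts [h3.1, h4.1]
  · intro s f f' hf
    have hc : tup 10 f = tup 10 f' := tup_congr fun i hi => hf i (by omega)
    rw [hc, hf 10 (by omega), hf 11 (by omega)]
    rintro ⟨h1, h2, h3, h4, h5, h6, h7, h8⟩
    refine ⟨h1, h2, h3, h4, h5, h6, fun i hi j hj => ?_, h8⟩
    rw [← hf i (by omega), ← hf j (by omega)]
    exact h7 i hi j hj
  · intro s f g
    rw [State.graph_setRegs, State.alive_setRegs (by omega), State.irr_setRegs]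
  · have h1 : 1 ≤ d + 12 := by omega
    refine ((Dec.forall_lt h1 10 fun i hi => Dec.alive (x := d + i) he (by omega)
      (by omega)).congr fun s => tup_subset_iff.symm).and h1 (((Dec.forall_lt h1 10 fun i hi =>
      Dec.irr (x := d + i) he (by omega) (by omega)).congr fun s => tup_subset_iff.symm).and h1 ?_)
    refine (Dec.alive he (by omega) (by omega)).and h1 ((Dec.alive he (by omega) (by omega)).and h1
      ((Dec.mem_tup (by omega) (by omega) hd (by omega) (by omega)).not.and h1
      ((Dec.mem_tup (by omega) (by omega) hd (by omega) (by omega)).not.and h1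
      ((Dec.stable_tup he (by omega) (by omega) hd).and h1 (Dec.not ?_)))))
    refine Dec.step (by omega) he (by omega) (by omega) (by omega) (by omega) ?_ ?_
    · exact fun s g => tup_congr fun i hi => State.setRegs_reg_lt (by omega)
    · exact fun e' he' z hz hz' => Dec.mem_tup (by omega) (by omega) hd hz hz'

theorem Dec.conn (hd : 4 ≤ d) (he : 4 ≤ e) : Dec d e (fun s => s.graph.Conn s.alive) := by
  have key : Dec d e (fun s => ∃ c : ℕ → ℕ, c 0 ∈ s.alive ∧ c 1 ∈ s.alive ∧
      ¬ ReflTransGen (s.graph.Step s.alive ∅) (c 0) (c 1)) := by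
    refine Dec.exists_tuple (k := 2) hd ?_ ?_ ?_ ?_
    · rintro s f ⟨h1, h2, -⟩ i hi
      rcases (show i = 0 ∨ i = 1 by omega) with rfl | rfl
      exacts [h1.1, h2.1]
    · intro s f f' hf
      rw [hf 0 (by omega), hf 1 (by omega)]
      exact id
    · intro s f g
      rw [State.graph_setRegs, State.alive_setRegs (by omega)]
    · refine (Dec.alive he (by omega) (by omega)).and (by omega)
        ((Dec.alive he (by omega) (by omega)).and (by omega) (Dec.not ?_))
      refine Dec.step (by omega) he (by omega) (by omega) (by omega) (by omega)
        (fun _ _ => rfl) ?_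
      exact fun e' he' z hz hz' => Dec.true.not.congr fun s => by simp
  refine key.not.congr fun s => ⟨fun h a ha b hb => ?_, fun h ⟨c, h0, h1, hc⟩ =>
    hc (h _ h0 _ h1)⟩
  by_contra hab
  exact h ⟨fun i => if i = 0 then a else b, ha, hb, hab⟩

/-- Two reflexive vertices are separated by the irreflexive vertices. -/
theorem Dec.separated (hd : 4 ≤ d) (he : 4 ≤ e) : Dec d e (fun s => ∃ a ∈ s.alive, ∃ b ∈ s.alive,
    a ∉ s.irr ∧ b ∉ s.irr ∧ ¬ ReflTransGen (s.graph.Step s.alive s.irr) a b) := by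
  have key : Dec d e (fun s => ∃ c : ℕ → ℕ, c 0 ∈ s.alive ∧ c 1 ∈ s.alive ∧ c 0 ∉ s.irr ∧
      c 1 ∉ s.irr ∧ ¬ ReflTransGen (s.graph.Step s.alive s.irr) (c 0) (c 1)) := by
    refine Dec.exists_tuple (k := 2) hd ?_ ?_ ?_ ?_
    · rintro s f ⟨h1, h2, -⟩ i hi
      rcases (show i = 0 ∨ i = 1 by omega) with rfl | rfl
      exacts [h1.1, h2.1]
    · intro s f f' hf
      rw [hf 0 (by omega), hf 1 (by omega)]
      exact id
    · intro s f g
      rw [State.graph_setRegs, State.alive_setRegs (by omega), State.irr_setRegs]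
    · refine (Dec.alive he (by omega) (by omega)).and (by omega)
        ((Dec.alive he (by omega) (by omega)).and (by omega)
        ((Dec.irr he (by omega) (by omega)).not.and (by omega)
        ((Dec.irr he (by omega) (by omega)).not.and (by omega) (Dec.not ?_))))
      refine Dec.step (by omega) he (by omega) (by omega) (by omega) (by omega)
        (fun _ _ => rfl) ?_
      exact fun e' he' z hz hz' => Dec.irr (by omega) hz hz'
  refine key.congr fun s => ⟨fun ⟨c, h0, h1, h⟩ => ⟨_, h0, _, h1, h⟩, fun ⟨a, ha, b, hb, h⟩ =>
    ⟨fun i => if i = 0 then a else b, ha, hb, h⟩⟩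

/-- The vertices in the registers `4, …, 11`. -/
def State.piece (s : State) : ℕ → ℕ := fun i => s.reg (4 + i)

theorem State.piece_setRegs (hd : 14 ≤ d) (g : ℕ → ℕ) :
    tup 8 (s.setRegs d k g).piece = tup 8 s.piece :=
  tup_congr fun i hi => State.setRegs_reg_lt (by omega)

theorem Dec.block (hd : 14 ≤ d) (he : 4 ≤ e) :
    Dec d e (fun s => s.graph.Block s.alive (tup 8 s.piece) (s.reg 12) (s.reg 13)) := by
  have h1 : 1 ≤ d := by omega
  -- The closure condition is tested by searching for a neighbour that violates it.
  have hnbr : Dec d e (fun s => ∀ i < 8, ¬ ∃ w, w ∈ s.alive ∧ s.graph.Adj (s.piece i) w ∧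
      ¬ (w ∈ tup 8 s.piece ∨ w = s.reg 12 ∨ w = s.reg 13)) := by
    refine Dec.forall_lt h1 8 fun i hi => Dec.not (Dec.exists_vertex (by omega) ?_ ?_ ?_)
    · exact fun s v h => h.1.1
    · intro s v g
      rw [State.graph_setRegs, State.alive_setRegs (by omega), State.piece_setRegs hd,
        State.setRegs_reg_lt (by omega), State.setRegs_reg_lt (by omega)]
      simp only [State.piece, State.setRegs_reg_lt (show 4 + i < d by omega)]
    · exact (Dec.alive he (by omega) (by omega)).and (by omega)
        ((Dec.adj (x := 4 + i) he (by omega) (by omega) (by omega) (by omega)).and (by omega)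
        ((Dec.mem_tup (by omega) (by omega) (by omega) (by omega) (by omega)).or (by omega)
        ((Dec.eq (by omega) (by omega) (by omega) (by omega)).or (by omega)
        (Dec.eq (by omega) (by omega) (by omega) (by omega)))).not)
  refine (((Dec.forall_lt h1 8 fun i hi => Dec.alive (x := 4 + i) he (by omega) (by omega)).and h1
    ((Dec.alive (x := 12) he (by omega) (by omega)).and h1
    ((Dec.alive (x := 13) he (by omega) (by omega)).and h1
    ((Dec.mem_tup (b := 4) (k := 8) (x := 12) (by omega) (by omega) (by omega) (by omega)
      (by omega)).not.and h1
    ((Dec.mem_tup (b := 4) (k := 8) (x := 13) (by omega) (by omega) (by omega) (by omega)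
      (by omega)).not.and h1 hnbr)))))).congr fun s => ⟨?_, ?_⟩
  · rintro ⟨g1, g2, g3, g4, g5, g6⟩
    refine ⟨tup_subset_iff.2 g1, g2, g3, g4, g5, ?_⟩
    rintro _ ⟨i, hi, rfl⟩ w hw hiw
    by_contra hcon
    exact g6 i hi ⟨w, hw, hiw, hcon⟩
  · rintro ⟨g1, g2, g3, g4, g5, g6⟩
    exact ⟨tup_subset_iff.1 g1, g2, g3, g4, g5, fun i hi ⟨w, hw, hiw, hcon⟩ =>
      hcon (g6 _ ⟨i, hi, rfl⟩ w hw hiw)⟩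

/-- Containment of the piece in the living vertices is included so that the separating sequence
ranges over numbers below `n`. It costs nothing later, because a block satisfies it. -/
theorem Dec.sep (hd : 14 ≤ d) (he : 4 ≤ e) :
    Dec d e (fun s => tup 8 s.piece ⊆ s.alive ∧
      s.graph.Sep s.alive s.irr (tup 8 s.piece) (s.reg 12) (s.reg 13)) := by
  have key := Dec.exists_tuple (d := d) (e := e) (k := 8)
    (Q := fun s c => tup 8 s.piece ⊆ s.alive ∧ tup 8 c ⊆ tup 8 s.piece ∧
    tup 8 c ⊆ s.irr ∧ (∀ i < 8, ∀ j < 8, ¬ s.graph.Adj (c i) (c j)) ∧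
    ¬ ReflTransGen (s.graph.SepStep s.alive (tup 8 s.piece) (tup 8 c) (s.reg 13))
      (s.reg 12) (s.reg 13)) (by omega) ?_ ?_ ?_ ?_
  · exact key.congr fun s => ⟨fun ⟨c, h, h'⟩ => ⟨h, c, h'⟩, fun ⟨h, c, h'⟩ => ⟨c, h, h'⟩⟩
  · exact fun s f h i hi => (h.1 (h.2.1 ⟨i, hi, rfl⟩)).1
  · intro s f f' hf
    have hc : tup 8 f = tup 8 f' := tup_congr hf
    rw [hc]
    rintro ⟨g0, g1, g2, g3, g4⟩
    refine ⟨g0, g1, g2, fun i hi j hj => ?_, g4⟩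
    rw [← hf i hi, ← hf j hj]
    exact g3 i hi j hj
  · intro s f g
    rw [State.graph_setRegs, State.alive_setRegs (by omega), State.irr_setRegs,
      State.piece_setRegs hd, State.setRegs_reg_lt (by omega), State.setRegs_reg_lt (by omega)]
  · have h1 : 1 ≤ d + 8 := by omega
    refine ((Dec.forall_lt h1 8 fun i hi => Dec.alive (x := 4 + i) he (by omega)
      (by omega)).congr fun s => tup_subset_iff.symm).and h1 ?_
    refine ((Dec.forall_lt h1 8 fun i hi => Dec.mem_tup (x := d + i) (b := 4) (k := 8) (by omega)
      (by omega) (by omega) (by omega) (by omega)).congr fun s => tup_subset_iff.symm).and h1 ?_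
    refine ((Dec.forall_lt h1 8 fun i hi => Dec.irr (x := d + i) he (by omega)
      (by omega)).congr fun s => tup_subset_iff.symm).and h1 ?_
    refine (Dec.stable_tup he (by omega) (by omega) (by omega)).and h1 (Dec.not ?_)
    refine Dec.reachable (by omega) (by omega) (by omega) (by omega) (by omega)
      (fun s i j h => ⟨h.1.2.1.1, h.1.2.2.1⟩) ?_ ?_
    · intro s g
      rw [State.graph_setRegs, State.alive_setRegs (by omega), State.piece_setRegs (by omega),
        State.setRegs_reg_lt (by omega)]
      congr 1
      exact tup_congr fun i hi => State.setRegs_reg_lt (by omega)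
    · intro e' he'
      exact (Dec.restrict_adj (by omega) (by omega) (by omega) (by omega)
        (by omega)).and (by omega) (((Dec.mem_tup (by omega) (by omega) (by omega) (by omega)
        (by omega)).or (by omega) (Dec.eq (by omega) (by omega) (by omega) (by omega))).and
        (by omega) (Dec.mem_tup (by omega) (by omega) (by omega) (by omega) (by omega)).not)

theorem Dec.twin (hd : 14 ≤ d) (he : 4 ≤ e) :
    Dec d e (fun s => s.graph.Twin s.alive s.irr (s.piece 0) (s.reg 12) (s.reg 13)) := by
  have h1 : 1 ≤ d := by omega
  have hnbr : Dec d e (fun s => ¬ ∃ w, w ∈ s.alive ∧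
      ((s.graph.Adj (s.reg 4) w ∧ ¬ s.graph.Adj (s.reg 12) w) ∨
      (¬ s.graph.Adj (s.reg 4) w ∧ s.graph.Adj (s.reg 12) w))) := by
    refine Dec.not (Dec.exists_vertex (by omega) (fun s v h => h.1.1) ?_ ?_)
    · intro s v g
      rw [State.graph_setRegs, State.alive_setRegs (by omega),
        State.setRegs_reg_lt (by omega), State.setRegs_reg_lt (by omega)]
    · have ha := Dec.adj (d := d + 1) (e := e) (x := 4) (y := d) he (by omega) (by omega)
        (by omega) (by omega)
      have hb := Dec.adj (d := d + 1) (e := e) (x := 12) (y := d) he (by omega) (by omega)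
        (by omega) (by omega)
      exact (Dec.alive he (by omega) (by omega)).and (by omega)
        ((ha.and (by omega) hb.not).or (by omega) (ha.not.and (by omega) hb))
  refine ((Dec.eq (x := 4) (y := 12) (by omega) (by omega) (by omega) (by omega)).not.and h1
    ((Dec.alive (x := 4) he (by omega) (by omega)).and h1
    ((Dec.alive (x := 12) he (by omega) (by omega)).and h1 (hnbr.and h1
    (((Dec.irr (x := 4) he (by omega) (by omega)).or h1
      (Dec.irr (x := 12) he (by omega) (by omega)).not).and h1
    ((Dec.alive (x := 13) he (by omega) (by omega)).and h1
    ((Dec.eq (x := 13) (y := 4) (by omega) (by omega) (by omega) (by omega)).not.and h1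
    ((Dec.eq (x := 13) (y := 12) (by omega) (by omega) (by omega) (by omega)).not.and h1
    (Dec.adj (x := 4) (y := 13) he (by omega) (by omega) (by omega)
      (by omega)).not)))))))).congr fun s => ⟨?_, ?_⟩
  · rintro ⟨g1, g2, g3, g4, g5, g6, g7, g8, g9⟩
    refine ⟨g1, g2, g3, fun p hp => ?_, g5, g6, g7, g8, g9⟩
    by_contra hcon
    exact g4 ⟨p, hp, by simp only [State.piece] at hcon; tauto⟩
  · rintro ⟨g1, g2, g3, g4, g5, g6, g7, g8, g9⟩
    refine ⟨g1, g2, g3, fun ⟨w, hw, h⟩ => ?_, g5, g6, g7, g8, g9⟩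
    have := g4 w hw
    simp only [State.piece] at this
    tauto

/-- The rule for deletion applies to the vertices in the registers. -/
def State.Del (s : State) : Prop :=
  s.graph.DelRule s.alive s.irr s.piece (s.reg 12) (s.reg 13)

/-- A rule applies to the vertices in the registers. -/
def State.Rule (s : State) : Prop :=
  s.graph.Rule s.alive s.irr s.piece (s.reg 12) (s.reg 13)

theorem Dec.del (hd : 14 ≤ d) (he : 4 ≤ e) : Dec d e State.Del := by
  have h1 : 1 ≤ d := by omega
  refine (((Dec.block hd he).and h1 ((Dec.eq (x := 12) (y := 13) (by omega) (by omega) (by omega)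
    (by omega)).or h1 (Dec.sep hd he))).or h1 ((Dec.twin hd he).and h1 (Dec.forall_lt h1 8
    fun j hj => Dec.eq (x := 4 + j) (y := 4 + 0) (by omega) (by omega) (by omega)
    (by omega)))).congr fun s => ?_
  refine or_congr (and_congr_right fun hb => or_congr_right ?_) Iff.rfl
  exact and_iff_right hb.sub

theorem Dec.rule (hd : 14 ≤ d) (he : 4 ≤ e) : Dec d e State.Rule := by
  have h1 : 1 ≤ d := by omega
  refine (((Dec.smallCut (by omega) he).not.and h1 (Dec.conn (by omega) he)).and h1
    ((Dec.del hd he).or h1 (((Dec.block hd he).and h1 (Dec.sep hd he).not).and h1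
    (Dec.irr (x := 4) he (by omega) (by omega))))).congr fun s => ?_
  refine and_congr_right fun _ => or_congr_right (and_congr_left fun _ =>
    and_congr_right fun hb => not_congr (and_iff_right hb.sub))

end

end RAM

/-! ### The algorithm -/

namespace RAM

open Relation SimpleGraph

/-- Mark the vertices in the registers `4, …, 3 + k` as deleted. -/
def markAll : ℕ → Cmd
  | 0 => .const 3 1
  | k + 1 => .seq (markAll k) (.store 2 (4 + k) 3)

theorem runs_markAll (s : State) : ∀ k, Runs (markAll k) s (k + 1) (fun s' => s'.reg 3 = 1 ∧
    (∀ x ≠ 3, s'.reg x = s.reg x) ∧ (∀ a ≠ 2, s'.arr a = s.arr a) ∧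
    ∀ i, s'.arr 2 i = 0 ↔ s.arr 2 i = 0 ∧ i ∉ tup k s.piece)
  | 0 => by
    refine Runs.const ⟨by simp [State.setReg], fun x hx => by simp [State.setReg, hx],
      fun _ _ => rfl, fun i => ?_⟩
    simp [tup, State.setReg]
  | k + 1 => by
    refine (runs_markAll s k).seq fun s' ⟨h3, hr, ha, h2⟩ => Runs.store ⟨h3, hr, ?_, fun i => ?_⟩
    · intro a ha'
      simp only [State.setArr, Function.update_of_ne ha']
      exact ha a ha'
    · have htup : i ∉ tup (k + 1) s.piece ↔ i ∉ tup k s.piece ∧ i ≠ s.reg (4 + k) := by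
        constructor
        · exact fun h => ⟨fun ⟨j, hj, hi⟩ => h ⟨j, by omega, hi⟩, fun hi => h ⟨k, by omega, hi⟩⟩
        · rintro ⟨h, h'⟩ ⟨j, hj, hi⟩
          rcases Nat.lt_succ_iff_lt_or_eq.1 hj with hj | rfl
          exacts [h ⟨j, hj, hi⟩, h' hi]
      rw [htup, ← and_assoc, ← h2 i, ← hr (4 + k) (by omega)]
      simp only [State.setArr, Function.update_self, h3]
      by_cases hi : i = s'.reg (4 + k)
      · simp [hi]
      · simp [hi]

/-- Compute the row positions of the adjacency matrix. -/
def rows : Cmd :=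
  .seq (.const 4 0) (.seq (.const 5 0) (.seq (.sub 2 0 4) (.while 2 (.seq (.store 1 4 5)
    (.seq (.add 5 5 0) (.seq (.const 3 1) (.seq (.add 4 4 3) (.sub 2 0 4))))))))

theorem runs_rows (s : State) : Runs rows s (4 + s.reg 0 * 6) (fun s' => s'.reg 0 = s.reg 0 ∧
    (∀ a ≠ 1, s'.arr a = s.arr a) ∧ ∀ i < s.reg 0, s'.arr 1 i = i * s.reg 0) := by
  rw [show 4 + s.reg 0 * 6 = 1 + (1 + (1 + (1 + s.reg 0 * (5 + 1)))) by ring]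
  refine Runs.const_seq (Runs.const_seq (Runs.sub_seq ?_))
  -- The machine cannot multiply: register `5` accumulates `i * n` by repeated addition while
  -- register `4` counts `i`.
  have := Runs.while (x := 2) (c := .seq (.store 1 4 5)
    (.seq (.add 5 5 0) (.seq (.const 3 1) (.seq (.add 4 4 3) (.sub 2 0 4)))))
    (s := ((s.setReg 4 0).setReg 5 0).setReg 2 (((s.setReg 4 0).setReg 5 0).reg 0 -
      ((s.setReg 4 0).setReg 5 0).reg 4)) (T := 5)
    (fun s' => s'.reg 0 = s.reg 0 ∧ (∀ a ≠ 1, s'.arr a = s.arr a) ∧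
      s'.reg 2 = s.reg 0 - s'.reg 4 ∧ s'.reg 5 = s'.reg 4 * s.reg 0 ∧
      ∀ i < s'.reg 4, s'.arr 1 i = i * s.reg 0)
    (fun s' => s'.reg 2) ?_ ?_
  · have h2 : (((s.setReg 4 0).setReg 5 0).setReg 2 (((s.setReg 4 0).setReg 5 0).reg 0 -
        ((s.setReg 4 0).setReg 5 0).reg 4)).reg 2 = s.reg 0 := by simp [State.setReg]
    rw [h2] at this
    exact this.mono le_rfl fun s' ⟨⟨h0, ha, h2, h5, h⟩, hz⟩ => ⟨h0, ha, fun i hi =>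
      h i (by omega)⟩
  · rintro s' ⟨h0, ha, h2, h5, h⟩ hne
    refine Runs.store_seq (T := 4) (Runs.add_seq (T := 3) (Runs.const_seq (T := 2)
      (Runs.add_seq (T := 1) (Runs.sub ⟨⟨?_, ?_, ?_, ?_, ?_⟩, ?_⟩))))
    · simp [State.setReg, State.setArr, h0]
    · intro a ha'
      simp [State.setReg, State.setArr, ha', ha a ha']
    · simp [State.setReg, State.setArr, h0]
    · simp [State.setReg, State.setArr, h0, h5, add_mul]
    · intro i hi
      simp [State.setReg, State.setArr] at hi ⊢
      by_cases hi4 : i = s'.reg 4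
      · simp [hi4, h5]
      · simp only [Function.update_of_ne hi4]
        exact h i (by omega)
    · simp [State.setReg, State.setArr, h0]
      omega
  · simp [State.setReg]

theorem State.graph_congr {s t : State} (h0 : t.arr 0 = s.arr 0) (h1 : t.arr 1 = s.arr 1) :
    t.graph = s.graph := by
  ext i j
  simp only [State.graph, h0, h1]

theorem State.irr_congr {s t : State} (h0 : t.arr 0 = s.arr 0) (h1 : t.arr 1 = s.arr 1)
    (h3 : t.arr 3 = s.arr 3) : t.irr = s.irr := by
  simp only [State.irr, h0, h1, h3]

theorem State.alive_congr {s t : State} (h0 : t.reg 0 = s.reg 0) (h2 : t.arr 2 = s.arr 2) :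
    t.alive = s.alive := by
  simp only [State.alive, h0, h2]

/-- The size of the instance: the number of unmarked cells. -/
def State.size (t : State) : ℕ :=
  ((Finset.range (t.reg 0)).filter (fun i => t.arr 2 i = 0)).card +
    ((Finset.range (t.reg 0)).filter (fun i => t.arr 3 i = 0)).card

/-- `t` is a reduced version of `s`. -/
structure State.Reduces (s t : State) : Prop where
  reg : t.reg 0 = s.reg 0
  arr0 : t.arr 0 = s.arr 0
  arr1 : t.arr 1 = s.arr 1
  alive : t.alive ⊆ s.alive
  cut : s.graph.HasCut t.alive t.irr ↔ s.graph.HasCut s.alive s.irr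

theorem State.Reduces.graph {s t : State} (h : s.Reduces t) : t.graph = s.graph :=
  State.graph_congr h.arr0 h.arr1

theorem State.Reduces.agree {s t t' : State} {d : ℕ} (h : s.Reduces t) (ha : Agree d 4 t t')
    (hd : 1 ≤ d) : s.Reduces t' ∧ t'.alive = t.alive ∧ t'.irr = t.irr ∧ t'.size = t.size := by
  have h0 := ha.reg 0 (by omega) (by omega)
  have e1 := State.alive_congr h0 (ha.arr 2 (by omega))
  have e2 := State.irr_congr (ha.arr 0 (by omega)) (ha.arr 1 (by omega)) (ha.arr 3 (by omega))
  refine ⟨⟨h0.trans h.reg, (ha.arr 0 (by omega)).trans h.arr0,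
    (ha.arr 1 (by omega)).trans h.arr1, ?_, ?_⟩, e1, e2, ?_⟩
  · rw [e1]; exact h.alive
  · rw [e1, e2]; exact h.cut
  · simp only [State.size, h0, ha.arr 2 (show 2 < 4 by omega), ha.arr 3 (show 3 < 4 by omega)]

/-- Apply the rule that was found. -/
def applyRule : Cmd := .ite 1 (markAll 8) (.seq (.const 3 1) (.store 3 4 3))

/-- Entry `0` of the piece is alive before a deletion and irreflexive before a new loop, so `size`
drops in both branches. Deletion has priority, and the other branch relies on the failure of the
deletion rule. -/
theorem runs_applyRule {s t : State} (h : s.Reduces t) (hr : t.Rule) (h1 : t.reg 1 ≠ 0 ↔ t.Del) :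
    Runs applyRule t 10 (fun t' => s.Reduces t' ∧ t'.size < t.size) := by
  have hmem := hr.mem
  refine Runs.ite (T := 9) (fun hd => ?_) (fun hd => ?_)
  · refine (runs_markAll t 8).mono le_rfl fun t' ⟨_, hreg, harr, h2⟩ => ?_
    have halive : t'.alive = t.alive \ tup 8 t.piece := by
      ext i
      simp only [State.alive, Set.mem_ofPred_eq, Set.mem_sdiff, hreg 0 (by omega), ne_eq, not_not,
        h2 i, and_assoc]
    have hirr : t'.irr = t.irr :=
      State.irr_congr (harr 0 (by omega)) (harr 1 (by omega)) (harr 3 (by omega))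
    refine ⟨⟨(hreg 0 (by omega)).trans h.reg, (harr 0 (by omega)).trans h.arr0,
      (harr 1 (by omega)).trans h.arr1, ?_, ?_⟩, ?_⟩
    · rw [halive]
      exact Set.sdiff_subset.trans h.alive
    · rw [halive, hirr, ← h.cut, ← h.graph]
      exact Rule.hasCut_del hr (h1.1 hd)
    · simp only [State.size, hreg 0 (by omega), harr 3 (by omega)]
      refine Nat.add_lt_add_right ?_ _
      have hj := hmem.1 0 (by omega)
      refine card_filter_lt hj.1 (fun i _ hi => ((h2 i).1 hi).1) (not_not.1 hj.2) fun hi => ?_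
      exact ((h2 _).1 hi).2 ⟨0, by omega, rfl⟩
  · refine (Runs.const_seq (T := 1) (Runs.store ?_)).mono (T := 2) (by omega) (fun _ h => h)
    obtain ⟨hcut, hS⟩ := Rule.hasCut_ref hr (fun hD => h1.2 hD hd)
    have harr : ((t.setReg 3 1).setArr 3 ((t.setReg 3 1).reg 4) ((t.setReg 3 1).reg 3)).arr 3 =
        Function.update (t.arr 3) (t.reg 4) 1 := by
      simp [State.setReg, State.setArr]
    have hreg : ((t.setReg 3 1).setArr 3 ((t.setReg 3 1).reg 4) ((t.setReg 3 1).reg 3)).reg 0 =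
        t.reg 0 := rfl
    have harr' : ∀ a ≠ 3, ((t.setReg 3 1).setArr 3 ((t.setReg 3 1).reg 4)
        ((t.setReg 3 1).reg 3)).arr a = t.arr a := fun a ha => Function.update_of_ne ha ..
    generalize (t.setReg 3 1).setArr 3 ((t.setReg 3 1).reg 4) ((t.setReg 3 1).reg 3) = t'
      at harr hreg harr'
    have halive : t'.alive = t.alive := State.alive_congr hreg (harr' 2 (by omega))
    have hp : t.piece 0 = t.reg 4 := rfl
    have hirr : t'.irr = t.irr \ {t.piece 0} := by
      ext i
      simp only [State.irr, Set.mem_ofPred_eq, Set.mem_sdiff, Set.mem_singleton_iff, harr,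
        harr' 0 (by omega), harr' 1 (by omega), hp]
      by_cases hi : i = t.reg 4
      · simp [hi]
      · simp [hi]
    refine ⟨⟨hreg.trans h.reg, (harr' 0 (by omega)).trans h.arr0,
      (harr' 1 (by omega)).trans h.arr1, ?_, ?_⟩, ?_⟩
    · rw [halive]; exact h.alive
    · rw [halive, hirr, ← h.cut, ← h.graph]
      exact hcut
    · simp only [State.size, hreg, harr' 2 (by omega)]
      refine Nat.add_lt_add_left ?_ _
      refine card_filter_lt (j := t.reg 4) (hmem.1 0 (by omega)).1 (fun i _ hi => ?_)
        (not_not.1 hS.2) (by rw [harr]; simp)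
      rw [harr] at hi
      by_cases hi4 : i = t.reg 4
      · rw [hi4]; exact not_not.1 hS.2
      · rwa [Function.update_of_ne hi4] at hi

/-- The answer for an instance to which no rule applies. -/
def State.Answer (s : State) : Prop :=
  s.graph.SmallCut s.alive s.irr ∨ (s.graph.Conn s.alive ∧ ∃ a ∈ s.alive, ∃ b ∈ s.alive,
    a ∉ s.irr ∧ b ∉ s.irr ∧ ¬ ReflTransGen (s.graph.Step s.alive s.irr) a b)

/-- The main loop applies rules until a search finds none, and then evaluates `State.Answer`. The
measure `size` starts at no more than `2 n`. Deleting vertices creates no forbidden subgraph, so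
`hasCut_iff_of_no_rule` applies to the final graph. -/
theorem exists_runs_hasCut : ∃ (c : Cmd) (p : Polynomial ℕ), ∀ s : State,
    (s.graph.restrict s.alive).NoH2221C3 → Runs c s (p.eval (s.reg 0)) (fun s' =>
      (s.graph.HasCut s.alive s.irr → s'.reg 0 = 1) ∧
      (¬ s.graph.HasCut s.alive s.irr → s'.reg 0 = 0)) := by
  obtain ⟨c, p, hc⟩ := exists_isSearch (k := 10) (le_refl 4)
    (Dec.rule (d := 14) (e := 4) le_rfl le_rfl)
  obtain ⟨-, cd, pd, hcd⟩ := Dec.del (d := 14) (e := 4) le_rfl le_rfl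
  obtain ⟨-, ca, pa, hca⟩ : Dec 4 4 State.Answer := (Dec.smallCut le_rfl le_rfl).or (by omega)
    ((Dec.conn le_rfl le_rfl).and (by omega) (Dec.separated le_rfl le_rfl))
  refine ⟨.seq c (.seq (.while 1 (.seq cd (.seq applyRule c))) (.seq ca
    (.ite 1 (.const 0 1) (.const 0 0)))),
    p + ((1 + (Polynomial.X + Polynomial.X) * (pd + (10 + p) + 1)) + (pa + 2)), fun s hG => ?_⟩
  simp only [Polynomial.eval_add, Polynomial.eval_ofNat, Polynomial.eval_mul, Polynomial.eval_X,
    Polynomial.eval_one]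
  let full : State → Prop := fun t => s.Reduces t ∧ (t.reg 1 ≠ 0 → t.Rule) ∧
    (t.reg 1 = 0 → ∀ i x y, ¬ s.graph.Rule t.alive t.irr i x y)
  have hsearch : ∀ t, s.Reduces t → Runs c t (p.eval (s.reg 0))
      (fun t' => full t' ∧ t'.size = t.size) := by
    intro t ht
    have := hc t
    rw [ht.reg] at this
    refine this.mono le_rfl fun t' ⟨ha, hyes, hno⟩ => ?_
    obtain ⟨hred, halive, hirr, hsize⟩ := ht.agree ha (by omega)
    refine ⟨⟨hred, fun h1 => (hyes h1).1, fun h1 i x y hr => ?_⟩, hsize⟩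
    obtain ⟨hm, hmx, hmy⟩ := hr.mem
    rw [halive] at hm hmx hmy
    have hn : ∀ v ∈ t.alive, v < s.reg 0 := fun v hv => by
      rw [← ht.reg]
      exact hv.1
    -- The values to be found in registers `4` to `13`: the piece and the two attachments.
    let f : ℕ → ℕ := fun j => if j < 8 then i j else if j = 8 then x else y
    have hf : ∀ j < 8, f j = i j := fun j hj => if_pos hj
    refine hno h1 f (fun j hj => ?_) ?_
    · simp only [f]
      split_ifs with h8 h9
      exacts [hn _ (hm j h8), hn _ hmx, hn _ hmy]
    · have h4 : ∀ j < 8, (t.setRegs 4 10 f).piece j = i j := fun j hj =>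
        (State.setRegs_reg_add (show j < 10 by omega)).trans (hf j hj)
      have hx : (t.setRegs 4 10 f).reg 12 = x := rfl
      have hy : (t.setRegs 4 10 f).reg 13 = y := rfl
      rw [halive, hirr, ← ht.graph] at hr
      simp only [State.Rule, SimpleGraph.Rule, DelRule, RefRule, hx, hy, tup_congr h4,
        State.graph_setRegs, State.irr_setRegs, State.alive_setRegs (show 1 ≤ 4 by omega)]
      rw [h4 0 (by omega)]
      refine ⟨hr.1, hr.2.imp (Or.imp id (And.imp id fun h j hj => ?_)) id⟩
      rw [h4 j hj]
      exact h j hj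
  refine (hsearch s ⟨rfl, rfl, rfl, le_rfl, Iff.rfl⟩).seq fun s₁ ⟨hfull, _⟩ => ?_
  have hsize : s₁.size ≤ s.reg 0 + s.reg 0 := by
    rw [← hfull.1.reg]
    exact add_le_add ((Finset.card_filter_le _ _).trans (by simp))
      ((Finset.card_filter_le _ _).trans (by simp))
  refine ((Runs.while (x := 1) (T := pd.eval (s.reg 0) + (10 + p.eval (s.reg 0))) full State.size
    ?_ hfull).mono (Nat.add_le_add_left (Nat.mul_le_mul_right _ hsize) 1)
    (fun _ h => h)).seq fun s₂ ⟨⟨hred, _, hno⟩, h1⟩ => ?_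
  · rintro t ⟨ht, hyes, -⟩ h1
    have := hcd t
    rw [ht.reg] at this
    refine this.seq fun t' ⟨ha, hdel⟩ => ?_
    obtain ⟨hred, halive, hirr, hsize⟩ := ht.agree ha (by omega)
    have hgraph : t'.graph = t.graph := hred.graph.trans ht.graph.symm
    -- Deciding which rule applies preserves registers `4` to `13`, so the vertices found by the
    -- search are still in place.
    have hrule : t'.Rule := ((Dec.rule (d := 14) (e := 4) le_rfl le_rfl).1 t t' ha).2 (hyes h1)
    have hdel' : t'.reg 1 ≠ 0 ↔ t'.Del :=
      hdel.trans ((Dec.del (d := 14) (e := 4) le_rfl le_rfl).1 t t' ha).symm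
    refine (runs_applyRule hred hrule hdel').seq fun t'' ⟨hred', hlt⟩ =>
      (hsearch t'' hred').mono le_rfl fun t₃ ⟨hf, hs⟩ => ⟨hf, ?_⟩
    rw [hs, ← hsize]
    exact hlt
  · have := hca s₂
    rw [hred.reg] at this
    refine this.seq fun s₃ ⟨ha, hans⟩ => ?_
    have hans' : s₂.Answer ↔ s.graph.HasCut s.alive s.irr := by
      rw [← hred.cut]
      have hfin : s₂.alive.Finite := (Set.finite_Iio (s₂.reg 0)).subset fun v hv => hv.1
      rw [(hG.restrict_mono hred.alive).hasCut_iff_of_no_rule hfin (hno h1), ← hred.graph]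
      rfl
    rw [hans'] at hans
    refine Runs.ite (T := 1) (fun h => Runs.const ?_) (fun h => Runs.const ?_)
    · exact ⟨fun _ => by simp [State.setReg], fun hno => absurd (hans.1 h) hno⟩
    · exact ⟨fun hyes => absurd h (hans.2 hyes), fun _ => by simp [State.setReg]⟩

/-- A memory that holds the graph `G` together with its row positions. -/
structure Holds {n : ℕ} (G : PRGraph (Fin n)) (s : State) : Prop where
  size : s.reg 0 = n
  edge : ∀ i j : Fin n, s.arr 0 (s.arr 1 i + j) ≠ 0 ↔ G.Edge i j
  dead : ∀ i, s.arr 2 i = 0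
  refl : ∀ i, s.arr 3 i = 0

theorem Holds.adj_iff {n : ℕ} {G : PRGraph (Fin n)} {s : State} (h : Holds G s) (i j : Fin n) :
    s.graph.Adj i j ↔ G.graph.Adj i j := by
  simp only [State.graph, h.edge, PRGraph.Edge, ne_eq, Fin.val_inj]
  constructor
  · rintro ⟨h1, h2 | h2, -⟩
    exacts [h2, absurd h2.1 h1]
  · exact fun h => ⟨h.ne, Or.inl h, Or.inl h.symm⟩

theorem Holds.mem_alive {n : ℕ} {G : PRGraph (Fin n)} {s : State} (h : Holds G s) (i : ℕ) :
    i ∈ s.alive ↔ i < n := by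
  simp [State.alive, h.size, h.dead]

theorem Holds.mem_irr {n : ℕ} {G : PRGraph (Fin n)} {s : State} (h : Holds G s) (i : Fin n) :
    (i : ℕ) ∈ s.irr ↔ i ∈ G.irreflexive := by
  simp only [State.irr, Set.mem_ofPred_eq, h.edge, h.refl, PRGraph.Edge, PRGraph.irreflexive,
    Set.mem_compl_iff]
  simp

theorem Holds.noH2221C3 {n : ℕ} {G : PRGraph (Fin n)} {s : State} (h : Holds G s)
    (hG : G.graph.NoH2221C3) : (s.graph.restrict s.alive).NoH2221C3 := by
  have key : ∀ {p q} (hp : p < n) (hq : q < n), (s.graph.restrict s.alive).Adj p q →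
      G.graph.Adj ⟨p, hp⟩ ⟨q, hq⟩ := fun hp hq hpq => (h.adj_iff ⟨_, hp⟩ ⟨_, hq⟩).1 hpq.1
  have lt : ∀ {p q}, (s.graph.restrict s.alive).Adj p q → p < n ∧ q < n := fun hpq =>
    ⟨(h.mem_alive _).1 hpq.2.1, (h.mem_alive _).1 hpq.2.2⟩
  constructor
  · intro a b c hab hbc hac
    exact hG.triangle _ _ _ (key (lt hab).1 (lt hab).2 hab) (key _ (lt hbc).2 hbc) (key _ _ hac)
  · rintro x ⟨h0, h01, h02, h23, h04, h45, h16, h67, h18⟩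
    have hx : ∀ i, x i < n := by
      intro i
      fin_cases i
      exacts [(lt h01).1, (lt h01).2, (lt h02).2, (lt h23).2, (lt h04).2, (lt h45).2, (lt h16).2,
        (lt h67).2, (lt h18).2]
    exact hG.copy (fun i => ⟨x i, hx i⟩) ⟨fun i j hij => h0 (Fin.mk.inj_iff.1 hij),
      key _ _ h01, key _ _ h02, key _ _ h23, key _ _ h04, key _ _ h45, key _ _ h16, key _ _ h67,
      key _ _ h18⟩

theorem Holds.hasCut_iff {n : ℕ} {G : PRGraph (Fin n)} {s : State} (h : Holds G s) :
    s.graph.HasCut s.alive s.irr ↔ G.HasStableCut := by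
  rw [PRGraph.hasStableCut_iff_hasCut]
  constructor
  · rintro ⟨f, hf, hs⟩
    have adj : ∀ i j : Fin n, (G.graph.restrict Set.univ).Adj i j →
        (s.graph.restrict s.alive).Adj i j := fun i j hij =>
      ⟨(h.adj_iff i j).2 hij.1, (h.mem_alive _).2 i.2, (h.mem_alive _).2 j.2⟩
    refine ⟨fun i => f i, ⟨fun i j hij => hf.far i j (adj i j hij),
      fun i j hij => hf.mid i j (adj i j hij),
      fun i _ hi => (h.mem_irr i).1 (hf.loop i ((h.mem_alive _).2 i.2) hi)⟩, fun c => ?_⟩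
    obtain ⟨v, hv, hvc⟩ := hs c
    exact ⟨⟨v, (h.mem_alive v).1 hv⟩, trivial, hvc⟩
  · rintro ⟨f, hf, hs⟩
    -- The default colour is harmless, since numbers from `n` on are not alive.
    let g : ℕ → Fin 3 := fun i => if hi : i < n then f ⟨i, hi⟩ else 0
    have hg : ∀ i (hi : i < n), g i = f ⟨i, hi⟩ := fun i hi => dif_pos hi
    have adj : ∀ i j, (s.graph.restrict s.alive).Adj i j → ∃ (hi : i < n) (hj : j < n),
        (G.graph.restrict Set.univ).Adj ⟨i, hi⟩ ⟨j, hj⟩ := by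
      intro i j hij
      have hi := (h.mem_alive _).1 hij.2.1
      have hj := (h.mem_alive _).1 hij.2.2
      exact ⟨hi, hj, (h.adj_iff ⟨i, hi⟩ ⟨j, hj⟩).1 hij.1, trivial, trivial⟩
    refine ⟨g, ⟨?_, ?_, ?_⟩, fun c => ?_⟩
    · intro i j hij
      obtain ⟨hi, hj, hadj⟩ := adj i j hij
      rw [hg i hi, hg j hj]
      exact hf.far _ _ hadj
    · intro i j hij
      obtain ⟨hi, hj, hadj⟩ := adj i j hij
      rw [hg i hi, hg j hj]
      exact hf.mid _ _ hadj
    · intro i hi h1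
      have hi' := (h.mem_alive _).1 hi
      rw [hg i hi'] at h1
      exact (h.mem_irr ⟨i, hi'⟩).2 (hf.loop _ trivial h1)
    · obtain ⟨v, -, hvc⟩ := hs c
      exact ⟨v, (h.mem_alive v).2 v.2, (hg v v.2).trans hvc⟩

theorem holds_of_rows {n : ℕ} {G : PRGraph (Fin n)} {s : State} (h0 : s.reg 0 = n)
    (harr : ∀ a ≠ 1, s.arr a = (input G).arr a) (h1 : ∀ i < n, s.arr 1 i = i * n) :
    Holds G s := by
  refine ⟨h0, fun i j => ?_, fun i => ?_, fun i => ?_⟩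
  · rw [harr 0 (by omega), h1 i i.2]
    simp only [input, true_and, ne_eq, ite_eq_right_iff, one_ne_zero, imp_false, not_not]
    constructor
    · rintro ⟨i', j', hk, he⟩
      -- Division with remainder recovers row and column from the matrix index.
      have hj : (j : ℕ) = j' := by
        have := congrArg (· % n) hk
        simpa [Nat.mul_add_mod', Nat.mod_eq_of_lt j.2, Nat.mod_eq_of_lt j'.2] using this
      have hi : (i : ℕ) = i' := by
        have hn : 0 < n := i.pos
        rw [hj] at hk
        exact Nat.eq_of_mul_eq_mul_right hn (Nat.add_right_cancel hk)
      rwa [Fin.ext hi, Fin.ext hj]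
    · exact fun he => ⟨i, j, rfl, he⟩
  · rw [harr 2 (by omega)]
    simp [input]
  · rw [harr 3 (by omega)]
    simp [input]

theorem polyTimeSolvableOn_hasStableCut :
    PolyTimeSolvableOn (fun _ G => G.IsH2221C3Free) (fun _ G => G.HasStableCut) := by
  obtain ⟨c, p, hc⟩ := exists_runs_hasCut
  refine ⟨.seq rows c, 4 + Polynomial.X * 6 + p, fun n G hG => ?_⟩
  have h0 : (input G).reg 0 = n := by simp [input]
  have := (runs_rows (input G)).seq (Q := fun s' => (G.HasStableCut → s'.reg 0 = 1) ∧
    (¬ G.HasStableCut → s'.reg 0 = 0)) (d := c) (T' := p.eval n) fun s ⟨hs, harr, h1⟩ => ?_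
  · obtain ⟨t, s, he, ht, hQ⟩ := this
    refine ⟨t, s, he, ?_, hQ⟩
    rw [h0] at ht
    simpa using ht
  · rw [h0] at hs h1
    have hh := holds_of_rows hs harr h1
    have := hc s (hh.noH2221C3 (noH2221C3_of_free hG.1 hG.2))
    rw [hh.hasCut_iff, hs] at this
    exact this

end RAM

theorem mainTheorem6 :
    RAM.PolyTimeSolvableOn (fun _ G => G.IsH2221C3Free) (fun _ G => G.HasStableCut) ∧
    ∀ (n : ℕ) (G : PRGraph (Fin n)), G.IsH2221C3Free → G.IsReduced →
      G.graph.IsIndepSet G.irreflexive ∧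
      (G.HasStableCut ↔ G.IsCutset G.irreflexive) := by
  refine ⟨RAM.polyTimeSolvableOn_hasStableCut, fun n G hG hR => ?_⟩
  have hG' := SimpleGraph.noH2221C3_of_free hG.1 hG.2
  exact ⟨hR.isIndepSet hG', hR.hasStableCut_iff hG'⟩
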